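/- Let $N\ge 1$ and $0<\ell<1/2$. Then there exist constants $C_*>0$ and $T_*\in(0,1)$, depending only on $N$ and $\ell$, with the following property. Let $H\in C(\mathbf R^N)\cap C^1(\mathbf R^N\setminus\{0\})$ be a norm on $\mathbf R^N$, that is, $H\ge 0$, $H(\xi)=0$ if and only if $\xi=0$, $H$ is convex, and $H(\alpha\xi)=|\alpha|H(\xi)$ for $\alpha\in\mathbf R$, $\xi\in\mathbf R^N$. Assume that its unit ball is strictly convex (the unit sphere of $H$ contains no nontrivial segment). Let $H_0(x)=\sup_{\xi\ne0}\frac{x\cdot\xi}{H(\xi)}$ be the dual norm and $B_{H_0}(x,r)=\{y\in\mathbf R^N: H_0(y-x)<r\}$. Let $R\ge1$, $\Omega=B_{H_0}(0,R)$, $\phi\in C_0^\infty(\Omega)$, and let $$u\in W^{1,2}(0,\infty;L^2(\Omega))\cap C([0,\infty);H^1_0(\Omega))$$ be a strong solution of the Cauchy–Dirichlet problem for the Finsler heat equation $$\partial_t u=\operatorname{div}\bigl(H(\nabla u)\nabla_\xi H(\nabla u)\bigr)\ \text{ in }\Omega\times(0,\infty),\qquad u=0\ \text{ on }\partial\Omega\times(0,\infty),\qquad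 u(\cdot,0)=\phi\ \text{ in }\Omega,$$ where $H(\xi)\nabla_\xi H(\xi)$ is taken to be $0$ at $\xi=0$; that is, $u(0)=\phi$ in $L^2(\Omega)$ and, for almost every $t>0$, the equation holds in the sense of distributions on $\Omega$ with $\partial_tu(t)\in L^2(\Omega)$. Then, with $h(y,t)=H_0(y)^2(1+t^\ell)$, $$\sup_{x\in\Omega}\int_{\Omega\cap B_{H_0}(x,1)}e^{-h(y,t)}|u(y,t)|\,dy\le C_*\sup_{x\in\Omega}\int_{\Omega\cap B_{H_0}(x,1)}e^{-H_0(y)^2}|\phi(y)|\,dy\qquad\text{for all }t\in(0,T_*].$$ -/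

import Mathlib

open MeasureTheory Set
open scoped ENNReal ContDiff

noncomputable section

namespace FinslerHeat

/-- `ℝ^N` with its Euclidean inner product and Lebesgue measure. -/
abbrev Space (N : ℕ) : Type := EuclideanSpace ℝ (Fin N)

/-- The standing assumptions on `H`: a norm on `ℝ^N` that is continuous, of class `C^1` away from
the origin, and whose unit ball is strictly convex.  Strict convexity is stated for the closed unit
ball: it says that the unit sphere contains no nontrivial segment (Mathlib's `StrictConvex` holds
for every open convex set, so for the open ball it would say nothing). -/
structure IsFinslerNorm {N : ℕ} (H : Space N → ℝ) : Prop where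
  nonneg : ∀ ξ, 0 ≤ H ξ
  eq_zero_iff : ∀ ξ, H ξ = 0 ↔ ξ = 0
  convexOn : ConvexOn ℝ univ H
  homogeneous : ∀ (α : ℝ) (ξ : Space N), H (α • ξ) = |α| * H ξ
  continuous : Continuous H
  contDiffOn : ContDiffOn ℝ 1 H {0}ᶜ
  strictConvex : StrictConvex ℝ {ξ | H ξ ≤ 1}

/-- The dual norm `H₀(x) = sup_{ξ ≠ 0} (x · ξ) / H(ξ)`. -/
def dualNorm {N : ℕ} (H : Space N → ℝ) (x : Space N) : ℝ :=
  ⨆ ξ : {ξ : Space N // ξ ≠ 0}, inner ℝ x ξ.1 / H ξ.1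

/-- The open ball `B_{H₀}(x, R) = {y : H₀(y - x) < R}`. -/
def dualBall {N : ℕ} (H : Space N → ℝ) (x : Space N) (R : ℝ) : Set (Space N) :=
  {y | dualNorm H (y - x) < R}

/-- The flux `A(ξ) = H(ξ) ∇H(ξ)`, which is `0` at `ξ = 0` because `H(0) = 0`; the Finsler-Laplace
operator is `Δ_H u = div A(∇u)`. -/
def flux {N : ℕ} (H : Space N → ℝ) (ξ : Space N) : Space N :=
  H ξ • gradient H ξ

/-- `θ ∈ C_0^∞(Ω)`: smooth, with compact support contained in `Ω`. -/
structure IsTestFunction {N : ℕ} (Ω : Set (Space N)) (θ : Space N → ℝ) : Prop where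
  contDiff : ContDiff ℝ ∞ θ
  hasCompactSupport : HasCompactSupport θ
  tsupport_subset : tsupport θ ⊆ Ω

/-- `L²(Ω)`. -/
abbrev L2 {N : ℕ} (Ω : Set (Space N)) : Type := Lp ℝ 2 (volume.restrict Ω)

/-- `L²(Ω; ℝ^N)`. -/
abbrev L2Vec {N : ℕ} (Ω : Set (Space N)) : Type := Lp (Space N) 2 (volume.restrict Ω)

/-- The Sobolev space `H_0^1(Ω)`, as the set of pairs `(w, ∇w)`: the closure in
`L²(Ω) × L²(Ω; ℝ^N)` of the pairs `(θ, ∇θ)` with `θ ∈ C_0^∞(Ω)`.  The second component is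
the weak gradient of the first, and the topology induced by the product is that of the `H^1` norm. -/
def sobolevH10 {N : ℕ} (Ω : Set (Space N)) : Set (L2 Ω × L2Vec Ω) :=
  closure {p | ∃ θ : Space N → ℝ, IsTestFunction Ω θ ∧
    (∀ᵐ y ∂(volume.restrict Ω), p.1 y = θ y) ∧
    (∀ᵐ y ∂(volume.restrict Ω), p.2 y = gradient θ y)}

/-- `u ∈ W^{1,2}(0, ∞; X)` with weak derivative `v`: both are in `L²(0, ∞; X)` and
`∫ χ' u dt = - ∫ χ v dt` for all `χ ∈ C_0^∞(0, ∞)`. -/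
structure HasW12Deriv {X : Type*} [NormedAddCommGroup X] [NormedSpace ℝ X]
    (u v : ℝ → X) : Prop where
  memLp : MemLp u 2 (volume.restrict (Ioi 0))
  memLp_deriv : MemLp v 2 (volume.restrict (Ioi 0))
  integral_eq : ∀ χ : ℝ → ℝ, ContDiff ℝ ∞ χ → HasCompactSupport χ → tsupport χ ⊆ Ioi 0 →
    ∫ t in Ioi (0 : ℝ), deriv χ t • u t = - ∫ t in Ioi (0 : ℝ), χ t • v t

/-- `u` is a (strong) solution of the Cauchy-Dirichlet problem
`∂_t u = Δ_H u` in `Ω × (0, ∞)`, `u = 0` on `∂Ω × (0, ∞)`, `u(·, 0) = φ` in `Ω`,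
in the class `W^{1,2}(0, ∞; L²(Ω)) ∩ C([0, ∞); H_0^1(Ω))`.
Here `v = ∂_t u` and `G = ∇u`; the equation holds in the sense of distributions on `Ω`
for almost every `t > 0`. Only the values `u t` with `t ≥ 0` matter. -/
def IsSolution {N : ℕ} (H : Space N → ℝ) (Ω : Set (Space N)) (φ : Space N → ℝ)
    (u : ℝ → L2 Ω) : Prop :=
  ∃ (v : ℝ → L2 Ω) (G : ℝ → L2Vec Ω),
    HasW12Deriv u v ∧
    ContinuousOn u (Ici 0) ∧
    ContinuousOn G (Ici 0) ∧
    (∀ t, 0 ≤ t → (u t, G t) ∈ sobolevH10 Ω) ∧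
    (∀ᵐ t ∂(volume.restrict (Ioi (0 : ℝ))), ∀ θ : Space N → ℝ, IsTestFunction Ω θ →
      (∫ y in Ω, v t y * θ y) + (∫ y in Ω, inner ℝ (flux H (G t y)) (gradient θ y)) = 0) ∧
    (∀ᵐ y ∂(volume.restrict Ω), u 0 y = φ y)

/-- The weight exponent `h(x, t) = H₀(x)² (1 + t^ℓ)`. -/
def weight {N : ℕ} (H : Space N → ℝ) (ℓ : ℝ) (x : Space N) (t : ℝ) : ℝ :=
  dualNorm H x ^ 2 * (1 + t ^ ℓ)

end FinslerHeat

end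

/-!
The proof is an `L¹` smoothing argument. Fix a point `x` of `Ω` and a smooth substitute `K` for
the dual norm `H₀`, with `H(∇K) ≤ 1`, and put `ψ(y) = K(y - x)`, `h = K² (1 + s^ℓ)`. All
quantities are compared with a bound `M` of the cutoff masses `E_x(s) = ∫ |u(s)| e^{-h - ψ}`,
uniform in `x ∈ Ω` and in small times `s`. The claim is that each of them satisfies `E_x(t) ≤
E_x(0) + M g(t)`, where `g` depends only on `N` and `ℓ` and `g(0) = 0` (`mass_le_add_growth`). On
the time interval where `g ≤ 1/2` the masses then at most double (`mass_le_two_mul`). Passing from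
the cutoff `e^{-ψ}` to unit balls and back, by averaging over balls
(`lintegral_mul_exp_le_of_ball`), gives the theorem.

To bound the growth of `E_x`, the equation is tested with `sgn(u) e^{-h - ψ}`. Differentiating the
weight in time produces the good term `-(ℓ / s) s^ℓ K² |u|`, while the flux, which is as large as
`H(∇u)`, meets a gradient of the weight as large as `1 + K`. There is no control of `∇u` in `L¹`,
so the energy `λ s^{1/2} ∫ |u|^q (1 + κ s^ℓ K²) e^{-q h - ψ}` with `q = 1 + 1/(2N)` is added: its
dissipation `|u|^{q-2} H(∇u)²` absorbs the flux by Young's inequality, and what remains is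
absorbed by the good term up to a multiple of `M s^{γ-1}` with `γ > 0`; this is where `ℓ < 1/2`
enters (`remainder_le`). The derivative of `s^{1/2}` leaves a multiple of `λ s^{-1/2} ∫ |u|^q
e^{-q h - ψ}`, which is bounded, at the scale `r² ~ s`, by the dissipation and by a Nash
inequality that involves only the `L¹` norm (`nash_weighted`). With `λ = (M / |B|)^{1-q}`, `|B|`
being the volume of the unit ball of `H₀`, this bound is linear in `M` and independent of `H`. All
of these pointwise absorptions are collected in `integrand_add_le`, and integrated in
`integral_slopeIntegrand_add_le`.

Since `|u|^q` is not smooth, it is replaced by `(u² + δ²)^{q/2}`, and `δ → 0` at the end. The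
solution is only known to have a weak time derivative, so the masses are not differentiated:
convexity of the power bounds their left difference quotients by a pairing of the increment of `u`
with a fixed element of `H¹₀(Ω)` (`eventually_slope_weightedMass_lt`), and a comparison principle
that uses only left difference quotients replaces integration in time
(`sub_le_sub_of_left_slope`).
-/

namespace FinslerHeat

open Filter Topology

/-! ### The norm `H`, its dual norm and the flux -/

namespace IsFinslerNorm

open scoped Pointwise

variable {N : ℕ} {H : Space N → ℝ}

theorem map_zero (hH : IsFinslerNorm H) : H 0 = 0 := (hH.eq_zero_iff 0).2 rfl

theorem pos (hH : IsFinslerNorm H) {ξ : Space N} (h : ξ ≠ 0) : 0 < H ξ :=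
  lt_of_le_of_ne (hH.nonneg ξ) fun h0 => h ((hH.eq_zero_iff ξ).1 h0.symm)

theorem map_neg (hH : IsFinslerNorm H) (ξ : Space N) : H (-ξ) = H ξ := by
  simpa using hH.homogeneous (-1) ξ

theorem add_le (hH : IsFinslerNorm H) (ξ ζ : Space N) : H (ξ + ζ) ≤ H ξ + H ζ := by
  have h := hH.convexOn.2 (mem_univ ξ) (mem_univ ζ) (show (0 : ℝ) ≤ 1 / 2 by norm_num)
    (show (0 : ℝ) ≤ 1 / 2 by norm_num) (by norm_num)
  have h2 : H (ξ + ζ) = 2 * H ((1 / 2 : ℝ) • ξ + (1 / 2 : ℝ) • ζ) := by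
    rw [← smul_add, hH.homogeneous, abs_of_pos (by norm_num)]; ring
  simp only [smul_eq_mul] at h
  linarith

theorem exists_le_norm (hH : IsFinslerNorm H) : ∃ C, 0 < C ∧ ∀ ξ, H ξ ≤ C * ‖ξ‖ := by
  obtain ⟨C, hC⟩ := ((isCompact_sphere (0 : Space N) 1).bddAbove_image hH.continuous.continuousOn)
  refine ⟨max C 1, by positivity, fun ξ => ?_⟩
  rcases eq_or_ne ξ 0 with rfl | h
  · simp [hH.map_zero]
  · have h1 : H (‖ξ‖⁻¹ • ξ) ≤ C := hC ⟨_, by simp [norm_smul, h], rfl⟩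
    rw [hH.homogeneous, abs_of_nonneg (by positivity), inv_mul_le_iff₀ (by positivity)] at h1
    nlinarith [norm_nonneg ξ, le_max_left C 1]

theorem exists_norm_le (hH : IsFinslerNorm H) : ∃ c, 0 < c ∧ ∀ ξ, c * ‖ξ‖ ≤ H ξ := by
  obtain ⟨c, hc0, hc⟩ := (isCompact_sphere (0 : Space N) 1).exists_forall_le'
    hH.continuous.continuousOn (a := 0) (fun b hb => hH.pos (by rintro rfl; simp at hb))
  refine ⟨c, hc0, fun ξ => ?_⟩
  rcases eq_or_ne ξ 0 with rfl | h
  · simp [hH.map_zero]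
  · have h1 : c ≤ H (‖ξ‖⁻¹ • ξ) := hc _ (by simp [norm_smul, h])
    rwa [hH.homogeneous, abs_of_nonneg (by positivity), le_inv_mul_iff₀ (by positivity),
      mul_comm] at h1

theorem abs_sub_le (hH : IsFinslerNorm H) (ξ ζ : Space N) : |H ξ - H ζ| ≤ H (ξ - ζ) := by
  rw [abs_le]
  constructor
  · have := hH.add_le ξ (ζ - ξ)
    rw [add_sub_cancel, ← hH.map_neg (ζ - ξ), neg_sub] at this
    linarith
  · have := hH.add_le ζ (ξ - ζ)
    rw [add_sub_cancel] at this
    linarith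

theorem bddAbove_dual (hH : IsFinslerNorm H) (x : Space N) :
    BddAbove (range fun ξ : {ξ : Space N // ξ ≠ 0} => inner ℝ x ξ.1 / H ξ.1) := by
  obtain ⟨c, hc0, hc⟩ := hH.exists_norm_le
  refine ⟨‖x‖ / c, ?_⟩
  rintro _ ⟨⟨ξ, hξ⟩, rfl⟩
  have h1 := hH.pos hξ
  have h2 := real_inner_le_norm x ξ
  have h3 := hc ξ
  simp only
  rw [div_le_div_iff₀ h1 hc0]
  nlinarith [norm_nonneg x, norm_nonneg ξ]

/-- The duality inequality between `H₀` and `H`. -/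
theorem inner_le (hH : IsFinslerNorm H) (x ξ : Space N) :
    inner ℝ x ξ ≤ dualNorm H x * H ξ := by
  rcases eq_or_ne ξ 0 with rfl | h
  · simp [hH.map_zero]
  · rw [← div_le_iff₀ (hH.pos h)]
    exact le_ciSup (hH.bddAbove_dual x) ⟨ξ, h⟩

theorem dualNorm_le (hH : IsFinslerNorm H) {x : Space N} {a : ℝ} (ha : 0 ≤ a)
    (h : ∀ ξ, inner ℝ x ξ ≤ a * H ξ) : dualNorm H x ≤ a :=
  Real.iSup_le (fun ξ => (div_le_iff₀ (hH.pos ξ.2)).2 (h ξ)) ha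

theorem dualNorm_zero (_hH : IsFinslerNorm H) : dualNorm H 0 = 0 := by
  simp [dualNorm]

theorem dualNorm_pos (hH : IsFinslerNorm H) {x : Space N} (h : x ≠ 0) : 0 < dualNorm H x := by
  have h1 := hH.inner_le x x
  rw [real_inner_self_eq_norm_sq] at h1
  have h2 : 0 < ‖x‖ ^ 2 := by positivity
  exact pos_of_mul_pos_left (h2.trans_le h1) (hH.nonneg x)

theorem dualNorm_nonneg (hH : IsFinslerNorm H) (x : Space N) : 0 ≤ dualNorm H x := by
  rcases eq_or_ne x 0 with rfl | h
  · rw [hH.dualNorm_zero]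
  · exact (hH.dualNorm_pos h).le

theorem dualNorm_add_le (hH : IsFinslerNorm H) (x y : Space N) :
    dualNorm H (x + y) ≤ dualNorm H x + dualNorm H y := by
  refine hH.dualNorm_le (add_nonneg (hH.dualNorm_nonneg x) (hH.dualNorm_nonneg y)) fun ξ => ?_
  rw [inner_add_left, add_mul]
  exact add_le_add (hH.inner_le x ξ) (hH.inner_le y ξ)

theorem dualNorm_smul_le (hH : IsFinslerNorm H) (r : ℝ) (x : Space N) :
    dualNorm H (r • x) ≤ |r| * dualNorm H x := by
  refine hH.dualNorm_le (mul_nonneg (abs_nonneg r) (hH.dualNorm_nonneg x)) fun ξ => ?_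
  have h1 := hH.inner_le x (r • ξ)
  rw [hH.homogeneous, inner_smul_right] at h1
  rw [real_inner_smul_left]
  linarith

theorem dualNorm_smul (hH : IsFinslerNorm H) (r : ℝ) (x : Space N) :
    dualNorm H (r • x) = |r| * dualNorm H x := by
  refine le_antisymm (hH.dualNorm_smul_le r x) ?_
  rcases eq_or_ne r 0 with rfl | h
  · simpa using hH.dualNorm_nonneg 0
  · have h1 := hH.dualNorm_smul_le r⁻¹ (r • x)
    rw [smul_smul, inv_mul_cancel₀ h, one_smul, abs_inv] at h1
    rwa [le_inv_mul_iff₀ (abs_pos.2 h)] at h1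

theorem dualNorm_neg (hH : IsFinslerNorm H) (x : Space N) : dualNorm H (-x) = dualNorm H x := by
  simpa using hH.dualNorm_smul (-1) x

theorem dualNorm_sub_comm (hH : IsFinslerNorm H) (x y : Space N) :
    dualNorm H (x - y) = dualNorm H (y - x) := by
  rw [← hH.dualNorm_neg, neg_sub]

theorem exists_dualNorm_le (hH : IsFinslerNorm H) : ∃ C, 0 < C ∧ ∀ x, dualNorm H x ≤ C * ‖x‖ := by
  obtain ⟨c, hc0, hc⟩ := hH.exists_norm_le
  refine ⟨c⁻¹, by positivity, fun x => hH.dualNorm_le (by positivity) fun ξ => ?_⟩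
  have h2 := real_inner_le_norm x ξ
  have h3 : ‖ξ‖ ≤ c⁻¹ * H ξ := (le_inv_mul_iff₀ hc0).2 (hc ξ)
  nlinarith [norm_nonneg x, norm_nonneg ξ]

theorem exists_le_dualNorm (hH : IsFinslerNorm H) : ∃ c, 0 < c ∧ ∀ x, c * ‖x‖ ≤ dualNorm H x := by
  obtain ⟨C, hC0, hC⟩ := hH.exists_le_norm
  refine ⟨C⁻¹, by positivity, fun x => ?_⟩
  rcases eq_or_ne x 0 with rfl | h
  · simp [hH.dualNorm_zero]
  · have h1 := hH.inner_le x x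
    rw [real_inner_self_eq_norm_sq] at h1
    rw [inv_mul_le_iff₀ hC0]
    have h2 : 0 < ‖x‖ := norm_pos_iff.2 h
    have h3 := mul_le_mul_of_nonneg_left (hC x) (hH.dualNorm_nonneg x)
    nlinarith

theorem dualNorm_abs_sub_le (hH : IsFinslerNorm H) (x y : Space N) :
    |dualNorm H x - dualNorm H y| ≤ dualNorm H (x - y) := by
  rw [abs_le]
  constructor
  · have := hH.dualNorm_add_le x (y - x)
    rw [add_sub_cancel, hH.dualNorm_sub_comm] at this
    linarith
  · have := hH.dualNorm_add_le y (x - y)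
    rw [add_sub_cancel] at this
    linarith

theorem continuous_dualNorm (hH : IsFinslerNorm H) : Continuous (dualNorm H) := by
  obtain ⟨C, hC0, hC⟩ := hH.exists_dualNorm_le
  refine (LipschitzWith.of_dist_le_mul (K := ⟨C, hC0.le⟩) fun x y => ?_).continuous
  rw [Real.dist_eq, dist_eq_norm]
  exact (hH.dualNorm_abs_sub_le x y).trans (hC _)

theorem isOpen_dualBall (hH : IsFinslerNorm H) (x : Space N) (R : ℝ) : IsOpen (dualBall H x R) :=
  isOpen_lt (hH.continuous_dualNorm.comp (continuous_id.sub continuous_const)) continuous_const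

theorem measurableSet_dualBall (hH : IsFinslerNorm H) (x : Space N) (R : ℝ) :
    MeasurableSet (dualBall H x R) := (hH.isOpen_dualBall x R).measurableSet

theorem isBounded_dualBall (hH : IsFinslerNorm H) (x : Space N) (R : ℝ) :
    Bornology.IsBounded (dualBall H x R) := by
  obtain ⟨c, hc0, hc⟩ := hH.exists_le_dualNorm
  refine (Metric.isBounded_ball (x := x) (r := c⁻¹ * R)).subset fun y hy => ?_
  rw [Metric.mem_ball, dist_eq_norm, lt_inv_mul_iff₀ hc0]
  exact (hc _).trans_lt hy

theorem volume_dualBall_lt_top (hH : IsFinslerNorm H) (x : Space N) (R : ℝ) :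
    volume (dualBall H x R) < ⊤ := (hH.isBounded_dualBall x R).measure_lt_top

theorem mem_dualBall_self (hH : IsFinslerNorm H) (x : Space N) {R : ℝ} (hR : 0 < R) :
    x ∈ dualBall H x R := by
  simpa [dualBall, hH.dualNorm_zero] using hR

theorem volume_dualBall_pos (hH : IsFinslerNorm H) (x : Space N) {R : ℝ} (hR : 0 < R) :
    0 < volume (dualBall H x R) :=
  (hH.isOpen_dualBall x R).measure_pos volume ⟨x, hH.mem_dualBall_self x hR⟩

theorem mem_dualBall_comm (hH : IsFinslerNorm H) {x y : Space N} {R : ℝ} :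
    x ∈ dualBall H y R ↔ y ∈ dualBall H x R := by
  simp only [dualBall, mem_ofPred_eq, hH.dualNorm_sub_comm x y]

theorem volume_dualBall (hH : IsFinslerNorm H) (x : Space N) {r : ℝ} (hr : 0 < r) :
    volume (dualBall H x r) = ENNReal.ofReal (r ^ N) * volume (dualBall H 0 1) := by
  have h1 : dualBall H x r = (fun y => y + -x) ⁻¹' (r • dualBall H 0 1) := by
    ext y
    rw [mem_preimage, mem_smul_set_iff_inv_smul_mem₀ hr.ne']
    simp only [dualBall, mem_ofPred_eq, sub_zero, hH.dualNorm_smul]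
    rw [abs_of_pos (by positivity), inv_mul_lt_iff₀ hr, mul_one, sub_eq_add_neg]
  rw [h1, measure_preimage_add_right, Measure.addHaar_smul]
  simp [abs_of_pos hr]

/-! #### The gradient of `H` -/

theorem differentiableAt (hH : IsFinslerNorm H) {ξ : Space N} (h : ξ ≠ 0) :
    DifferentiableAt ℝ H ξ :=
  (hH.contDiffOn.differentiableOn (by simp)).differentiableAt
    (isOpen_compl_singleton.mem_nhds h)

theorem inner_gradient_le (hH : IsFinslerNorm H) (ξ ζ : Space N) :
    inner ℝ (gradient H ξ) ζ ≤ H ζ := by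
  rw [inner_gradient_left]
  by_cases hd : DifferentiableAt ℝ H ξ
  · have h1 : HasDerivAt (fun t : ℝ => H (ξ + t • ζ)) (fderiv ℝ H ξ ζ) 0 :=
      hd.hasFDerivAt.hasLineDerivAt ζ
    rw [hasDerivAt_iff_tendsto_slope] at h1
    refine le_of_tendsto (h1.mono_left (nhdsGT_le_nhdsNE 0)) ?_
    filter_upwards [self_mem_nhdsWithin] with t (ht : 0 < t)
    rw [slope_def_field, sub_zero, zero_smul, add_zero, div_le_iff₀ ht]
    have := hH.add_le ξ (t • ζ)
    rw [hH.homogeneous, abs_of_pos ht] at this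
    linarith
  · rw [fderiv_zero_of_not_differentiableAt hd]
    exact hH.nonneg ζ

theorem inner_gradient_self (hH : IsFinslerNorm H) {ξ : Space N} (h : ξ ≠ 0) :
    inner ℝ (gradient H ξ) ξ = H ξ := by
  refine le_antisymm (hH.inner_gradient_le ξ ξ) ?_
  rw [inner_gradient_left]
  have h1 : HasDerivAt (fun t : ℝ => H (ξ + t • ξ)) (fderiv ℝ H ξ ξ) 0 :=
    (hH.differentiableAt h).hasFDerivAt.hasLineDerivAt ξ
  rw [hasDerivAt_iff_tendsto_slope] at h1
  refine ge_of_tendsto (h1.mono_left (nhdsGT_le_nhdsNE 0)) ?_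
  filter_upwards [self_mem_nhdsWithin] with t (ht : 0 < t)
  rw [slope_def_field, sub_zero, zero_smul, add_zero, le_div_iff₀ ht]
  have h2 : ξ + t • ξ = (1 + t) • ξ := by rw [add_smul, one_smul]
  rw [h2, hH.homogeneous, abs_of_pos (by linarith)]
  linarith

theorem dualNorm_gradient_le (hH : IsFinslerNorm H) (ξ : Space N) :
    dualNorm H (gradient H ξ) ≤ 1 :=
  hH.dualNorm_le zero_le_one fun ζ => by simpa using hH.inner_gradient_le ξ ζ

/-- The bidual of `H` is `H`: the gradient of `H` at `ζ` is a vector on which `ζ` attains its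
bidual norm. -/
theorem le_of_inner_le (hH : IsFinslerNorm H) {ζ : Space N} {c : ℝ} (hc : 0 ≤ c)
    (h : ∀ z, inner ℝ ζ z ≤ c * dualNorm H z) : H ζ ≤ c := by
  rcases eq_or_ne ζ 0 with rfl | h0
  · rwa [hH.map_zero]
  · rw [← hH.inner_gradient_self h0, real_inner_comm]
    exact (h _).trans (mul_le_of_le_one_right hc (hH.dualNorm_gradient_le ζ))

theorem inner_flux_self (hH : IsFinslerNorm H) (ξ : Space N) :
    inner ℝ (flux H ξ) ξ = H ξ ^ 2 := by
  rcases eq_or_ne ξ 0 with rfl | h0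
  · simp [hH.map_zero]
  · rw [flux, real_inner_smul_left, hH.inner_gradient_self h0]; ring

theorem inner_flux_le (hH : IsFinslerNorm H) (ξ ζ : Space N) :
    inner ℝ (flux H ξ) ζ ≤ H ξ * H ζ := by
  rw [flux, real_inner_smul_left]
  exact mul_le_mul_of_nonneg_left (hH.inner_gradient_le ξ ζ) (hH.nonneg ξ)

theorem abs_inner_flux_le (hH : IsFinslerNorm H) (ξ ζ : Space N) :
    |inner ℝ (flux H ξ) ζ| ≤ H ξ * H ζ := by
  rw [abs_le]
  refine ⟨?_, hH.inner_flux_le ξ ζ⟩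
  have := hH.inner_flux_le ξ (-ζ)
  rw [inner_neg_right, hH.map_neg] at this
  linarith

theorem exists_norm_flux_le (hH : IsFinslerNorm H) : ∃ C, 0 < C ∧ ∀ ξ, ‖flux H ξ‖ ≤ C * ‖ξ‖ := by
  obtain ⟨C, hC0, hC⟩ := hH.exists_le_norm
  refine ⟨C * C, by positivity, fun ξ => ?_⟩
  have h1 : ‖gradient H ξ‖ ≤ C := by
    have h2 := hH.inner_gradient_le ξ (gradient H ξ)
    rw [real_inner_self_eq_norm_sq] at h2
    have h3 := h2.trans (hC _)
    by_contra! h4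
    nlinarith
  rw [flux, norm_smul, Real.norm_of_nonneg (hH.nonneg ξ)]
  nlinarith [hC ξ, norm_nonneg ξ, hH.nonneg ξ, norm_nonneg (gradient H ξ),
    mul_le_mul (hC ξ) h1 (norm_nonneg _) (by positivity)]

theorem continuous_flux (hH : IsFinslerNorm H) : Continuous (flux H) := by
  rw [continuous_iff_continuousAt]
  intro ξ
  rcases eq_or_ne ξ 0 with rfl | h0
  · obtain ⟨C, hC0, hC⟩ := hH.exists_norm_flux_le
    have h1 : flux H 0 = 0 := by simp [flux, hH.map_zero]
    rw [ContinuousAt, h1]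
    refine squeeze_zero_norm hC ?_
    have : Continuous fun ξ : Space N => C * ‖ξ‖ := by fun_prop
    simpa using this.tendsto 0
  · have h1 : ContinuousOn (fderiv ℝ H) {0}ᶜ :=
      hH.contDiffOn.continuousOn_fderiv_of_isOpen isOpen_compl_singleton (by simp)
    have h2 : ContinuousAt (fderiv ℝ H) ξ := h1.continuousAt (isOpen_compl_singleton.mem_nhds h0)
    exact hH.continuous.continuousAt.smul
      ((InnerProductSpace.toDual ℝ (Space N)).symm.continuous.continuousAt.comp h2)

/-! #### A smooth substitute for the dual norm -/

/-- Mollification of `H₀`: a smooth function uniformly close to `H₀` whose gradient lies in the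
unit ball of `H`. -/
theorem exists_smooth_dualNorm (hH : IsFinslerNorm H) {ρ : ℝ} (hρ : 0 < ρ) :
    ∃ K : Space N → ℝ, ContDiff ℝ ∞ K ∧ (∀ x, 0 ≤ K x) ∧ (∀ x, |K x - dualNorm H x| ≤ ρ) ∧
      ∀ x, H (gradient K x) ≤ 1 := by
  obtain ⟨C, hC0, hC⟩ := hH.exists_dualNorm_le
  have hr : 0 < ρ / C := by positivity
  let b : ContDiffBump (0 : Space N) := ⟨ρ / C / 2, ρ / C, by positivity, by linarith⟩
  let K : Space N → ℝ :=
    convolution (b.normed volume) (dualNorm H) (ContinuousLinearMap.lsmul ℝ ℝ) volume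
  have hli : LocallyIntegrable (dualNorm H) (volume : Measure (Space N)) :=
    hH.continuous_dualNorm.locallyIntegrable
  have hsmooth : ContDiff ℝ ∞ K :=
    b.hasCompactSupport_normed.contDiff_convolution_left _ b.contDiff_normed hli
  have hKdef : ∀ x, K x = ∫ t, b.normed volume t * dualNorm H (x - t) := fun x => by
    simp [K, convolution]
  have hint : ∀ x, Integrable (fun t => b.normed volume t * dualNorm H (x - t)) := fun x =>
    (b.continuous_normed.mul (hH.continuous_dualNorm.comp
      (continuous_const.sub continuous_id))).integrable_of_hasCompactSupport
      (b.hasCompactSupport_normed.mul_right)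
  have hlip : ∀ x z, K (x + z) - K x ≤ dualNorm H z := fun x z => by
    rw [hKdef, hKdef, ← integral_sub (hint _) (hint _)]
    calc _ ≤ ∫ t, b.normed volume t * dualNorm H z := by
          refine integral_mono ((hint _).sub (hint _)) (b.integrable_normed.mul_const _) fun t => ?_
          simp only
          rw [← mul_sub]
          refine mul_le_mul_of_nonneg_left ?_ (b.nonneg_normed t)
          have := hH.dualNorm_add_le (x - t) z
          rw [show x + z - t = x - t + z by abel]
          linarith
      _ = dualNorm H z := by rw [integral_mul_const, b.integral_normed, one_mul]
  refine ⟨K, hsmooth, fun x => ?_, fun x => ?_, fun x => ?_⟩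
  · rw [hKdef]
    exact integral_nonneg fun t => mul_nonneg (b.nonneg_normed t) (hH.dualNorm_nonneg _)
  · rw [← Real.dist_eq]
    refine b.dist_normed_convolution_le hH.continuous_dualNorm.aestronglyMeasurable fun y hy => ?_
    rw [Real.dist_eq]
    refine (hH.dualNorm_abs_sub_le y x).trans ((hC _).trans ?_)
    rw [Metric.mem_ball, dist_eq_norm, lt_div_iff₀ hC0] at hy
    linarith
  · refine hH.le_of_inner_le zero_le_one fun z => ?_
    rw [inner_gradient_left, one_mul]
    have h1 : HasDerivAt (fun t : ℝ => K (x + t • z)) (fderiv ℝ K x z) 0 :=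
      (hsmooth.differentiable (by simp) x).hasFDerivAt.hasLineDerivAt z
    rw [hasDerivAt_iff_tendsto_slope] at h1
    refine le_of_tendsto (h1.mono_left (nhdsGT_le_nhdsNE 0)) ?_
    filter_upwards [self_mem_nhdsWithin] with t (ht : 0 < t)
    rw [slope_def_field, sub_zero, zero_smul, add_zero, div_le_iff₀ ht]
    have := hlip x (t • z)
    rw [hH.dualNorm_smul, abs_of_pos ht] at this
    linarith

/-! #### Exponentially weighted integrals and unit balls -/

theorem lintegral_exp_neg_half_dualNorm (hH : IsFinslerNorm H) (x : Space N) :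
    ∫⁻ y, ENNReal.ofReal (Real.exp (-(dualNorm H (y - x) / 2))) =
      ENNReal.ofReal (2 ^ N * N.factorial) * volume (dualBall H 0 1) := by
  rw [lintegral_sub_right_eq_self (fun y => ENNReal.ofReal (Real.exp (-(dualNorm H y / 2)))) x]
  have key := measure_lt_one_eq_integral_div_gamma (volume : Measure (Space N))
    (g := fun x => dualNorm H x / 2) (by simp [hH.dualNorm_zero])
    (fun x => by simp only [hH.dualNorm_neg])
    (fun x y => by linarith [hH.dualNorm_add_le x y])
    (fun {x} hx => by
      by_contra h
      have := hH.dualNorm_pos h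
      linarith)
    (fun r x => by linarith [hH.dualNorm_smul_le r x]) (p := 1) one_pos
  simp only [Real.rpow_one, div_one, finrank_euclideanSpace, Fintype.card_fin,
    Real.Gamma_nat_eq_factorial] at key
  have hset : {x | dualNorm H x / 2 < 1} = dualBall H 0 2 := by
    ext x
    simp only [dualBall, mem_ofPred_eq, sub_zero]
    exact div_lt_one two_pos
  rw [hset] at key
  have hfact : (0 : ℝ) < N.factorial := by exact_mod_cast N.factorial_pos
  rw [mul_comm (2 ^ N : ℝ), ENNReal.ofReal_mul hfact.le, mul_assoc,
    ← hH.volume_dualBall 0 two_pos, key, ← ENNReal.ofReal_mul hfact.le,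
    mul_div_cancel₀ _ hfact.ne']
  refine (ofReal_integral_eq_lintegral_ofReal ?_ (ae_of_all _ fun x => (Real.exp_pos _).le)).symm
  by_contra hni
  rw [integral_undef hni, zero_div, ENNReal.ofReal_zero] at key
  exact (hH.volume_dualBall_pos 0 two_pos).ne' key

/-- An exponentially weighted integral over `Ω` is controlled by the largest integral over a unit
ball centred in `Ω`.  Averaging over balls of radius `1 / 2` replaces a covering argument: such a
ball, if it meets `Ω`, lies in a unit ball centred in `Ω`. -/
theorem lintegral_mul_exp_le_of_ball (hH : IsFinslerNorm H) {Ω : Set (Space N)}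
    {f : Space N → ℝ≥0∞} (hf : Measurable f) {S : ℝ≥0∞}
    (hS : ∀ x ∈ Ω, ∫⁻ y in Ω ∩ dualBall H x 1, f y ≤ S) (x : Space N) :
    ∫⁻ y in Ω, f y * ENNReal.ofReal (Real.exp (-(dualNorm H (y - x) / 2))) ≤
      ENNReal.ofReal (Real.exp (1 / 4) * (4 ^ N * N.factorial)) * S := by
  set V := volume (dualBall H 0 (1 / 2)) with hV
  set e : Space N → ℝ≥0∞ := fun y => ENNReal.ofReal (Real.exp (-(dualNorm H (y - x) / 2))) with he
  have hVtop : V ≠ ⊤ := (hH.volume_dualBall_lt_top 0 _).ne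
  have hVpos : V ≠ 0 := (hH.volume_dualBall_pos 0 (by norm_num)).ne'
  have hcont := hH.continuous_dualNorm
  have hem : Measurable e := by
    refine ENNReal.measurable_ofReal.comp (Continuous.measurable ?_)
    exact Real.continuous_exp.comp
      ((hcont.comp (continuous_id.sub continuous_const)).div_const 2).neg
  let D : Set (Space N × Space N) := {p | dualNorm H (p.1 - p.2) < 1 / 2}
  have hD : MeasurableSet D :=
    (isOpen_lt (hcont.comp (continuous_fst.sub continuous_snd)) continuous_const).measurableSet
  have hsec : ∀ y : Space N, ∫⁻ z, D.indicator 1 (y, z) = V := fun y => by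
    have h1 : (fun z => D.indicator (1 : Space N × Space N → ℝ≥0∞) (y, z)) =
        (dualBall H y (1 / 2)).indicator 1 := by
      ext z
      by_cases hz : z ∈ dualBall H y (1 / 2)
      · rw [indicator_of_mem hz, indicator_of_mem]
        · rfl
        · exact hH.mem_dualBall_comm.1 hz
      · rw [indicator_of_notMem hz, indicator_of_notMem]
        exact fun h => hz (hH.mem_dualBall_comm.2 h)
    rw [h1, lintegral_indicator_one (hH.measurableSet_dualBall _ _)]
    exact (hH.volume_dualBall y (by norm_num)).trans (hH.volume_dualBall 0 (by norm_num)).symm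
  have h4 : ∀ z : Space N, ∫⁻ y in Ω, f y * e y * D.indicator 1 (y, z) ≤
      ENNReal.ofReal (Real.exp (1 / 4)) * e z * S := fun z => by
    have h5 : ∀ y, f y * e y * D.indicator 1 (y, z) ≤ ENNReal.ofReal (Real.exp (1 / 4)) * e z *
        (dualBall H z (1 / 2)).indicator f y := fun y => by
      by_cases hy : y ∈ dualBall H z (1 / 2)
      · have hy' : (y, z) ∈ D := hy
        rw [indicator_of_mem hy, indicator_of_mem hy', Pi.one_apply, mul_one, mul_comm]
        gcongr
        rw [he, ← ENNReal.ofReal_mul (Real.exp_pos _).le, ← Real.exp_add]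
        refine ENNReal.ofReal_le_ofReal (Real.exp_le_exp.2 ?_)
        have h6 := hH.dualNorm_add_le (y - x) (z - y)
        have h7 : dualNorm H (z - y) < 1 / 2 := by rw [hH.dualNorm_sub_comm]; exact hy
        rw [sub_add_sub_comm, sub_eq_add_neg, add_comm y z, add_comm x y] at h6
        rw [show z + y + -(y + x) = z - x by abel] at h6
        linarith
      · have hy' : (y, z) ∉ D := hy
        rw [indicator_of_notMem hy']; simp
    refine (lintegral_mono h5).trans ?_
    rw [lintegral_const_mul _ (hf.indicator (hH.measurableSet_dualBall _ _)),
      lintegral_indicator (hH.measurableSet_dualBall _ _),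
      Measure.restrict_restrict (hH.measurableSet_dualBall _ _)]
    gcongr
    by_cases hne : (dualBall H z (1 / 2) ∩ Ω).Nonempty
    · obtain ⟨x', hx', hx'Ω⟩ := hne
      refine (lintegral_mono_set ?_).trans (hS x' hx'Ω)
      rintro y ⟨hy, hyΩ⟩
      refine ⟨hyΩ, ?_⟩
      have h6 := hH.dualNorm_add_le (y - z) (z - x')
      rw [sub_add_sub_cancel, hH.dualNorm_sub_comm z x'] at h6
      have h7 : dualNorm H (y - z) < 1 / 2 := hy
      have h8 : dualNorm H (x' - z) < 1 / 2 := hx'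
      show dualNorm H (y - x') < 1
      linarith
    · rw [not_nonempty_iff_eq_empty.1 hne]; simp
  have hDm : Measurable (D.indicator (1 : Space N × Space N → ℝ≥0∞)) :=
    measurable_one.indicator hD
  have key : (∫⁻ y in Ω, f y * e y) * V ≤
      ENNReal.ofReal (Real.exp (1 / 4)) * (ENNReal.ofReal (2 ^ N * N.factorial) *
        volume (dualBall H 0 1)) * S := by
    calc (∫⁻ y in Ω, f y * e y) * V = ∫⁻ y in Ω, ∫⁻ z, f y * e y * D.indicator 1 (y, z) := by
          rw [← lintegral_mul_const V (f := fun y => f y * e y) (hf.mul hem)]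
          refine lintegral_congr fun y => ?_
          rw [lintegral_const_mul _ (f := fun z => D.indicator 1 (y, z))
            (hDm.comp measurable_prodMk_left), hsec]
      _ = ∫⁻ z, ∫⁻ y in Ω, f y * e y * D.indicator 1 (y, z) := by
          refine lintegral_lintegral_swap (Measurable.aemeasurable ?_)
          exact ((hf.mul hem).comp measurable_fst).mul hDm
      _ ≤ ∫⁻ z, ENNReal.ofReal (Real.exp (1 / 4)) * e z * S := lintegral_mono h4
      _ = _ := by
          rw [lintegral_mul_const _ (hem.const_mul _), lintegral_const_mul _ hem,
            hH.lintegral_exp_neg_half_dualNorm]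
  have hB : volume (dualBall H 0 1) = ENNReal.ofReal (2 ^ N) * V := by
    rw [hV, hH.volume_dualBall 0 (r := 1 / 2) (by norm_num), ← mul_assoc,
      ← ENNReal.ofReal_mul (by positivity), ← mul_pow]
    norm_num
  rw [← ENNReal.mul_le_mul_iff_left hVpos hVtop]
  refine key.trans (le_of_eq ?_)
  have h4 : (4 : ℝ) ^ N = 2 ^ N * 2 ^ N := by rw [← mul_pow]; norm_num
  rw [hB, h4, show Real.exp (1 / 4) * (2 ^ N * 2 ^ N * (N.factorial : ℝ)) =
      Real.exp (1 / 4) * ((2 ^ N * N.factorial) * 2 ^ N) by ring,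
    ENNReal.ofReal_mul (Real.exp_pos _).le,
    ENNReal.ofReal_mul (show (0 : ℝ) ≤ 2 ^ N * N.factorial by positivity)]
  ring

end IsFinslerNorm

/-! ### Regularized powers -/

/-- The smooth substitute `(a² + δ²)^{p/2}` for `|a|^p`. -/
noncomputable def regPow (δ p a : ℝ) : ℝ := (a ^ 2 + δ ^ 2) ^ (p / 2)

section regPow

variable {δ : ℝ}

theorem sq_add_sq_pos_of_pos (hδ : 0 < δ) (a : ℝ) : 0 < a ^ 2 + δ ^ 2 := by positivity

theorem regPow_pos (hδ : 0 < δ) (p a : ℝ) : 0 < regPow δ p a :=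
  Real.rpow_pos_of_pos (sq_add_sq_pos_of_pos hδ a) _

theorem contDiff_regPow (hδ : 0 < δ) (p : ℝ) : ContDiff ℝ ∞ (regPow δ p) := by
  unfold regPow
  exact ((contDiff_id.pow 2).add contDiff_const).rpow_const_of_ne
    fun a => (sq_add_sq_pos_of_pos hδ a).ne'

theorem continuous_regPow (hδ : 0 < δ) (p : ℝ) : Continuous (regPow δ p) :=
  (contDiff_regPow hδ p).continuous

theorem regPow_mul (hδ : 0 < δ) (p q a : ℝ) :
    regPow δ p a * regPow δ q a = regPow δ (p + q) a := by
  rw [regPow, regPow, regPow, ← Real.rpow_add (sq_add_sq_pos_of_pos hδ a), add_div]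

theorem regPow_two (a : ℝ) : regPow δ 2 a = a ^ 2 + δ ^ 2 := by simp [regPow]

theorem regPow_zero (a : ℝ) : regPow δ 0 a = 1 := by simp [regPow]

theorem regPow_eq_rpow (hδ : 0 < δ) (p a : ℝ) : regPow δ p a = regPow δ 1 a ^ p := by
  rw [regPow, regPow, ← Real.rpow_mul (sq_add_sq_pos_of_pos hδ a).le]; congr 1; ring

theorem hasDerivAt_regPow (hδ : 0 < δ) (p a : ℝ) :
    HasDerivAt (regPow δ p) (p * a * regPow δ (p - 2) a) a := by
  have h1 : HasDerivAt (fun a : ℝ => a ^ 2 + δ ^ 2) (2 * a) a := by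
    simpa using (hasDerivAt_pow 2 a).add_const (δ ^ 2)
  have h2 := h1.rpow_const (p := p / 2) (Or.inl (sq_add_sq_pos_of_pos hδ a).ne')
  refine h2.congr_deriv ?_
  rw [regPow, show (p - 2) / 2 = p / 2 - 1 by ring]; ring

theorem regPow_eq_add (hδ : 0 < δ) (p a : ℝ) :
    regPow δ p a = a ^ 2 * regPow δ (p - 2) a + δ ^ 2 * regPow δ (p - 2) a := by
  rw [← add_mul, ← regPow_two, regPow_mul hδ]; congr 1; ring

theorem sq_mul_regPow_le (hδ : 0 < δ) (p a : ℝ) : a ^ 2 * regPow δ (p - 2) a ≤ regPow δ p a := by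
  have := regPow_pos hδ (p - 2) a
  rw [regPow_eq_add hδ p a]
  nlinarith [mul_nonneg (sq_nonneg δ) this.le]

theorem le_regPow_one (a : ℝ) : |a| ≤ regPow δ 1 a := by
  rw [regPow, ← Real.sqrt_eq_rpow]
  exact Real.abs_le_sqrt (by nlinarith [sq_nonneg δ])

theorem regPow_one_le (hδ : 0 < δ) (a : ℝ) : regPow δ 1 a ≤ |a| + δ := by
  rw [regPow, ← Real.sqrt_eq_rpow]
  refine Real.sqrt_le_iff.2 ⟨by positivity, ?_⟩
  nlinarith [sq_abs a, mul_nonneg (abs_nonneg a) hδ.le]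

theorem delta_le_regPow_one (a : ℝ) : δ ≤ regPow δ 1 a := by
  rw [regPow, ← Real.sqrt_eq_rpow]
  exact Real.le_sqrt_of_sq_le (by nlinarith [sq_nonneg a])

theorem regPow_le_of_nonpos (hδ : 0 < δ) {p : ℝ} (hp : p ≤ 0) (a : ℝ) :
    regPow δ p a ≤ δ ^ p := by
  rw [regPow_eq_rpow hδ]
  exact Real.rpow_le_rpow_of_nonpos hδ (delta_le_regPow_one a) hp

theorem regPow_le_sq (hδ : 0 < δ) {p : ℝ} (hp : p ≤ 2) (a : ℝ) :
    regPow δ p a ≤ δ ^ (p - 2) * (a ^ 2 + δ ^ 2) := by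
  have h1 := regPow_mul hδ (p - 2) 2 a
  rw [sub_add_cancel, regPow_two] at h1
  rw [← h1]
  exact mul_le_mul_of_nonneg_right (regPow_le_of_nonpos hδ (by linarith) a) (by positivity)

theorem sq_mul_regPow_sub_two_le (hδ : 0 < δ) {p : ℝ} (hp2 : p ≤ 2) (a : ℝ) :
    δ ^ 2 * regPow δ (p - 2) a ≤ δ ^ p := by
  calc δ ^ 2 * regPow δ (p - 2) a ≤ δ ^ 2 * δ ^ (p - 2) := by
        gcongr; exact regPow_le_of_nonpos hδ (by linarith) a
    _ = δ ^ p := by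
        rw [← Real.rpow_natCast δ 2, ← Real.rpow_add hδ]; congr 1; push_cast; ring

/-- The derivative of `a ↦ a (a² + δ²)^{p/2}`. -/
noncomputable def derivMulRegPow (δ p a : ℝ) : ℝ :=
  regPow δ p a + p * (a ^ 2 * regPow δ (p - 2) a)

theorem hasDerivAt_mul_regPow (hδ : 0 < δ) (p a : ℝ) :
    HasDerivAt (fun a => a * regPow δ p a) (derivMulRegPow δ p a) a := by
  refine ((hasDerivAt_id a).mul (hasDerivAt_regPow hδ p a)).congr_deriv ?_
  simp only [derivMulRegPow, id]; ring

theorem contDiff_mul_regPow (hδ : 0 < δ) (p : ℝ) : ContDiff ℝ ∞ (fun a => a * regPow δ p a) :=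
  contDiff_id.mul (contDiff_regPow hδ p)

theorem le_derivMulRegPow (hδ : 0 < δ) {p : ℝ} (hp : p ≤ 0) (a : ℝ) :
    (1 + p) * regPow δ p a ≤ derivMulRegPow δ p a := by
  have := sq_mul_regPow_le hδ p a
  rw [derivMulRegPow]; nlinarith

theorem derivMulRegPow_le (hδ : 0 < δ) {p : ℝ} (hp : p ≤ 0) (a : ℝ) :
    derivMulRegPow δ p a ≤ regPow δ p a := by
  have := mul_nonneg (sq_nonneg a) (regPow_pos hδ (p - 2) a).le
  rw [derivMulRegPow]; nlinarith

theorem derivMulRegPow_nonneg (hδ : 0 < δ) {p : ℝ} (hp1 : -1 ≤ p) (hp : p ≤ 0) (a : ℝ) :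
    0 ≤ derivMulRegPow δ p a :=
  (mul_nonneg (by linarith) (regPow_pos hδ p a).le).trans (le_derivMulRegPow hδ hp a)

theorem abs_deriv_mul_regPow_le (hδ : 0 < δ) {p : ℝ} (hp1 : -1 ≤ p) (hp : p ≤ 0) (a : ℝ) :
    |deriv (fun a => a * regPow δ p a) a| ≤ δ ^ p := by
  rw [(hasDerivAt_mul_regPow hδ p a).deriv, abs_of_nonneg (derivMulRegPow_nonneg hδ hp1 hp a)]
  exact (derivMulRegPow_le hδ hp a).trans (regPow_le_of_nonpos hδ hp a)

theorem monotone_mul_regPow (hδ : 0 < δ) {p : ℝ} (hp1 : -1 ≤ p) (hp : p ≤ 0) :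
    Monotone (fun a => a * regPow δ p a) :=
  monotone_of_deriv_nonneg ((contDiff_mul_regPow hδ p).differentiable (by simp)) fun a => by
    rw [(hasDerivAt_mul_regPow hδ p a).deriv]; exact derivMulRegPow_nonneg hδ hp1 hp a

/-- The convex function `(b² + δ²)^{q/2} / q` lies above its tangents. -/
theorem regPow_sub_le (hδ : 0 < δ) {q : ℝ} (hq1 : 1 ≤ q) (hq2 : q ≤ 2) (a b : ℝ) :
    regPow δ q b / q - regPow δ q a / q ≤ b * regPow δ (q - 2) b * (b - a) := by
  have hd : ∀ x, HasDerivAt (fun x => regPow δ q x / q) (x * regPow δ (q - 2) x) x := fun x => by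
    refine ((hasDerivAt_regPow hδ q x).div_const q).congr_deriv ?_
    field_simp
  have hc : Continuous fun x => regPow δ q x / q := (continuous_regPow hδ q).div_const q
  have hm := monotone_mul_regPow hδ (p := q - 2) (by linarith) (by linarith)
  rcases lt_trichotomy a b with h | rfl | h
  · obtain ⟨c, hc1, hc2⟩ := exists_hasDerivAt_eq_slope (fun x => regPow δ q x / q) _ h
      hc.continuousOn fun x _ => hd x
    rw [eq_div_iff (by linarith)] at hc2
    rw [← hc2]
    exact mul_le_mul_of_nonneg_right (hm hc1.2.le) (by linarith)
  · simp
  · obtain ⟨c, hc1, hc2⟩ := exists_hasDerivAt_eq_slope (fun x => regPow δ q x / q) _ h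
      hc.continuousOn fun x _ => hd x
    rw [eq_div_iff (by linarith)] at hc2
    have := mul_le_mul_of_nonneg_right (hm hc1.1.le) (show 0 ≤ a - b by linarith)
    simp only at this
    linarith

theorem abs_regPow_sub_le (hδ : 0 < δ) {q : ℝ} (hq1 : 1 ≤ q) (hq2 : q ≤ 2) (a b : ℝ) :
    |regPow δ q b / q - regPow δ q a / q| ≤ δ ^ (q - 2) * (|a| + |b|) * |b - a| := by
  have hp : ∀ x y : ℝ, x * regPow δ (q - 2) x * (x - y) ≤
      δ ^ (q - 2) * (|y| + |x|) * |x - y| := fun x y => by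
    refine (le_abs_self _).trans ?_
    rw [abs_mul, abs_mul, abs_of_pos (regPow_pos hδ _ _), mul_comm |x|]
    gcongr
    · exact regPow_le_of_nonpos hδ (by linarith) x
    · exact le_add_of_nonneg_left (abs_nonneg y)
  rw [abs_le]
  have h1 := (regPow_sub_le hδ hq1 hq2 a b).trans (hp b a)
  have h2 := (regPow_sub_le hδ hq1 hq2 b a).trans (hp a b)
  rw [abs_sub_comm, add_comm |b|] at h2
  exact ⟨by linarith, h1⟩

end regPow

/-! ### A Nash inequality adapted to `H` -/

theorem sq_intervalIntegral_le {w : ℝ → ℝ} (hw : Continuous w) :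
    (∫ t in (0 : ℝ)..1, w t) ^ 2 ≤ ∫ t in (0 : ℝ)..1, w t ^ 2 := by
  set X := ∫ t in (0 : ℝ)..1, w t with hX
  have h0 : 0 ≤ ∫ t in (0 : ℝ)..1, (w t - X) ^ 2 :=
    intervalIntegral.integral_nonneg zero_le_one fun t _ => sq_nonneg _
  have h1 : ∫ t in (0 : ℝ)..1, (w t - X) ^ 2 =
      (∫ t in (0 : ℝ)..1, w t ^ 2) - 2 * X * X + X ^ 2 := by
    have h2 : ∀ t, (w t - X) ^ 2 = w t ^ 2 - 2 * X * w t + X ^ 2 := fun t => by ring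
    simp_rw [h2]
    rw [intervalIntegral.integral_add, intervalIntegral.integral_sub,
      intervalIntegral.integral_const_mul, ← hX]
    · simp
    all_goals exact Continuous.intervalIntegrable (by fun_prop) _ _
  nlinarith

theorem continuous_gradient {N : ℕ} {f : Space N → ℝ} (hf : ContDiff ℝ ∞ f) :
    Continuous (gradient f) :=
  (InnerProductSpace.toDual ℝ (Space N)).symm.continuous.comp (hf.continuous_fderiv (by simp))

theorem hasCompactSupport_gradient {N : ℕ} {f : Space N → ℝ} (hf : HasCompactSupport f) :
    HasCompactSupport (gradient f) := by
  refine (hf.fderiv (𝕜 := ℝ)).mono fun y hy h => hy ?_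
  rw [gradient, h, _root_.map_zero]

namespace IsFinslerNorm

variable {N : ℕ} {H : Space N → ℝ}

/-- The `L²` modulus of continuity is controlled by the `L²` norm of the gradient. -/
theorem lintegral_sq_sub_translate_le (hH : IsFinslerNorm H) {f : Space N → ℝ}
    (hf : ContDiff ℝ ∞ f) {r : ℝ} {z : Space N} (hz : dualNorm H z ≤ r) :
    ∫⁻ y, ENNReal.ofReal ((f y - f (y + z)) ^ 2) ≤
      ENNReal.ofReal (r ^ 2) * ∫⁻ y, ENNReal.ofReal (H (gradient f y) ^ 2) := by
  have hcg := continuous_gradient hf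
  have hr : 0 ≤ r := (hH.dualNorm_nonneg z).trans hz
  have hcH : Continuous fun y => H (gradient f y) ^ 2 := (hH.continuous.comp hcg).pow 2
  have h1 : ∀ y, ENNReal.ofReal ((f y - f (y + z)) ^ 2) ≤
      ∫⁻ t in Ioc (0 : ℝ) 1, ENNReal.ofReal (r ^ 2) *
        ENNReal.ofReal (H (gradient f (y + t • z)) ^ 2) := fun y => by
    have hw : Continuous fun t : ℝ => inner ℝ (gradient f (y + t • z)) z :=
      (hcg.comp (by fun_prop)).inner continuous_const
    have hftc : ∫ t in (0 : ℝ)..1, inner ℝ (gradient f (y + t • z)) z = f (y + z) - f y := by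
      have hd : ∀ t : ℝ, HasDerivAt (fun t : ℝ => f (y + t • z))
          (inner ℝ (gradient f (y + t • z)) z) t := fun t => by
        rw [inner_gradient_left]
        have h2 : HasDerivAt (fun t : ℝ => y + t • z) z t := by
          simpa using ((hasDerivAt_id t).smul_const z).const_add y
        exact ((hf.differentiable (by simp) (y + t • z)).hasFDerivAt).comp_hasDerivAt t h2
      rw [intervalIntegral.integral_eq_sub_of_hasDerivAt (fun t _ => hd t)
        (hw.intervalIntegrable _ _)]
      simp
    have h3 := sq_intervalIntegral_le hw
    rw [hftc] at h3
    have hc2 : Continuous fun t : ℝ => r ^ 2 * H (gradient f (y + t • z)) ^ 2 :=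
      continuous_const.mul (hcH.comp (by fun_prop))
    have h4 : ∫ t in (0 : ℝ)..1, inner ℝ (gradient f (y + t • z)) z ^ 2 ≤
        ∫ t in (0 : ℝ)..1, r ^ 2 * H (gradient f (y + t • z)) ^ 2 := by
      refine intervalIntegral.integral_mono zero_le_one ((hw.pow 2).intervalIntegrable _ _)
        (hc2.intervalIntegrable _ _) fun t => ?_
      simp only
      rw [← mul_pow, ← sq_abs]
      gcongr
      rw [abs_le]
      have hHn := hH.nonneg (gradient f (y + t • z))
      have h5 := hH.inner_le z (gradient f (y + t • z))
      have h6 := hH.inner_le (-z) (gradient f (y + t • z))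
      rw [hH.dualNorm_neg, inner_neg_left] at h6
      rw [real_inner_comm] at h5 h6
      constructor <;> nlinarith
    rw [← sq_abs, abs_sub_comm, sq_abs]
    refine (ENNReal.ofReal_le_ofReal (h3.trans h4)).trans (le_of_eq ?_)
    rw [intervalIntegral.integral_of_le zero_le_one, ofReal_integral_eq_lintegral_ofReal]
    · simp_rw [ENNReal.ofReal_mul (sq_nonneg r)]
    · exact (hc2.intervalIntegrable 0 1).1
    · exact ae_of_all _ fun t => by positivity
  refine (lintegral_mono h1).trans ?_
  rw [lintegral_lintegral_swap]
  · have h2 : ∀ t : ℝ, ∫⁻ y, ENNReal.ofReal (r ^ 2) *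
        ENNReal.ofReal (H (gradient f (y + t • z)) ^ 2) =
        ENNReal.ofReal (r ^ 2) * ∫⁻ y, ENNReal.ofReal (H (gradient f y) ^ 2) := fun t => by
      rw [lintegral_const_mul' _ _ ENNReal.ofReal_ne_top,
        lintegral_add_right_eq_self fun y => ENNReal.ofReal (H (gradient f y) ^ 2)]
    simp [h2]
  · refine Measurable.aemeasurable (Measurable.const_mul (ENNReal.measurable_ofReal.comp ?_) _)
    exact (hcH.comp (by fun_prop : Continuous fun p : Space N × ℝ => p.1 + p.2 • z)).measurable

theorem integrableOn_dualBall (hH : IsFinslerNorm H) {g : Space N → ℝ} (hg : Continuous g)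
    (x : Space N) (r : ℝ) : IntegrableOn g (dualBall H x r) := by
  have h1 := (hH.isBounded_dualBall x r).isCompact_closure
  exact (hg.continuousOn.integrableOn_compact h1).mono_set subset_closure

/-- Pointwise form of the Nash inequality: `f` is split into its average over the ball of
radius `r` and the rest, and both parts are estimated by Jensen's inequality. -/
theorem sq_le_average_add (hH : IsFinslerNorm H) {f : Space N → ℝ} (hfcont : Continuous f)
    {r q : ℝ} (hip : Integrable fun y => |f y| ^ (2 / q)) (hr : 0 < r) (hq1 : 1 ≤ q) (hq2 : q ≤ 2)
    (y : Space N) :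
    f y ^ 2 ≤ 2 * ((volume.real (dualBall H 0 r))⁻¹ *
        ∫ z in dualBall H 0 r, (f y - f (y + z)) ^ 2) +
      2 * ((∫ y, |f y| ^ (2 / q)) / volume.real (dualBall H 0 r)) ^ (q - 1) *
        ((volume.real (dualBall H 0 r))⁻¹ * ∫ z in dualBall H 0 r, |f (y + z)| ^ (2 / q)) := by
  set V := volume.real (dualBall H 0 r) with hV
  set b := dualBall H 0 r with hb
  set P := ∫ y, |f y| ^ (2 / q) with hP
  have hq0 : 0 < q := by linarith
  have hp0 : 0 < 2 / q := by positivity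
  have hp1 : 1 ≤ 2 / q := (one_le_div hq0).2 hq2
  have hVtop : volume b ≠ ⊤ := (hH.volume_dualBall_lt_top 0 r).ne
  have hV0' : volume b ≠ 0 := (hH.volume_dualBall_pos 0 hr).ne'
  have hV0 : 0 < V := ENNReal.toReal_pos hV0' hVtop
  have hct : Continuous fun z => f (y + z) := by fun_prop
  have hav : (⨍ z in b, f (y + z)) = V⁻¹ * ∫ z in b, f (y + z) := by
    rw [setAverage_eq, smul_eq_mul]
  have hav1 : (⨍ z in b, (f y - f (y + z))) = f y - ⨍ z in b, f (y + z) := by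
    rw [setAverage_eq, hav, integral_sub (hH.integrableOn_dualBall continuous_const _ _)
      (hH.integrableOn_dualBall hct _ _), smul_eq_mul, setIntegral_const, smul_eq_mul, mul_sub]
    congr 1
    rw [← mul_assoc, inv_mul_cancel₀ hV0.ne', one_mul]
  have hJ1 : (⨍ z in b, (f y - f (y + z))) ^ 2 ≤ V⁻¹ * ∫ z in b, (f y - f (y + z)) ^ 2 := by
    have := (even_two.convexOn_pow (𝕜 := ℝ)).map_set_average_le (μ := volume) (t := b)
      (f := fun z => f y - f (y + z)) (by fun_prop) isClosed_univ hV0' hVtop (by simp)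
      (hH.integrableOn_dualBall (by fun_prop) _ _)
      (hH.integrableOn_dualBall (by fun_prop) _ _)
    rwa [setAverage_eq volume (fun z => (f y - f (y + z)) ^ 2), smul_eq_mul] at this
  have hI : V⁻¹ * ∫ z in b, |f (y + z)| ^ (2 / q) ≤ P / V := by
    rw [div_eq_inv_mul P V]
    refine mul_le_mul_of_nonneg_left ?_ (inv_pos.2 hV0).le
    calc ∫ z in b, |f (y + z)| ^ (2 / q) ≤ ∫ z, |f (y + z)| ^ (2 / q) := by
          refine setIntegral_le_integral ?_ (ae_of_all _ fun z => by positivity)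
          exact hip.comp_add_left y
      _ = P := integral_add_left_eq_self (fun z => |f z| ^ (2 / q)) y
  have hI0 : 0 ≤ V⁻¹ * ∫ z in b, |f (y + z)| ^ (2 / q) :=
    mul_nonneg (by positivity) (integral_nonneg fun z => by positivity)
  have hJ2 : (⨍ z in b, |f (y + z)|) ^ (2 / q) ≤ V⁻¹ * ∫ z in b, |f (y + z)| ^ (2 / q) := by
    have := (convexOn_rpow hp1).map_set_average_le (μ := volume) (t := b)
      (f := fun z => |f (y + z)|)
      (Continuous.continuousOn (Real.continuous_rpow_const hp0.le)) isClosed_Ici hV0' hVtop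
      (by simp) (hH.integrableOn_dualBall hct.abs _ _)
      (hH.integrableOn_dualBall (hct.abs.rpow_const fun _ => Or.inr hp0.le) _ _)
    rwa [setAverage_eq volume (fun z => |f (y + z)| ^ (2 / q)), smul_eq_mul] at this
  have habs : |⨍ z in b, f (y + z)| ≤ ⨍ z in b, |f (y + z)| := by
    rw [setAverage_eq, setAverage_eq, smul_eq_mul, smul_eq_mul, abs_mul,
      abs_of_pos (inv_pos.2 hV0)]
    gcongr
    exact abs_integral_le_integral_abs
  have hc2 : (⨍ z in b, f (y + z)) ^ 2 ≤
      (P / V) ^ (q - 1) * (V⁻¹ * ∫ z in b, |f (y + z)| ^ (2 / q)) := by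
    set A := ⨍ z in b, |f (y + z)|
    set I := V⁻¹ * ∫ z in b, |f (y + z)| ^ (2 / q)
    have hA0 : 0 ≤ A := (abs_nonneg _).trans habs
    calc (⨍ z in b, f (y + z)) ^ 2 ≤ A ^ 2 := by rw [← sq_abs]; gcongr
      _ = (A ^ (2 / q)) ^ q := by
          rw [← Real.rpow_mul hA0, div_mul_cancel₀ _ hq0.ne', Real.rpow_two]
      _ ≤ I ^ q := by gcongr
      _ = I ^ (q - 1) * I := by
          rcases hI0.eq_or_lt with h | h
          · rw [← h, mul_zero, Real.zero_rpow hq0.ne']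
          · nth_rewrite 3 [← Real.rpow_one I]
            rw [← Real.rpow_add h, sub_add_cancel]
      _ ≤ (P / V) ^ (q - 1) * I := by gcongr
  have hsplit : f y = (⨍ z in b, (f y - f (y + z))) + ⨍ z in b, f (y + z) := by
    rw [hav1]; ring
  calc f y ^ 2 = ((⨍ z in b, (f y - f (y + z))) + ⨍ z in b, f (y + z)) ^ 2 := by rw [← hsplit]
    _ ≤ 2 * (⨍ z in b, (f y - f (y + z))) ^ 2 + 2 * (⨍ z in b, f (y + z)) ^ 2 := by
        nlinarith [sq_nonneg ((⨍ z in b, (f y - f (y + z))) - ⨍ z in b, f (y + z))]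
    _ ≤ _ := by linarith

/-- A Nash type inequality: the oscillation of `f` at scale `r` is controlled by its gradient,
and its average at scale `r` by a weaker Lebesgue norm. -/
theorem nash_smooth (hH : IsFinslerNorm H) {f : Space N → ℝ} (hf : ContDiff ℝ ∞ f)
    (hfc : HasCompactSupport f) {r : ℝ} (hr : 0 < r) {q : ℝ} (hq1 : 1 ≤ q) (hq2 : q ≤ 2) :
    ∫ y, f y ^ 2 ≤ 2 * r ^ 2 * (∫ y, H (gradient f y) ^ 2) +
      2 * (volume.real (dualBall H 0 r)) ^ (-(q - 1)) * (∫ y, |f y| ^ (2 / q)) ^ q := by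
  set V := volume.real (dualBall H 0 r) with hV
  set b := dualBall H 0 r with hb
  set P := ∫ y, |f y| ^ (2 / q) with hP
  have hq0 : 0 < q := by linarith
  have hp0 : 0 < 2 / q := by positivity
  have hp1 : 1 ≤ 2 / q := (one_le_div hq0).2 hq2
  have hVtop : volume b ≠ ⊤ := (hH.volume_dualBall_lt_top 0 r).ne
  have hV0' : volume b ≠ 0 := (hH.volume_dualBall_pos 0 hr).ne'
  have hV0 : 0 < V := ENNReal.toReal_pos hV0' hVtop
  have hbm : MeasurableSet b := hH.measurableSet_dualBall 0 r
  have hfcont := hf.continuous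
  have hcg := continuous_gradient hf
  have hcH : Continuous fun y => H (gradient f y) ^ 2 := (hH.continuous.comp hcg).pow 2
  have hcp : Continuous fun y => |f y| ^ (2 / q) :=
    hfcont.abs.rpow_const fun _ => Or.inr hp0.le
  have hP0 : 0 ≤ P := integral_nonneg fun y => by positivity
  have hip : Integrable fun y => |f y| ^ (2 / q) := by
    refine hcp.integrable_of_hasCompactSupport (hfc.mono fun y hy h => hy ?_)
    simp only [h, abs_zero, Real.zero_rpow hp0.ne']
  have hi2 : Integrable fun y => f y ^ 2 := by
    refine (hfcont.pow 2).integrable_of_hasCompactSupport (hfc.mono fun y hy h => hy ?_)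
    change f y ^ 2 = 0
    rw [show f y = 0 from h]; norm_num
  have hgc := hasCompactSupport_gradient hfc
  have hiH : Integrable fun y => H (gradient f y) ^ 2 := by
    refine hcH.integrable_of_hasCompactSupport (hgc.mono fun y hy h => hy ?_)
    simp only [h, hH.map_zero]; norm_num
  have hpt := hH.sq_le_average_add hfcont hip hr hq1 hq2
  -- integration over `y`, by Tonelli's theorem
  have hT1 : ∫⁻ y, ENNReal.ofReal (∫ z in b, (f y - f (y + z)) ^ 2) ≤
      ENNReal.ofReal (V * (r ^ 2 * ∫ y, H (gradient f y) ^ 2)) := by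
    calc _ = ∫⁻ y, ∫⁻ z in b, ENNReal.ofReal ((f y - f (y + z)) ^ 2) := by
          refine lintegral_congr fun y => ?_
          exact ofReal_integral_eq_lintegral_ofReal
            (hH.integrableOn_dualBall (by fun_prop) _ _) (ae_of_all _ fun z => sq_nonneg _)
      _ = ∫⁻ z in b, ∫⁻ y, ENNReal.ofReal ((f y - f (y + z)) ^ 2) := by
          refine lintegral_lintegral_swap (Measurable.aemeasurable ?_)
          exact ENNReal.measurable_ofReal.comp
            (by fun_prop : Continuous fun p : Space N × Space N =>
              (f p.1 - f (p.1 + p.2)) ^ 2).measurable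
      _ ≤ ∫⁻ z in b, ENNReal.ofReal (r ^ 2 * ∫ y, H (gradient f y) ^ 2) := by
          refine setLIntegral_mono' hbm fun z hz => ?_
          have hz' : dualNorm H z ≤ r := by
            have : dualNorm H (z - 0) < r := hz
            rw [sub_zero] at this; exact this.le
          refine (hH.lintegral_sq_sub_translate_le hf hz').trans (le_of_eq ?_)
          rw [ENNReal.ofReal_mul (sq_nonneg r),
            ofReal_integral_eq_lintegral_ofReal hiH (ae_of_all _ fun y => sq_nonneg _)]
      _ = _ := by
          rw [setLIntegral_const, mul_comm, ENNReal.ofReal_mul hV0.le, hV, measureReal_def,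
            ENNReal.ofReal_toReal hVtop]
  have hT2 : ∫⁻ y, ENNReal.ofReal (∫ z in b, |f (y + z)| ^ (2 / q)) ≤
      ENNReal.ofReal (V * P) := by
    calc _ = ∫⁻ y, ∫⁻ z in b, ENNReal.ofReal (|f (y + z)| ^ (2 / q)) := by
          refine lintegral_congr fun y => ?_
          exact ofReal_integral_eq_lintegral_ofReal
            (hH.integrableOn_dualBall (hcp.comp (by fun_prop)) _ _)
            (ae_of_all _ fun z => by positivity)
      _ = ∫⁻ z in b, ∫⁻ y, ENNReal.ofReal (|f (y + z)| ^ (2 / q)) := by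
          refine lintegral_lintegral_swap (Measurable.aemeasurable ?_)
          exact ENNReal.measurable_ofReal.comp (hcp.comp
            (by fun_prop : Continuous fun p : Space N × Space N => p.1 + p.2)).measurable
      _ = ∫⁻ z in b, ENNReal.ofReal P := by
          refine lintegral_congr fun z => ?_
          rw [lintegral_add_right_eq_self fun y => ENNReal.ofReal (|f y| ^ (2 / q)),
            ofReal_integral_eq_lintegral_ofReal hip (ae_of_all _ fun y => by positivity)]
      _ ≤ _ := by
          rw [setLIntegral_const, mul_comm, ENNReal.ofReal_mul hV0.le, hV, measureReal_def,
            ENNReal.ofReal_toReal hVtop]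
  have hm1 : Measurable fun y => ENNReal.ofReal (∫ z in b, (f y - f (y + z)) ^ 2) := by
    refine ENNReal.measurable_ofReal.comp (StronglyMeasurable.measurable ?_)
    exact StronglyMeasurable.integral_prod_right'
      (f := fun p : Space N × Space N => (f p.1 - f (p.1 + p.2)) ^ 2)
      (by fun_prop : Continuous fun p : Space N × Space N =>
        (f p.1 - f (p.1 + p.2)) ^ 2).stronglyMeasurable
  have hG0 : 0 ≤ ∫ y, H (gradient f y) ^ 2 := integral_nonneg fun y => sq_nonneg _
  have hc0 : 0 ≤ 2 * (P / V) ^ (q - 1) * V⁻¹ := by positivity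
  have hfin : ENNReal.ofReal (∫ y, f y ^ 2) ≤
      ENNReal.ofReal (2 * r ^ 2 * (∫ y, H (gradient f y) ^ 2) +
        2 * V ^ (-(q - 1)) * P ^ q) := by
    rw [ofReal_integral_eq_lintegral_ofReal hi2 (ae_of_all _ fun y => sq_nonneg _)]
    calc ∫⁻ y, ENNReal.ofReal (f y ^ 2) ≤
        ∫⁻ y, (ENNReal.ofReal (2 * V⁻¹) * ENNReal.ofReal (∫ z in b, (f y - f (y + z)) ^ 2) +
          ENNReal.ofReal (2 * (P / V) ^ (q - 1) * V⁻¹) *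
            ENNReal.ofReal (∫ z in b, |f (y + z)| ^ (2 / q))) := by
          refine lintegral_mono fun y => ?_
          rw [← ENNReal.ofReal_mul (by positivity), ← ENNReal.ofReal_mul hc0,
            ← ENNReal.ofReal_add]
          · refine ENNReal.ofReal_le_ofReal ((hpt y).trans (le_of_eq (by ring)))
          · exact mul_nonneg (by positivity) (integral_nonneg fun z => sq_nonneg _)
          · exact mul_nonneg hc0 (integral_nonneg fun z => by positivity)
      _ ≤ ENNReal.ofReal (2 * V⁻¹) * ENNReal.ofReal (V * (r ^ 2 * ∫ y, H (gradient f y) ^ 2)) +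
          ENNReal.ofReal (2 * (P / V) ^ (q - 1) * V⁻¹) * ENNReal.ofReal (V * P) := by
          rw [lintegral_add_left (hm1.const_mul _), lintegral_const_mul _ hm1,
            lintegral_const_mul' _ _ ENNReal.ofReal_ne_top]
          gcongr
      _ = _ := by
          rw [← ENNReal.ofReal_mul (by positivity), ← ENNReal.ofReal_mul hc0,
            ← ENNReal.ofReal_add (by positivity) (mul_nonneg hc0 (by positivity))]
          congr 1
          have h1 : P ^ q = P ^ (q - 1) * P := by
            rcases hP0.eq_or_lt with h | h
            · rw [← h, mul_zero, Real.zero_rpow hq0.ne']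
            · nth_rewrite 3 [← Real.rpow_one P]
              rw [← Real.rpow_add h, sub_add_cancel]
          rw [h1, Real.div_rpow hP0 hV0.le, Real.rpow_neg hV0.le]
          field_simp
  refine (ENNReal.ofReal_le_ofReal_iff ?_).1 hfin
  have : 0 ≤ P ^ q := Real.rpow_nonneg hP0 q
  have : 0 ≤ V ^ (-(q - 1)) := Real.rpow_nonneg hV0.le _
  positivity

end IsFinslerNorm

/-! ### Continuity of superposition operators on `L²` -/

section L2

variable {α : Type*} [MeasurableSpace α] {μ : Measure α}

theorem tendsto_toLp_of_dominated {E : Type*} [NormedAddCommGroup E] {f : ℕ → α → E}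
    (hf : ∀ n, MemLp (f n) 2 μ) {b : α → ℝ} (hb : MemLp b 2 μ)
    (hfb : ∀ n, ∀ᵐ x ∂μ, ‖f n x‖ ≤ b x)
    (hlim : ∀ᵐ x ∂μ, Tendsto (fun n => f n x) atTop (𝓝 0)) :
    Tendsto (fun n => ‖(hf n).toLp (f n)‖) atTop (𝓝 0) := by
  simp_rw [Lp.norm_toLp]
  rw [← ENNReal.toReal_zero]
  refine (ENNReal.tendsto_toReal ENNReal.zero_ne_top).comp ?_
  simp_rw [eLpNorm_eq_lintegral_rpow_enorm_toReal (two_ne_zero) (ENNReal.ofNat_ne_top),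
    ENNReal.toReal_ofNat]
  have h0 : Tendsto (fun n => ∫⁻ x, ‖f n x‖ₑ ^ (2 : ℝ) ∂μ) atTop (𝓝 0) := by
    have h1 := tendsto_lintegral_of_dominated_convergence' (μ := μ)
      (F := fun n x => ‖f n x‖ₑ ^ (2 : ℝ)) (f := fun _ => 0) (fun x => ‖b x‖ₑ ^ (2 : ℝ))
      (fun n => (hf n).1.enorm.pow_const _) ?_ ?_ ?_
    · simpa using h1
    · intro n
      filter_upwards [hfb n] with x hx
      refine ENNReal.rpow_le_rpow ?_ zero_le_two
      rw [enorm_le_iff_norm_le]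
      exact hx.trans (le_abs_self _)
    · have := lintegral_rpow_enorm_lt_top_of_eLpNorm_lt_top two_ne_zero ENNReal.ofNat_ne_top hb.2
      simpa using this.ne
    · filter_upwards [hlim] with x hx
      have h2 : Tendsto (fun n => ‖f n x‖ₑ) atTop (𝓝 0) := by
        simpa using hx.enorm
      have h3 := h2.ennrpow_const 2
      simpa using h3
  have h4 := h0.ennrpow_const (1 / 2)
  simpa using h4

theorem integral_mul_le_norm_mul_norm (f g : Lp ℝ 2 μ) :
    ∫ x, |f x| * |g x| ∂μ ≤ ‖f‖ * ‖g‖ := by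
  have h1 := real_inner_le_norm |f| |g|
  rw [norm_abs_eq_norm, norm_abs_eq_norm, L2.inner_def] at h1
  refine le_trans (le_of_eq (integral_congr_ae ?_)) h1
  filter_upwards [Lp.coeFn_abs f, Lp.coeFn_abs g] with x hx hy
  simp [hx, hy, mul_comm]

theorem integrable_mul_L2 (f g : Lp ℝ 2 μ) : Integrable (fun x => |f x| * |g x|) μ :=
  MemLp.integrable_mul (p := 2) (q := 2) (Lp.memLp f).abs (Lp.memLp g).abs

variable [IsFiniteMeasure μ]

/-- A superposition operator whose symbol is locally Lipschitz with linearly growing constant is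
locally Lipschitz from `L²` to `L¹`. -/
theorem integral_abs_comp_sub_le {F : ℝ → ℝ} {C : ℝ} (hC : 0 ≤ C)
    (hF : ∀ a b, |F b - F a| ≤ C * (1 + |a| + |b|) * |b - a|) (u v : Lp ℝ 2 μ) :
    ∫ x, |F (v x) - F (u x)| ∂μ ≤
      C * (‖(memLp_const (1 : ℝ) : MemLp (fun _ : α => (1 : ℝ)) 2 μ).toLp‖ + ‖u‖ + ‖v‖) *
        ‖v - u‖ := by
  set one := (memLp_const (1 : ℝ) : MemLp (fun _ : α => (1 : ℝ)) 2 μ).toLp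
  have i1 := integrable_mul_L2 one (v - u)
  have i2 := integrable_mul_L2 u (v - u)
  have i3 := integrable_mul_L2 v (v - u)
  calc ∫ x, |F (v x) - F (u x)| ∂μ
      ≤ ∫ x, C * (|one x| * |(v - u) x| + |u x| * |(v - u) x| + |v x| * |(v - u) x|) ∂μ := by
        refine integral_mono_of_nonneg (ae_of_all _ fun x => abs_nonneg _)
          (((i1.add i2).add i3).const_mul C) ?_
        filter_upwards [Lp.coeFn_sub v u, MemLp.coeFn_toLp (memLp_const (1 : ℝ) (μ := μ) (p := 2))]
          with x h1 h2
        have h3 := hF (u x) (v x)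
        rw [h1, h2, Pi.sub_apply]
        simp only [abs_one]
        linarith
    _ = C * (∫ x, |one x| * |(v - u) x| ∂μ + ∫ x, |u x| * |(v - u) x| ∂μ +
          ∫ x, |v x| * |(v - u) x| ∂μ) := by
        rw [integral_const_mul, integral_add
          (f := fun x => |one x| * |(v - u) x| + |u x| * |(v - u) x|) (i1.add i2) i3,
          integral_add i1 i2]
    _ ≤ C * (‖one‖ * ‖v - u‖ + ‖u‖ * ‖v - u‖ + ‖v‖ * ‖v - u‖) := by
        gcongr <;> exact integral_mul_le_norm_mul_norm _ _
    _ = _ := by ring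

theorem integrable_comp_L2 {F : ℝ → ℝ} (hFc : Continuous F) {C : ℝ}
    (hF : ∀ a, |F a| ≤ C * (1 + a ^ 2)) (u : Lp ℝ 2 μ) : Integrable (fun x => F (u x)) μ := by
  refine Integrable.mono' (((integrable_const (1 : ℝ)).add (Lp.memLp u).integrable_sq).const_mul C)
    (hFc.comp_aestronglyMeasurable (Lp.aestronglyMeasurable u)) (ae_of_all _ fun x => hF _)

/-- Superposition operators as in `integral_abs_comp_sub_le` are continuous. -/
theorem tendsto_integral_abs_comp_sub {F : ℝ → ℝ} {C : ℝ} (hC : 0 ≤ C)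
    (hF : ∀ a b, |F b - F a| ≤ C * (1 + |a| + |b|) * |b - a|) {ι : Type*} {l : Filter ι}
    {v : ι → Lp ℝ 2 μ} {u : Lp ℝ 2 μ} (hv : Tendsto v l (𝓝 u)) :
    Tendsto (fun i => ∫ x, |F (v i x) - F (u x)| ∂μ) l (𝓝 0) := by
  refine squeeze_zero (fun i => integral_nonneg fun x => abs_nonneg _)
    (fun i => integral_abs_comp_sub_le hC hF u (v i)) ?_
  have h1 : Tendsto (fun i => ‖v i - u‖) l (𝓝 0) := tendsto_iff_norm_sub_tendsto_zero.1 hv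
  have h2 := ((hv.norm.const_add
    (‖(memLp_const (1 : ℝ) : MemLp (fun _ : α => (1 : ℝ)) 2 μ).toLp‖ + ‖u‖)).const_mul C).mul h1
  simpa using h2

theorem abs_rpow_sub_le {s : ℝ} (hs1 : 1 ≤ s) (hs2 : s ≤ 2) (a b : ℝ) :
    |(|b| ^ s - |a| ^ s)| ≤ 2 * (1 + |a| + |b|) * |b - a| := by
  have key : ∀ x y : ℝ, 0 ≤ x → x ≤ y → y ^ s - x ^ s ≤ 2 * (1 + y) * (y - x) := by
    intro x y hx hxy
    rcases (hx.trans hxy).eq_or_lt with h | hy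
    · have : x = 0 := by linarith
      subst this; rw [← h]; simp
    · have h1 := one_add_mul_self_le_rpow_one_add (s := x / y - 1)
        (by have : 0 ≤ x / y := by positivity
            linarith) hs1
      rw [add_sub_cancel, Real.div_rpow hx hy.le, le_div_iff₀ (by positivity)] at h1
      have h2 : y ^ s = y ^ (s - 1) * y := by
        nth_rewrite 3 [← Real.rpow_one y]
        rw [← Real.rpow_add hy, sub_add_cancel]
      have h3 : y ^ (s - 1) ≤ 1 + y := by
        rcases le_total y 1 with h | h
        · exact (Real.rpow_le_one hy.le h (by linarith)).trans (by linarith)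
        · calc y ^ (s - 1) ≤ y ^ (1 : ℝ) := Real.rpow_le_rpow_of_exponent_le h (by linarith)
            _ ≤ 1 + y := by rw [Real.rpow_one]; linarith
      have h4 : y ^ s - x ^ s ≤ s * (1 - x / y) * y ^ s := by linarith
      have h5 : s * (1 - x / y) * y ^ s = s * (y - x) * y ^ (s - 1) := by
        rw [h2]; field_simp
      have h6 : 0 ≤ y - x := by linarith
      have h7 : 0 < y ^ (s - 1) := by positivity
      calc y ^ s - x ^ s ≤ s * (y - x) * y ^ (s - 1) := h4.trans h5.le
        _ ≤ 2 * (y - x) * (1 + y) := by gcongr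
        _ = _ := by ring
  have hmono : ∀ x y : ℝ, 0 ≤ x → x ≤ y → x ^ s ≤ y ^ s := fun x y hx hxy => by gcongr
  have habs := abs_abs_sub_abs_le b a
  have h0 := abs_nonneg a
  have h0' := abs_nonneg b
  rcases le_total |a| |b| with h | h
  · rw [abs_of_nonneg (by linarith [hmono _ _ h0 h])]
    rw [abs_of_nonneg (by linarith)] at habs
    have := key _ _ h0 h
    nlinarith
  · rw [abs_of_nonpos (by linarith [hmono _ _ h0' h])]
    rw [abs_of_nonpos (by linarith)] at habs
    have := key _ _ h0' h
    nlinarith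

end L2

/-! ### The space `H¹₀(Ω)` -/

section Sobolev

variable {N : ℕ} {Ω : Set (Space N)}

theorem gradient_comp_mul {F : ℝ → ℝ} {F' : ℝ} {θ η : Space N → ℝ} {y : Space N}
    (hF : HasDerivAt F F' (θ y)) (hθ : DifferentiableAt ℝ θ y) (hη : DifferentiableAt ℝ η y) :
    gradient (fun y => F (θ y) * η y) y =
      (F' * η y) • gradient θ y + F (θ y) • gradient η y := by
  have h1 : HasFDerivAt (fun y => F (θ y)) (F' • fderiv ℝ θ y) y :=
    hF.comp_hasFDerivAt y hθ.hasFDerivAt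
  have h2 : HasFDerivAt (fun y => F (θ y) * η y) _ y := h1.mul hη.hasFDerivAt
  rw [gradient, h2.fderiv, gradient, gradient, add_comm]
  simp only [map_add, map_smul, smul_smul, mul_comm]

theorem IsTestFunction.comp_mul {θ η : Space N → ℝ} (hθ : IsTestFunction Ω θ) {F : ℝ → ℝ}
    (hF : ContDiff ℝ ∞ F) (hF0 : F 0 = 0) (hη : ContDiff ℝ ∞ η) :
    IsTestFunction Ω (fun y => F (θ y) * η y) := by
  have hsub : Function.support (fun y => F (θ y) * η y) ⊆ Function.support θ := fun y hy h => by
    refine hy ?_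
    change F (θ y) * η y = 0
    rw [show θ y = 0 from h, hF0, zero_mul]
  exact ⟨(hF.comp hθ.contDiff).mul hη, hθ.hasCompactSupport.mono hsub,
    (closure_mono hsub).trans hθ.tsupport_subset⟩

section comp

variable {F F' : ℝ → ℝ} {L M : ℝ} {η : Space N → ℝ}

theorem memLp_comp_mul (hF : ContDiff ℝ ∞ F) (hFL : ∀ a b, |F a - F b| ≤ L * |a - b|)
    (hF0 : F 0 = 0) (hη : ContDiff ℝ ∞ η) (hηM : ∀ᵐ y ∂(volume.restrict Ω), |η y| ≤ M)
    (u : L2 Ω) : MemLp (fun y => F (u y) * η y) 2 (volume.restrict Ω) := by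
  refine (Lp.memLp u).of_le_mul (c := L * M) ((hF.continuous.comp_aestronglyMeasurable
    (Lp.aestronglyMeasurable u)).mul hη.continuous.aestronglyMeasurable) ?_
  filter_upwards [hηM] with y hy
  have h1 := hFL (u y) 0
  rw [hF0, sub_zero, sub_zero] at h1
  rw [norm_mul, Real.norm_eq_abs, Real.norm_eq_abs, Real.norm_eq_abs]
  calc |F (u y)| * |η y| ≤ (L * |u y|) * M :=
        mul_le_mul h1 hy (abs_nonneg _) ((abs_nonneg _).trans h1)
    _ = _ := by ring

theorem memLp_comp_smul (hF : ContDiff ℝ ∞ F) (hFL : ∀ a b, |F a - F b| ≤ L * |a - b|)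
    (hF0 : F 0 = 0) (hη : ContDiff ℝ ∞ η)
    (hηM : ∀ᵐ y ∂(volume.restrict Ω), ‖gradient η y‖ ≤ M)
    (u : L2 Ω) : MemLp (fun y => F (u y) • gradient η y) 2 (volume.restrict Ω) := by
  refine (Lp.memLp u).of_le_mul (c := L * M) ((hF.continuous.comp_aestronglyMeasurable
    (Lp.aestronglyMeasurable u)).smul (continuous_gradient hη).aestronglyMeasurable) ?_
  filter_upwards [hηM] with y hy
  have h1 := hFL (u y) 0
  rw [hF0, sub_zero, sub_zero] at h1
  rw [norm_smul, Real.norm_eq_abs, Real.norm_eq_abs]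
  calc |F (u y)| * ‖gradient η y‖ ≤ (L * |u y|) * M :=
        mul_le_mul h1 hy (norm_nonneg _) ((abs_nonneg _).trans h1)
    _ = _ := by ring

theorem memLp_mul_smul (hF'c : Continuous F') (hF' : ∀ a, |F' a| ≤ L) (hη : ContDiff ℝ ∞ η)
    (hηM : ∀ᵐ y ∂(volume.restrict Ω), |η y| ≤ M) (u : L2 Ω) (G : L2Vec Ω) :
    MemLp (fun y => (F' (u y) * η y) • G y) 2 (volume.restrict Ω) := by
  refine (Lp.memLp G).of_le_mul (c := L * M) (((hF'c.comp_aestronglyMeasurable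
    (Lp.aestronglyMeasurable u)).mul hη.continuous.aestronglyMeasurable).smul
    (Lp.aestronglyMeasurable G)) ?_
  filter_upwards [hηM] with y hy
  rw [norm_smul, norm_mul, Real.norm_eq_abs, Real.norm_eq_abs]
  gcongr
  · exact (abs_nonneg _).trans (hF' (u y))
  · exact hF' _

/-- Chain and product rule in `H¹₀(Ω)`: if `F` is smooth with bounded derivative and `F 0 = 0`,
and `η` is smooth and bounded with bounded gradient on `Ω`, then `F(u) η` belongs to `H¹₀(Ω)`. -/
theorem exists_mem_sobolevH10_comp (hF : ContDiff ℝ ∞ F) (hF0 : F 0 = 0)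
    (hd : ∀ a, HasDerivAt F (F' a) a) (hF' : ∀ a, |F' a| ≤ L) (hη : ContDiff ℝ ∞ η)
    (hηM : ∀ᵐ y ∂(volume.restrict Ω), |η y| ≤ M)
    (hηM' : ∀ᵐ y ∂(volume.restrict Ω), ‖gradient η y‖ ≤ M) {p : L2 Ω × L2Vec Ω}
    (hp : p ∈ sobolevH10 Ω) :
    ∃ P ∈ sobolevH10 Ω, (∀ᵐ y ∂(volume.restrict Ω), P.1 y = F (p.1 y) * η y) ∧
      ∀ᵐ y ∂(volume.restrict Ω),
        P.2 y = (F' (p.1 y) * η y) • p.2 y + F (p.1 y) • gradient η y := by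
  have hF'c : Continuous F' := by
    have : F' = deriv F := funext fun a => ((hd a).deriv).symm
    rw [this]; exact hF.continuous_deriv (by simp)
  have hFL : ∀ a b, |F a - F b| ≤ L * |a - b| := fun a b => by
    have := Convex.norm_image_sub_le_of_norm_hasDerivWithin_le (f := F) (f' := F') (C := L)
      (fun x _ => (hd x).hasDerivWithinAt) (fun x _ => hF' x) convex_univ (mem_univ b) (mem_univ a)
    simpa using this
  have m1 := memLp_comp_mul hF hFL hF0 hη hηM
  have m2 := memLp_comp_smul hF hFL hF0 hη hηM'
  have m3 := memLp_mul_smul hF'c hF' hη hηM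
  have m4 : ∀ u : L2 Ω, ∀ v : L2 Ω, ∀ G : L2Vec Ω,
      MemLp (fun y => ((F' (u y) - F' (v y)) * η y) • G y) 2 (volume.restrict Ω) := fun u v G => by
    refine ((m3 u G).sub (m3 v G)).ae_eq (ae_of_all _ fun y => ?_)
    simp [sub_mul, sub_smul]
  let T : L2 Ω × L2Vec Ω → L2 Ω × L2Vec Ω := fun p =>
    ((m1 p.1).toLp, (m3 p.1 p.2).toLp + (m2 p.1).toLp)
  have hT1 : ∀ p, ∀ᵐ y ∂(volume.restrict Ω), (T p).1 y = F (p.1 y) * η y := fun p =>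
    (m1 p.1).coeFn_toLp
  have hT2 : ∀ p, ∀ᵐ y ∂(volume.restrict Ω),
      (T p).2 y = (F' (p.1 y) * η y) • p.2 y + F (p.1 y) • gradient η y := fun p => by
    filter_upwards [Lp.coeFn_add (m3 p.1 p.2).toLp (m2 p.1).toLp, (m3 p.1 p.2).coeFn_toLp,
      (m2 p.1).coeFn_toLp] with y h1 h2 h3
    rw [show (T p).2 y = ((m3 p.1 p.2).toLp + (m2 p.1).toLp) y from rfl, h1, Pi.add_apply, h2, h3]
  refine ⟨T p, ?_, hT1 p, hT2 p⟩
  obtain ⟨x, hx, hxp⟩ := mem_closure_iff_seq_limit.1 hp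
  have hx1 : Tendsto (fun n => (x n).1) atTop (𝓝 p.1) := (continuous_fst.tendsto p).comp hxp
  have hx2 : Tendsto (fun n => (x n).2) atTop (𝓝 p.2) := (continuous_snd.tendsto p).comp hxp
  obtain ⟨ns, hns, hae⟩ := (tendstoInMeasure_of_tendsto_Lp hx1).exists_seq_tendsto_ae
  have hx1' := hx1.comp hns.tendsto_atTop
  have hx2' := hx2.comp hns.tendsto_atTop
  refine mem_closure_of_tendsto (f := fun n => T (x (ns n))) (b := atTop) ?_
    (Eventually.of_forall fun n => ?_)
  · have d1 : Tendsto (fun n => ‖(x (ns n)).1 - p.1‖) atTop (𝓝 0) :=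
      tendsto_iff_norm_sub_tendsto_zero.1 hx1'
    have d2 : Tendsto (fun n => ‖(x (ns n)).2 - p.2‖) atTop (𝓝 0) :=
      tendsto_iff_norm_sub_tendsto_zero.1 hx2'
    refine Tendsto.prodMk_nhds ?_ (Tendsto.add ?_ ?_)
    · refine tendsto_iff_norm_sub_tendsto_zero.2 (squeeze_zero (fun _ => norm_nonneg _)
        (g := fun n => L * M * ‖(x (ns n)).1 - p.1‖) (fun n => ?_) (by simpa using d1.const_mul _))
      refine Lp.norm_le_mul_norm_of_ae_le_mul ?_
      filter_upwards [Lp.coeFn_sub (m1 (x (ns n)).1).toLp (m1 p.1).toLp,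
        (m1 (x (ns n)).1).coeFn_toLp, (m1 p.1).coeFn_toLp, Lp.coeFn_sub (x (ns n)).1 p.1, hηM]
        with y h1 h2 h3 h4 h5
      rw [h1, h4, Pi.sub_apply, Pi.sub_apply, h2, h3, ← sub_mul, norm_mul]
      have h6 := hFL ((x (ns n)).1 y) (p.1 y)
      calc _ ≤ (L * |(x (ns n)).1 y - p.1 y|) * M :=
            mul_le_mul h6 h5 (by positivity) ((abs_nonneg _).trans h6)
        _ = _ := by rw [Real.norm_eq_abs]; ring
    · -- the coefficient `F'(uₙ)` converges only almost everywhere, so it is moved to the limit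
      -- gradient, where dominated convergence applies
      have e0 := tendsto_toLp_of_dominated (fun n => m4 (x (ns n)).1 p.1 p.2)
        (b := fun y => 2 * L * M * ‖p.2 y‖) ((Lp.memLp p.2).norm.const_mul _) (fun n => by
          filter_upwards [hηM] with y h5
          rw [norm_smul, norm_mul, Real.norm_eq_abs, Real.norm_eq_abs]
          have h6 : |F' ((x (ns n)).1 y) - F' (p.1 y)| ≤ 2 * L := by
            refine (abs_sub _ _).trans ?_
            linarith [hF' ((x (ns n)).1 y), hF' (p.1 y)]
          have h7 := mul_le_mul h6 h5 (abs_nonneg _) ((abs_nonneg _).trans h6)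
          exact mul_le_mul_of_nonneg_right h7 (norm_nonneg _)) (by
          filter_upwards [hae] with y h5
          have h6 := ((hF'c.tendsto (p.1 y)).comp h5).sub_const (F' (p.1 y))
          have h7 := (h6.mul_const (η y)).smul_const (p.2 y)
          simpa using h7)
      refine tendsto_iff_norm_sub_tendsto_zero.2 (squeeze_zero (fun _ => norm_nonneg _)
        (g := fun n => L * M * ‖(x (ns n)).2 - p.2‖ + ‖(m4 (x (ns n)).1 p.1 p.2).toLp‖)
        (fun n => ?_) (by simpa using (d2.const_mul (L * M)).add e0))
      have hsplit : (m3 (x (ns n)).1 (x (ns n)).2).toLp - (m3 p.1 p.2).toLp =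
          (m3 (x (ns n)).1 ((x (ns n)).2 - p.2)).toLp + (m4 (x (ns n)).1 p.1 p.2).toLp := by
        rw [← MemLp.toLp_sub, ← MemLp.toLp_add]
        refine MemLp.toLp_congr _ _ ?_
        filter_upwards [Lp.coeFn_sub (x (ns n)).2 p.2] with y h4
        simp only [Pi.sub_apply, Pi.add_apply, h4, smul_sub, sub_mul, sub_smul]
        abel
      rw [hsplit]
      refine (norm_add_le _ _).trans (add_le_add_left ?_ _)
      refine Lp.norm_le_mul_norm_of_ae_le_mul ?_
      filter_upwards [(m3 (x (ns n)).1 ((x (ns n)).2 - p.2)).coeFn_toLp, hηM] with y h1 h5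
      rw [h1, norm_smul, norm_mul, Real.norm_eq_abs, Real.norm_eq_abs]
      have h6 := hF' ((x (ns n)).1 y)
      exact mul_le_mul_of_nonneg_right
        (mul_le_mul h6 h5 (abs_nonneg _) ((abs_nonneg _).trans h6)) (norm_nonneg _)
    · refine tendsto_iff_norm_sub_tendsto_zero.2 (squeeze_zero (fun _ => norm_nonneg _)
        (g := fun n => L * M * ‖(x (ns n)).1 - p.1‖) (fun n => ?_) (by simpa using d1.const_mul _))
      refine Lp.norm_le_mul_norm_of_ae_le_mul ?_
      filter_upwards [Lp.coeFn_sub (m2 (x (ns n)).1).toLp (m2 p.1).toLp,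
        (m2 (x (ns n)).1).coeFn_toLp, (m2 p.1).coeFn_toLp, Lp.coeFn_sub (x (ns n)).1 p.1, hηM']
        with y h1 h2 h3 h4 h5
      rw [h1, h4, Pi.sub_apply, Pi.sub_apply, h2, h3, ← sub_smul, norm_smul]
      have h6 := hFL ((x (ns n)).1 y) (p.1 y)
      calc _ ≤ (L * |(x (ns n)).1 y - p.1 y|) * M :=
            mul_le_mul h6 h5 (by positivity) ((abs_nonneg _).trans h6)
        _ = _ := by rw [Real.norm_eq_abs]; ring
  · obtain ⟨θ, hθ, hθ1, hθ2⟩ := hx (ns n)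
    refine ⟨_, hθ.comp_mul hF hF0 hη, ?_, ?_⟩
    · filter_upwards [hT1 (x (ns n)), hθ1] with y h1 h2
      rw [h1, h2]
    · filter_upwards [hT2 (x (ns n)), hθ1, hθ2] with y h1 h2 h3
      rw [h1, h2, h3, gradient_comp_mul (hd _) (hθ.contDiff.differentiable (by simp) y)
        (hη.differentiable (by simp) y)]

end comp

end Sobolev

/-! ### The Nash inequality in `H¹₀(Ω)` -/

section L2

variable {α : Type*} [MeasurableSpace α] {μ : Measure α}

theorem norm_sq_eq_integral_sq (f : Lp ℝ 2 μ) : ‖f‖ ^ 2 = ∫ x, f x ^ 2 ∂μ := by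
  rw [← real_inner_self_eq_norm_sq, L2.inner_def]
  simp [sq]

theorem continuous_integral_comp_L2 [IsFiniteMeasure μ] {F : ℝ → ℝ} (hFc : Continuous F) {C C' : ℝ}
    (hC : 0 ≤ C) (hF : ∀ a b, |F b - F a| ≤ C * (1 + |a| + |b|) * |b - a|)
    (hF' : ∀ a, |F a| ≤ C' * (1 + a ^ 2)) :
    Continuous fun u : Lp ℝ 2 μ => ∫ x, F (u x) ∂μ := by
  refine continuous_iff_continuousAt.2 fun u => ?_
  refine tendsto_iff_dist_tendsto_zero.2 (squeeze_zero (fun _ => dist_nonneg) (fun v => ?_)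
    (tendsto_integral_abs_comp_sub (μ := μ) hC hF (tendsto_id (x := 𝓝 u))))
  rw [Real.dist_eq, ← integral_sub (integrable_comp_L2 hFc hF' v) (integrable_comp_L2 hFc hF' u)]
  exact abs_integral_le_integral_abs

end L2

namespace IsFinslerNorm

variable {N : ℕ} {H : Space N → ℝ} {Ω : Set (Space N)}

theorem exists_lipschitzWith (hH : IsFinslerNorm H) : ∃ C, LipschitzWith C H := by
  obtain ⟨C, hC0, hC⟩ := hH.exists_le_norm
  refine ⟨⟨C, hC0.le⟩, LipschitzWith.of_dist_le_mul fun x y => ?_⟩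
  rw [Real.dist_eq, dist_eq_norm]
  exact (hH.abs_sub_le x y).trans (hC _)

theorem continuous_integral_sq_comp (hH : IsFinslerNorm H) :
    Continuous fun G : L2Vec Ω => ∫ y in Ω, H (G y) ^ 2 := by
  obtain ⟨C, hC⟩ := hH.exists_lipschitzWith
  have h1 : (fun G : L2Vec Ω => ∫ y in Ω, H (G y) ^ 2) =
      fun G => ‖hC.compLp hH.map_zero G‖ ^ 2 := by
    funext G
    rw [norm_sq_eq_integral_sq]
    refine integral_congr_ae ?_
    filter_upwards [hC.coeFn_compLp hH.map_zero G] with y hy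
    rw [hy]; rfl
  rw [h1]
  exact (hC.continuous_compLp hH.map_zero).norm.pow 2

/-- The Nash type inequality in `H¹₀(Ω)`. -/
theorem nash (hH : IsFinslerNorm H) (hΩ : volume Ω ≠ ⊤) {p : L2 Ω × L2Vec Ω}
    (hp : p ∈ sobolevH10 Ω) {r : ℝ} (hr : 0 < r) {q : ℝ} (hq1 : 1 ≤ q) (hq2 : q ≤ 2) :
    ∫ y in Ω, p.1 y ^ 2 ≤ 2 * r ^ 2 * (∫ y in Ω, H (p.2 y) ^ 2) +
      2 * (volume.real (dualBall H 0 r)) ^ (-(q - 1)) *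
        (∫ y in Ω, |p.1 y| ^ (2 / q)) ^ q := by
  have hq0 : 0 < q := by linarith
  have hs1 : 1 ≤ 2 / q := (one_le_div hq0).2 hq2
  have hs2 : 2 / q ≤ 2 := div_le_self zero_le_two hq1
  have hs0 : 0 < 2 / q := by linarith
  have : IsFiniteMeasure (volume.restrict Ω) := ⟨by simpa using hΩ.lt_top⟩
  have c1 : Continuous fun p : L2 Ω × L2Vec Ω => ∫ y in Ω, p.1 y ^ 2 := by
    simp_rw [← norm_sq_eq_integral_sq]
    fun_prop
  have c2 : Continuous fun p : L2 Ω × L2Vec Ω => ∫ y in Ω, H (p.2 y) ^ 2 :=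
    hH.continuous_integral_sq_comp.comp continuous_snd
  have c3 : Continuous fun p : L2 Ω × L2Vec Ω => ∫ y in Ω, |p.1 y| ^ (2 / q) := by
    refine (continuous_integral_comp_L2 (C := 2) (C' := 4)
      (continuous_abs.rpow_const fun _ => Or.inr hs0.le) zero_le_two
      (abs_rpow_sub_le hs1 hs2) fun a => ?_).comp continuous_fst
    have h1 := abs_rpow_sub_le hs1 hs2 0 a
    rw [abs_zero, Real.zero_rpow hs0.ne', sub_zero, sub_zero] at h1
    refine h1.trans ?_
    have h2 := sq_abs a
    nlinarith [sq_nonneg (|a| - 1), abs_nonneg a]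
  refine closure_minimal ?_ (isClosed_le c1 ((c2.const_mul (2 * r ^ 2)).add
    ((c3.rpow_const fun _ => Or.inr hq0.le).const_mul _))) hp
  rintro p ⟨θ, hθ, h1, h2⟩
  have hz : ∀ y, y ∉ Ω → θ y = 0 := fun y hy =>
    image_eq_zero_of_notMem_tsupport fun h => hy (hθ.tsupport_subset h)
  have hz' : ∀ y, y ∉ Ω → gradient θ y = 0 := fun y hy => by
    have : fderiv ℝ θ y = 0 :=
      image_eq_zero_of_notMem_tsupport fun h => hy (hθ.tsupport_subset (tsupport_fderiv_subset ℝ h))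
    rw [gradient, this, _root_.map_zero]
  have e1 : ∫ y in Ω, p.1 y ^ 2 = ∫ y, θ y ^ 2 := by
    rw [← setIntegral_eq_integral_of_forall_compl_eq_zero (s := Ω) (f := fun y => θ y ^ 2)
      fun y hy => by rw [hz y hy]; norm_num]
    exact integral_congr_ae (h1.mono fun y hy => by simp only [hy])
  have e2 : ∫ y in Ω, H (p.2 y) ^ 2 = ∫ y, H (gradient θ y) ^ 2 := by
    rw [← setIntegral_eq_integral_of_forall_compl_eq_zero (s := Ω)
      (f := fun y => H (gradient θ y) ^ 2)
      fun y hy => by rw [hz' y hy, hH.map_zero]; norm_num]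
    exact integral_congr_ae (h2.mono fun y hy => by simp only [hy])
  have e3 : ∫ y in Ω, |p.1 y| ^ (2 / q) = ∫ y, |θ y| ^ (2 / q) := by
    rw [← setIntegral_eq_integral_of_forall_compl_eq_zero (s := Ω) (f := fun y => |θ y| ^ (2 / q))
      fun y hy => by rw [hz y hy, abs_zero, Real.zero_rpow hs0.ne']]
    exact integral_congr_ae (h1.mono fun y hy => by simp only [hy])
  simp only [mem_ofPred_eq]
  rw [e1, Pi.add_apply, e2, e3]
  exact hH.nash_smooth hθ.contDiff hθ.hasCompactSupport hr hq1 hq2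

/-! ### The weak formulation -/

theorem memLp_flux (hH : IsFinslerNorm H) (G : L2Vec Ω) :
    MemLp (fun y => flux H (G y)) 2 (volume.restrict Ω) := by
  obtain ⟨C, hC0, hC⟩ := hH.exists_norm_flux_le
  exact (Lp.memLp G).of_le_mul
    (hH.continuous_flux.comp_aestronglyMeasurable (Lp.aestronglyMeasurable G))
    (ae_of_all _ fun y => hC _)

/-- The flux of an `L²` vector field, as an element of `L²`. -/
noncomputable def fluxL2 (hH : IsFinslerNorm H) (G : L2Vec Ω) : L2Vec Ω :=
  (hH.memLp_flux G).toLp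

theorem coeFn_fluxL2 (hH : IsFinslerNorm H) (G : L2Vec Ω) :
    ∀ᵐ y ∂(volume.restrict Ω), hH.fluxL2 G y = flux H (G y) := (hH.memLp_flux G).coeFn_toLp

theorem continuous_fluxL2 (hH : IsFinslerNorm H) :
    Continuous (hH.fluxL2 : L2Vec Ω → L2Vec Ω) := by
  obtain ⟨C, hC0, hC⟩ := hH.exists_norm_flux_le
  refine continuous_iff_seqContinuous.2 fun x G hx => ?_
  refine tendsto_of_subseq_tendsto fun ns hns => ?_
  have hx1 := hx.comp hns
  obtain ⟨ms, hms, hae⟩ := (tendstoInMeasure_of_tendsto_Lp hx1).exists_seq_tendsto_ae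
  refine ⟨ms, ?_⟩
  have hx2 := hx1.comp hms.tendsto_atTop
  have d2 : Tendsto (fun n => ‖x (ns (ms n)) - G‖) atTop (𝓝 0) :=
    tendsto_iff_norm_sub_tendsto_zero.1 hx2
  -- the part of the difference of the fluxes that exceeds a multiple of `‖Gₙ - G‖` is dominated
  -- by a fixed function
  let e : ℕ → Space N → ℝ := fun n y =>
    max (‖flux H (x (ns (ms n)) y) - flux H (G y)‖ - C * ‖x (ns (ms n)) y - G y‖) 0
  have hle : ∀ n y, e n y ≤ 2 * C * ‖G y‖ := fun n y => by
    refine max_le ?_ (by positivity)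
    have h1 := norm_sub_le (flux H (x (ns (ms n)) y)) (flux H (G y))
    have h2 := hC (x (ns (ms n)) y)
    have h3 := hC (G y)
    have h4 := norm_sub_norm_le (x (ns (ms n)) y) (G y)
    nlinarith
  have hem : ∀ n, MemLp (e n) 2 (volume.restrict Ω) := fun n => by
    refine (Lp.memLp G).of_le_mul (c := 2 * C) ?_ (ae_of_all _ fun y => ?_)
    · have m1 := hH.continuous_flux.comp_aestronglyMeasurable
        (Lp.aestronglyMeasurable (x (ns (ms n))))
      have m2 := hH.continuous_flux.comp_aestronglyMeasurable (Lp.aestronglyMeasurable G)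
      have m3 := ((Lp.aestronglyMeasurable (x (ns (ms n)))).sub (Lp.aestronglyMeasurable G)).norm
      exact ((m1.sub m2).norm.sub (m3.const_mul C)).sup aestronglyMeasurable_const
    · rw [Real.norm_of_nonneg (le_max_right _ _)]
      exact hle n y
  have e0 := tendsto_toLp_of_dominated hem (b := fun y => 2 * C * ‖G y‖)
    ((Lp.memLp G).norm.const_mul _)
    (fun n => ae_of_all _ fun y => by
      rw [Real.norm_of_nonneg (le_max_right _ _)]
      exact hle n y) (by
    filter_upwards [hae] with y hy
    have h1 : Tendsto (fun n => x (ns (ms n)) y) atTop (𝓝 (G y)) := hy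
    have h2 := ((((hH.continuous_flux.tendsto (G y)).comp h1).sub_const (flux H (G y))).norm.sub
      ((h1.sub_const (G y)).norm.const_mul C)).max (tendsto_const_nhds (x := (0 : ℝ)))
    simpa using h2)
  refine tendsto_iff_norm_sub_tendsto_zero.2 (squeeze_zero (fun _ => norm_nonneg _)
    (g := fun n => ‖(hem n).toLp‖ + C * ‖x (ns (ms n)) - G‖) (fun n => ?_)
    (by simpa using e0.add (d2.const_mul C)))
  have hnm := (Lp.memLp (x (ns (ms n)) - G)).norm
  have h5 : ‖hH.fluxL2 (x (ns (ms n))) - hH.fluxL2 G‖ ≤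
      ‖(hem n).toLp + C • hnm.toLp‖ := by
    refine Lp.norm_le_norm_of_ae_le ?_
    filter_upwards [Lp.coeFn_sub (hH.fluxL2 (x (ns (ms n)))) (hH.fluxL2 G),
      hH.coeFn_fluxL2 (x (ns (ms n))), hH.coeFn_fluxL2 G, Lp.coeFn_add (hem n).toLp (C • hnm.toLp),
      Lp.coeFn_smul C hnm.toLp, (hem n).coeFn_toLp, hnm.coeFn_toLp,
      Lp.coeFn_sub (x (ns (ms n))) G] with y a1 a2 a3 a4 a5 a6 a7 a8
    rw [a1, a4, Pi.sub_apply, Pi.add_apply, a2, a3, a5, Pi.smul_apply, a6, a7, a8, Pi.sub_apply]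
    refine le_trans ?_ (le_abs_self _)
    have := le_max_left (‖flux H (x (ns (ms n)) y) - flux H (G y)‖ -
      C * ‖x (ns (ms n)) y - G y‖) 0
    simp only [smul_eq_mul, e]
    linarith
  refine h5.trans ((norm_add_le _ _).trans (add_le_add_right (le_of_eq ?_) _))
  rw [norm_smul, Real.norm_of_nonneg hC0.le, Lp.norm_toLp, eLpNorm_norm, Lp.norm_def]

end IsFinslerNorm

/-- The du Bois-Reymond lemma: a continuous function with continuous weak derivative is a primitive
of its weak derivative. -/
theorem sub_eq_integral_of_weak_deriv {f g : ℝ → ℝ} (hf : ContinuousOn f (Ici 0))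
    (hg : ContinuousOn g (Ici 0))
    (h : ∀ χ : ℝ → ℝ, ContDiff ℝ ∞ χ → HasCompactSupport χ → tsupport χ ⊆ Ioi 0 →
      ∫ t in Ioi (0 : ℝ), deriv χ t * f t = ∫ t in Ioi (0 : ℝ), χ t * g t)
    {a b : ℝ} (ha : 0 < a) (hb : 0 < b) : f b - f a = -∫ t in a..b, g t := by
  have hmax : ∀ t : ℝ, 0 < t → max t 0 = t := fun t ht => max_eq_left ht.le
  let f' : ℝ → ℝ := fun t => f (max t 0)
  let g' : ℝ → ℝ := fun t => g (max t 0)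
  have hf' : Continuous f' :=
    hf.comp_continuous (continuous_id.max continuous_const) fun t => le_max_right t 0
  have hg' : Continuous g' :=
    hg.comp_continuous (continuous_id.max continuous_const) fun t => le_max_right t 0
  let Γ : ℝ → ℝ := fun t => ∫ s in (0 : ℝ)..t, g' s
  have hΓ : ∀ t, HasDerivAt Γ (g' t) t := fun t =>
    intervalIntegral.integral_hasDerivAt_right (hg'.intervalIntegrable _ _)
      (hg'.stronglyMeasurableAtFilter _ _) hg'.continuousAt
  have hΓc : Continuous Γ := continuous_iff_continuousAt.2 fun t => (hΓ t).continuousAt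
  let k : ℝ → ℝ := fun t => f' t + Γ t
  have hk : Continuous k := hf'.add hΓc
  have hcut : ∀ χ φ φ' : ℝ → ℝ, tsupport χ ⊆ Ioi 0 → (∀ t, 0 < t → φ t = φ' t) →
      ∫ t in Ioi (0 : ℝ), χ t * φ t = ∫ t, χ t * φ' t := fun χ φ φ' hχ hφ => by
    rw [← setIntegral_eq_integral_of_forall_compl_eq_zero (s := Ioi 0)
      (f := fun t => χ t * φ' t) fun t ht => by
        rw [image_eq_zero_of_notMem_tsupport fun h => ht (hχ h), zero_mul]]
    refine setIntegral_congr_fun measurableSet_Ioi fun t ht => ?_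
    simp only [hφ t ht]
  have step1 : ∀ χ : ℝ → ℝ, ContDiff ℝ ∞ χ → HasCompactSupport χ → tsupport χ ⊆ Ioi 0 →
      ∫ t, deriv χ t * k t = 0 := fun χ hχ hχc hχs => by
    have hdχ : Continuous (deriv χ) := hχ.continuous_deriv (by simp)
    have i1 : Integrable fun t => deriv χ t * f' t :=
      (hdχ.mul hf').integrable_of_hasCompactSupport hχc.deriv.mul_right
    have i2 : Integrable fun t => deriv χ t * Γ t :=
      (hdχ.mul hΓc).integrable_of_hasCompactSupport hχc.deriv.mul_right
    have i3 : Integrable fun t => χ t * g' t :=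
      (hχ.continuous.mul hg').integrable_of_hasCompactSupport hχc.mul_right
    have i4 : Integrable fun t => χ t * Γ t :=
      (hχ.continuous.mul hΓc).integrable_of_hasCompactSupport hχc.mul_right
    have h1 := integral_eq_zero_of_hasDerivAt_of_integrable (f := fun t => χ t * Γ t)
      (fun t => (hχ.differentiable (by simp) t).hasDerivAt.mul (hΓ t)) (i2.add i3) i4
    rw [integral_add i2 i3] at h1
    have h2 := h χ hχ hχc hχs
    rw [hcut χ g g' hχs fun t ht => by simp only [g', hmax t ht],
      hcut (deriv χ) f f' ((tsupport_deriv_subset (f := χ)).trans hχs)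
        fun t ht => by simp only [f', hmax t ht]] at h2
    simp only [k, mul_add]
    rw [integral_add i1 i2, h2]
    linarith
  let b0 : ContDiffBump (1 : ℝ) := ⟨1 / 4, 1 / 2, by norm_num, by norm_num⟩
  let ψ0 : ℝ → ℝ := b0.normed volume
  have hψ0 : ContDiff ℝ ∞ ψ0 := b0.contDiff_normed
  have hψ0c : HasCompactSupport ψ0 := b0.hasCompactSupport_normed
  have hψ0s : tsupport ψ0 ⊆ Ioi 0 := by
    rw [b0.tsupport_normed_eq]
    intro t ht
    rw [Real.closedBall_eq_Icc] at ht
    have := ht.1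
    simp only [b0] at this
    rw [mem_Ioi]; linarith
  have hψ01 : ∫ t, ψ0 t = 1 := b0.integral_normed
  have step2 : ∀ ψ : ℝ → ℝ, ContDiff ℝ ∞ ψ → HasCompactSupport ψ → tsupport ψ ⊆ Ioi 0 →
      ∫ t, ψ t * k t = (∫ t, ψ t) * ∫ t, ψ0 t * k t := fun ψ hψ hψc hψs => by
    -- a function of mean zero is the derivative of a test function
    let ζ : ℝ → ℝ := fun t => ψ t - (∫ t, ψ t) * ψ0 t
    have hζ : ContDiff ℝ ∞ ζ := hψ.sub (contDiff_const.mul hψ0)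
    have iψ : Integrable ψ := hψ.continuous.integrable_of_hasCompactSupport hψc
    have iψ0 : Integrable ψ0 := hψ0.continuous.integrable_of_hasCompactSupport hψ0c
    have hζ0 : ∫ t, ζ t = 0 := by
      simp only [ζ]
      rw [integral_sub iψ (iψ0.const_mul _), integral_const_mul, hψ01]; ring
    obtain ⟨α, β, hα, hαβ, hsupp⟩ : ∃ α β : ℝ, 0 < α ∧ α ≤ β ∧ ∀ t, t ∉ Icc α β → ζ t = 0 := by
      have hK : IsCompact (tsupport ψ ∪ tsupport ψ0) := hψc.isCompact.union hψ0c.isCompact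
      have hne : (tsupport ψ ∪ tsupport ψ0).Nonempty := ⟨1, Or.inr (by
        rw [b0.tsupport_normed_eq]
        exact Metric.mem_closedBall_self (by norm_num [b0]))⟩
      obtain ⟨α, hα, hα'⟩ := hK.exists_isLeast hne
      obtain ⟨β, hβ, hβ'⟩ := hK.exists_isGreatest hne
      refine ⟨α, β, hα.elim (fun h => hψs h) (fun h => hψ0s h), hα' hβ, fun t ht => ?_⟩
      have h1 : t ∉ tsupport ψ ∪ tsupport ψ0 := fun h => ht ⟨hα' h, hβ' h⟩
      simp only [ζ]
      rw [image_eq_zero_of_notMem_tsupport fun h => h1 (Or.inl h),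
        image_eq_zero_of_notMem_tsupport fun h => h1 (Or.inr h)]
      ring
    let χ : ℝ → ℝ := fun t => ∫ s in (0 : ℝ)..t, ζ s
    have hχd : ∀ t, HasDerivAt χ (ζ t) t := fun t =>
      intervalIntegral.integral_hasDerivAt_right (hζ.continuous.intervalIntegrable _ _)
        (hζ.continuous.stronglyMeasurableAtFilter _ _) hζ.continuous.continuousAt
    have hχd' : deriv χ = ζ := funext fun t => (hχd t).deriv
    have hχ : ContDiff ℝ ∞ χ := by
      refine contDiff_infty_iff_deriv.2 ⟨fun t => (hχd t).differentiableAt, ?_⟩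
      rw [hχd']; exact hζ
    have hχ0 : ∀ t, t ∉ Icc α β → χ t = 0 := fun t ht => by
      rcases lt_or_ge t α with h1 | h1
      · refine (intervalIntegral.integral_congr (g := fun _ => (0 : ℝ)) fun s hs => ?_).trans
          (by simp)
        refine hsupp s fun h => ?_
        have h2 := hs.2
        have h3 : max 0 t < α := max_lt hα h1
        linarith [h.1]
      · have h2 : β < t := by
          by_contra! h2
          exact ht ⟨h1, h2⟩
        have h3 : ∫ s in (0 : ℝ)..t, ζ s = ∫ s, ζ s := by
          refine intervalIntegral.integral_eq_integral_of_support_subset fun s hs => ?_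
          by_contra h4
          refine hs (hsupp s fun h5 => h4 ⟨by linarith [h5.1], by linarith [h5.2]⟩)
        exact h3.trans hζ0
    have hχs : tsupport χ ⊆ Icc α β := closure_minimal
      (fun t ht => by by_contra h1; exact ht (hχ0 t h1)) isClosed_Icc
    have h1 := step1 χ hχ (HasCompactSupport.of_support_subset_isCompact isCompact_Icc
      (subset_closure.trans hχs)) fun t ht => lt_of_lt_of_le hα (hχs ht).1
    rw [hχd'] at h1
    simp only [ζ, sub_mul, mul_assoc] at h1
    rw [integral_sub, integral_const_mul] at h1
    · linarith
    · exact (hψ.continuous.mul hk).integrable_of_hasCompactSupport hψc.mul_right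
    · exact ((hψ0.continuous.mul hk).integrable_of_hasCompactSupport hψ0c.mul_right).const_mul _
  set c := ∫ t, ψ0 t * k t with hc
  have hae := isOpen_Ioi.ae_eq_zero_of_integral_contDiff_smul_eq_zero (U := Ioi (0 : ℝ))
    (f := fun t => k t - c) (μ := volume)
    ((hk.sub continuous_const).locallyIntegrable.locallyIntegrableOn _)
    (fun ψ hψ hψc hψs => by
      simp only [smul_eq_mul, mul_sub]
      rw [integral_sub, step2 ψ hψ hψc hψs, integral_mul_const, sub_self]
      · exact (hψ.continuous.mul hk).integrable_of_hasCompactSupport hψc.mul_right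
      · exact (hψ.continuous.integrable_of_hasCompactSupport hψc).mul_const _)
  have heq : EqOn (fun t => k t - c) (fun _ => 0) (Ioi 0) :=
    Measure.eqOn_open_of_ae_eq ((ae_restrict_iff' measurableSet_Ioi).2 hae) isOpen_Ioi
      (hk.sub continuous_const).continuousOn continuousOn_const
  have ea := heq (mem_Ioi.2 ha)
  have eb := heq (mem_Ioi.2 hb)
  simp only [k, f', hmax a ha, hmax b hb] at ea eb
  have hint : ∫ t in a..b, g t = Γ b - Γ a := by
    rw [intervalIntegral.integral_interval_sub_left (hg'.intervalIntegrable _ _)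
      (hg'.intervalIntegrable _ _)]
    refine intervalIntegral.integral_congr fun t ht => ?_
    have : 0 < t := (lt_min ha hb).trans_le ht.1
    simp only [g', hmax t this]
  rw [hint]
  linarith

/-! ### Left difference quotients of weighted integrals -/

theorem tendsto_integral_comp_mul {α : Type*} [MeasurableSpace α] {μ : Measure α}
    [IsFiniteMeasure μ] {F : ℝ → ℝ} (hFc : Continuous F) {C C' M : ℝ} (hC : 0 ≤ C)
    (hF : ∀ a b, |F b - F a| ≤ C * (1 + |a| + |b|) * |b - a|)
    (hF' : ∀ a, |F a| ≤ C' * (1 + a ^ 2)) {ι : Type*} {l : Filter ι} [l.IsCountablyGenerated]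
    {v : ι → Lp ℝ 2 μ} {u : Lp ℝ 2 μ} (hv : Tendsto v l (𝓝 u)) {w : ι → α → ℝ} {w' : α → ℝ}
    (hwm : ∀ i, AEStronglyMeasurable (w i) μ) (hwM : ∀ᶠ i in l, ∀ᵐ x ∂μ, |w i x| ≤ M)
    (hw : ∀ᵐ x ∂μ, Tendsto (fun i => w i x) l (𝓝 (w' x))) :
    Tendsto (fun i => ∫ x, F (v i x) * w i x ∂μ) l (𝓝 (∫ x, F (u x) * w' x ∂μ)) := by
  have hi : ∀ u : Lp ℝ 2 μ, Integrable (fun x => F (u x)) μ := integrable_comp_L2 hFc hF'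
  have h1 : Tendsto (fun i => ∫ x, F (u x) * w i x ∂μ) l (𝓝 (∫ x, F (u x) * w' x ∂μ)) := by
    refine tendsto_integral_filter_of_dominated_convergence (fun x => |F (u x)| * M)
      (Eventually.of_forall fun i => (hi u).1.mul (hwm i)) ?_ ((hi u).abs.mul_const M) ?_
    · filter_upwards [hwM] with i h
      filter_upwards [h] with x hx
      rw [norm_mul]
      exact mul_le_mul_of_nonneg_left hx (norm_nonneg _)
    · filter_upwards [hw] with x hx
      exact hx.const_mul _
  have h2 : Tendsto (fun i => (∫ x, F (v i x) * w i x ∂μ) - ∫ x, F (u x) * w i x ∂μ) l (𝓝 0) := by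
    refine squeeze_zero_norm' (a := fun i => M * ∫ x, |F (v i x) - F (u x)| ∂μ) ?_
      (by simpa using (tendsto_integral_abs_comp_sub hC hF hv).const_mul M)
    filter_upwards [hwM] with i h
    have i1 : ∀ u : Lp ℝ 2 μ, Integrable (fun x => F (u x) * w i x) μ := fun u =>
      (hi u).mul_bdd (c := M) (hwm i) h
    rw [← integral_sub (i1 _) (i1 _), ← integral_const_mul]
    refine (norm_integral_le_integral_norm _).trans (integral_mono_ae ((i1 _).sub (i1 _)).norm
      (((hi _).sub (hi _)).abs.const_mul M) ?_)
    filter_upwards [h] with x hx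
    rw [← sub_mul, norm_mul, mul_comm, Real.norm_eq_abs, Real.norm_eq_abs]
    exact mul_le_mul_of_nonneg_right hx (abs_nonneg _)
  simpa using h2.add h1

section regPow

variable {δ q : ℝ}

theorem abs_regPow_div_sub_le (hδ : 0 < δ) (hq1 : 1 ≤ q) (hq2 : q ≤ 2) (a b : ℝ) :
    |regPow δ q b / q - regPow δ q a / q| ≤ δ ^ (q - 2) * (1 + |a| + |b|) * |b - a| := by
  refine (abs_regPow_sub_le hδ hq1 hq2 a b).trans ?_
  have : 0 < δ ^ (q - 2) := Real.rpow_pos_of_pos hδ _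
  gcongr
  linarith

theorem abs_regPow_div_le (hδ : 0 < δ) (hq1 : 1 ≤ q) (hq2 : q ≤ 2) (a : ℝ) :
    |regPow δ q a / q| ≤ (δ ^ (q - 2) * (1 + δ ^ 2)) * (1 + a ^ 2) := by
  have h0 := (regPow_pos hδ q a).le
  have h1 := regPow_le_sq hδ hq2 a
  have : 0 < δ ^ (q - 2) := Real.rpow_pos_of_pos hδ _
  rw [abs_of_nonneg (by positivity)]
  calc regPow δ q a / q ≤ regPow δ q a := div_le_self h0 hq1
    _ ≤ δ ^ (q - 2) * (a ^ 2 + δ ^ 2) := h1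
    _ ≤ δ ^ (q - 2) * ((1 + δ ^ 2) * (1 + a ^ 2)) := by
        gcongr; nlinarith [sq_nonneg a, sq_nonneg δ, mul_nonneg (sq_nonneg a) (sq_nonneg δ)]
    _ = _ := by ring

end regPow

section Solution

variable {N : ℕ} {H : Space N → ℝ} {Ω : Set (Space N)} {φ : Space N → ℝ} {u : ℝ → L2 Ω}

/-- The weak formulation, integrated in time and extended to test functions in `H¹₀(Ω)`. -/
theorem IsSolution.exists_gradient (hsol : IsSolution H Ω φ u) (hH : IsFinslerNorm H) :
    ∃ G : ℝ → L2Vec Ω, ContinuousOn u (Ici 0) ∧ ContinuousOn G (Ici 0) ∧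
      (∀ t, 0 ≤ t → (u t, G t) ∈ sobolevH10 Ω) ∧ (∀ᵐ y ∂(volume.restrict Ω), u 0 y = φ y) ∧
      ∀ p ∈ sobolevH10 Ω, ∀ a b : ℝ, 0 < a → 0 < b →
        inner ℝ p.1 (u b - u a) = -∫ t in a..b, inner ℝ p.2 (hH.fluxL2 (G t)) := by
  obtain ⟨v, G, hW, hu, hG, hmem, hpde, hφ⟩ := hsol
  refine ⟨G, hu, hG, hmem, hφ, fun p hp a b ha hb => ?_⟩
  have hA : ContinuousOn (fun t => hH.fluxL2 (G t)) (Ici 0) :=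
    hH.continuous_fluxL2.comp_continuousOn hG
  have hAi : IntervalIntegrable (fun t => hH.fluxL2 (G t)) volume a b :=
    (hA.mono fun t ht => ((lt_min ha hb).trans_le ht.1).le).intervalIntegrable
  have hint : ∀ p : L2 Ω × L2Vec Ω, ∫ t in a..b, inner ℝ p.2 (hH.fluxL2 (G t)) =
      inner ℝ p.2 (∫ t in a..b, hH.fluxL2 (G t)) := fun p =>
    (innerSL ℝ p.2).intervalIntegral_comp_comm hAi
  rw [hint]
  have c1 : Continuous fun p : L2 Ω × L2Vec Ω => inner ℝ p.1 (u b - u a) := by fun_prop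
  have c2 : Continuous fun p : L2 Ω × L2Vec Ω =>
      -inner ℝ p.2 (∫ t in a..b, hH.fluxL2 (G t)) := by fun_prop
  refine closure_minimal ?_ (isClosed_eq c1 c2) hp
  rintro p ⟨θ, hθ, hp1, hp2⟩
  rw [mem_ofPred_eq, ← hint, inner_sub_right]
  refine sub_eq_integral_of_weak_deriv (f := fun t => inner ℝ p.1 (u t))
    (g := fun t => inner ℝ p.2 (hH.fluxL2 (G t))) (continuousOn_const.inner hu)
    (continuousOn_const.inner hA) (fun χ hχ hχc hχs => ?_) ha hb
  have hdχ : Continuous (deriv χ) := hχ.continuous_deriv (by simp)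
  have hbd : ∀ χ : ℝ → ℝ, Continuous χ → HasCompactSupport χ → ∀ w : ℝ → L2 Ω,
      MemLp w 2 (volume.restrict (Ioi 0)) →
        Integrable (fun t => χ t • w t) (volume.restrict (Ioi 0)) := fun χ hχ hχc w hw => by
    have h1 : MemLp χ 2 (volume.restrict (Ioi (0 : ℝ))) :=
      (hχ.memLp_of_hasCompactSupport hχc).restrict _
    exact memLp_one_iff_integrable.1 (hw.smul h1)
  have e1 := integral_inner (𝕜 := ℝ) (hbd _ hdχ hχc.deriv u hW.memLp) p.1
  have e2 := integral_inner (𝕜 := ℝ) (hbd _ hχ.continuous hχc v hW.memLp_deriv) p.1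
  rw [hW.integral_eq χ hχ hχc hχs, inner_neg_right, ← e2, ← integral_neg] at e1
  simp only [inner_smul_right] at e1
  rw [e1]
  refine integral_congr_ae ?_
  filter_upwards [hpde] with t ht
  have h1 : inner ℝ p.1 (v t) = ∫ y in Ω, v t y * θ y := by
    rw [L2.inner_def]
    refine integral_congr_ae ?_
    filter_upwards [hp1] with y hy
    rw [hy]; simp
  have h2 : inner ℝ p.2 (hH.fluxL2 (G t)) = ∫ y in Ω, inner ℝ (flux H (G t y)) (gradient θ y) := by
    rw [L2.inner_def]
    refine integral_congr_ae ?_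
    filter_upwards [hp2, hH.coeFn_fluxL2 (G t)] with y hy hy'
    rw [hy, hy', real_inner_comm]
  have h3 := ht θ hθ
  rw [← h1, ← h2] at h3
  linear_combination -(χ t) * h3

/-- The weighted integral `∫ (u² + δ²)^{q/2} / q · η` at time `t`. -/
noncomputable def weightedMass (Ω : Set (Space N)) (δ q : ℝ) (η : ℝ → Space N → ℝ) (u : ℝ → L2 Ω)
    (t : ℝ) : ℝ :=
  ∫ y in Ω, regPow δ q (u t y) / q * η t y

variable {δ q M : ℝ} {η : ℝ → Space N → ℝ}

theorem continuousWithinAt_weightedMass (hΩ : volume Ω ≠ ⊤) (hδ : 0 < δ) (hq1 : 1 ≤ q)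
    (hq2 : q ≤ 2) (hu : ContinuousOn u (Ici 0)) {s : ℝ} (hs : 0 ≤ s)
    (hηc : ∀ t, Continuous (η t))
    (hηM : ∀ᶠ t in 𝓝[Ici 0] s, ∀ᵐ y ∂(volume.restrict Ω), |η t y| ≤ M)
    (hη : ∀ y, Tendsto (fun t => η t y) (𝓝[Ici 0] s) (𝓝 (η s y))) :
    ContinuousWithinAt (weightedMass Ω δ q η u) (Ici 0) s := by
  have : IsFiniteMeasure (volume.restrict Ω) := ⟨by simpa using hΩ.lt_top⟩
  exact tendsto_integral_comp_mul ((continuous_regPow hδ q).div_const q)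
    (Real.rpow_pos_of_pos hδ _).le (abs_regPow_div_sub_le hδ hq1 hq2)
    (abs_regPow_div_le hδ hq1 hq2) (hu s hs) (fun t => (hηc t).aestronglyMeasurable) hηM
    (ae_of_all _ hη)

/-- The left difference quotients of a weighted integral of a convex function of the solution.
Convexity bounds the increment by a pairing with the test function `F'(u(s)) η(s)`, which is kept
at the right endpoint, so that the weak formulation applies to a fixed test function. -/
theorem eventually_slope_weightedMass_lt (hH : IsFinslerNorm H) (hΩ : volume Ω ≠ ⊤)
    (hΩm : MeasurableSet Ω) (hδ : 0 < δ)
    (hq1 : 1 ≤ q) (hq2 : q ≤ 2) {G : ℝ → L2Vec Ω} (hu : ContinuousOn u (Ici 0))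
    (hG : ContinuousOn G (Ici 0)) (hmem : ∀ t, 0 ≤ t → (u t, G t) ∈ sobolevH10 Ω)
    (hweak : ∀ p ∈ sobolevH10 Ω, ∀ a b : ℝ, 0 < a → 0 < b →
        inner ℝ p.1 (u b - u a) = -∫ t in a..b, inner ℝ p.2 (hH.fluxL2 (G t)))
    {s : ℝ} (hs : 0 < s) (hηc : ∀ t, Continuous (η t)) (hηs : ContDiff ℝ ∞ (η s))
    (hη0 : ∀ y, 0 ≤ η s y) (hηM : ∀ y ∈ Ω, |η s y| ≤ M)
    (hηM' : ∀ y ∈ Ω, ‖gradient (η s) y‖ ≤ M) {η' : Space N → ℝ}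
    (hη' : ∀ y, HasDerivAt (fun t => η t y) (η' y) s)
    (hlip : ∀ᶠ a in 𝓝[<] s, ∀ y ∈ Ω, |η s y - η a y| ≤ M * (s - a)) {r : ℝ}
    (hr : ∫ y in Ω, (regPow δ q (u s y) / q * η' y -
      inner ℝ (flux H (G s y)) ((derivMulRegPow δ (q - 2) (u s y) * η s y) • G s y +
        (u s y * regPow δ (q - 2) (u s y)) • gradient (η s) y)) < r) :
    ∀ᶠ a in 𝓝[<] s, (weightedMass Ω δ q η u s - weightedMass Ω δ q η u a) / (s - a) < r := by
  have hfin : IsFiniteMeasure (volume.restrict Ω) := ⟨by simpa using hΩ.lt_top⟩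
  have hL : (𝓝[<] s) ≤ 𝓝[Ici 0] s :=
    nhdsWithin_le_iff.2 (mem_nhdsWithin_of_mem_nhds (Ici_mem_nhds hs))
  have hpos : ∀ᶠ a in 𝓝[<] s, 0 < a ∧ a < s := by
    filter_upwards [mem_nhdsWithin_of_mem_nhds (Ioi_mem_nhds hs), self_mem_nhdsWithin]
      with a h1 h2 using ⟨h1, h2⟩
  set F : ℝ → ℝ := fun a => regPow δ q a / q with hFdef
  have hFc : Continuous F := (continuous_regPow hδ q).div_const q
  have hδq : 0 ≤ δ ^ (q - 2) := (Real.rpow_pos_of_pos hδ _).le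
  have hFi : ∀ u : L2 Ω, Integrable (fun y => F (u y)) (volume.restrict Ω) :=
    integrable_comp_L2 hFc (abs_regPow_div_le hδ hq1 hq2)
  have hae : ∀ {p : Space N → Prop}, (∀ y ∈ Ω, p y) → ∀ᵐ y ∂(volume.restrict Ω), p y :=
    fun h => (ae_restrict_iff' hΩm).2 (ae_of_all _ h)
  -- the admissible test function
  obtain ⟨P, hP, hP1, hP2⟩ := exists_mem_sobolevH10_comp
    (F := fun a => a * regPow δ (q - 2) a) (F' := derivMulRegPow δ (q - 2)) (L := δ ^ (q - 2))
    (contDiff_mul_regPow hδ _) (by simp) (hasDerivAt_mul_regPow hδ _) (fun a => by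
      rw [← (hasDerivAt_mul_regPow hδ (q - 2) a).deriv]
      exact abs_deriv_mul_regPow_le hδ (by linarith) (by linarith) a) hηs (hae hηM) (hae hηM')
    (hmem s hs.le)
  -- the spatial part
  let k : ℝ → ℝ := fun t => inner ℝ P.2 (hH.fluxL2 (G (max t 0)))
  have hk : Continuous k := by
    have h1 : Continuous fun t => G (max t 0) :=
      hG.comp_continuous (continuous_id.max continuous_const) fun t => le_max_right t 0
    exact continuous_const.inner (hH.continuous_fluxL2.comp h1)
  have hA : Tendsto (fun a => -((∫ t in a..s, k t) / (s - a))) (𝓝[<] s) (𝓝 (-k s)) := by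
    have h1 : HasDerivAt (fun t => ∫ x in (0 : ℝ)..t, k x) (k s) s :=
      intervalIntegral.integral_hasDerivAt_right (hk.intervalIntegrable _ _)
        (hk.stronglyMeasurableAtFilter _ _) hk.continuousAt
    rw [hasDerivAt_iff_tendsto_slope] at h1
    refine ((h1.mono_left (nhdsLT_le_nhdsNE s)).neg).congr fun a => ?_
    rw [slope_comm, slope_def_field, intervalIntegral.integral_interval_sub_left
      (hk.intervalIntegrable _ _) (hk.intervalIntegrable _ _)]
  have hks : k s = ∫ y in Ω, inner ℝ (flux H (G s y))
      ((derivMulRegPow δ (q - 2) (u s y) * η s y) • G s y +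
        (u s y * regPow δ (q - 2) (u s y)) • gradient (η s) y) := by
    simp only [k, max_eq_left hs.le]
    rw [L2.inner_def]
    refine integral_congr_ae ?_
    filter_upwards [hP2, hH.coeFn_fluxL2 (G s)] with y h1 h2
    rw [h1, h2, real_inner_comm]
  have hki : Integrable (fun y => inner ℝ (flux H (G s y))
      ((derivMulRegPow δ (q - 2) (u s y) * η s y) • G s y +
        (u s y * regPow δ (q - 2) (u s y)) • gradient (η s) y)) (volume.restrict Ω) := by
    refine (L2.integrable_inner (𝕜 := ℝ) P.2 (hH.fluxL2 (G s))).congr ?_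
    filter_upwards [hP2, hH.coeFn_fluxL2 (G s)] with y h1 h2
    rw [h1, h2, real_inner_comm]
  -- the temporal part
  have hquot : ∀ᶠ a in 𝓝[<] s, ∀ y ∈ Ω, |(η s y - η a y) / (s - a)| ≤ M := by
    filter_upwards [hlip, hpos] with a h1 h2 y hy
    have h3 : 0 < s - a := by linarith
    rw [abs_div, abs_of_pos h3, div_le_iff₀ h3]
    exact h1 y hy
  have hlimq : ∀ y, Tendsto (fun a => (η s y - η a y) / (s - a)) (𝓝[<] s) (𝓝 (η' y)) := fun y => by
    have h1 := hasDerivAt_iff_tendsto_slope.1 (hη' y)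
    refine (h1.mono_left (nhdsLT_le_nhdsNE s)).congr fun a => ?_
    rw [slope_comm, slope_def_field]
  have hη'M : ∀ y ∈ Ω, |η' y| ≤ M := fun y hy =>
    le_of_tendsto (hlimq y).abs (hquot.mono fun a h => h y hy)
  have hD : Tendsto (fun a => ∫ y in Ω, F (u a y) * ((η s y - η a y) / (s - a))) (𝓝[<] s)
      (𝓝 (∫ y in Ω, F (u s y) * η' y)) :=
    tendsto_integral_comp_mul hFc hδq (abs_regPow_div_sub_le hδ hq1 hq2)
      (abs_regPow_div_le hδ hq1 hq2) ((hu s hs.le).mono_left hL)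
      (fun a => (((hηc s).sub (hηc a)).div_const _).aestronglyMeasurable)
      (hquot.mono fun a h => hae h) (ae_of_all _ hlimq)
  have hη'm : AEStronglyMeasurable η' (volume.restrict Ω) :=
    aestronglyMeasurable_of_tendsto_ae (𝓝[<] s)
      (fun a => (((hηc s).sub (hηc a)).div_const (s - a)).aestronglyMeasurable)
      (ae_of_all _ hlimq)
  have hlim := hA.add hD
  have hval : -k s + ∫ y in Ω, F (u s y) * η' y < r := by
    rw [integral_sub _ hki, ← hks] at hr
    · linarith
    · exact (hFi (u s)).mul_bdd (c := M) hη'm (hae hη'M)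
  filter_upwards [hlim.eventually (gt_mem_nhds hval), hpos, hlip] with a h1 ⟨ha0, has⟩ h2
  refine lt_of_le_of_lt ?_ h1
  have hsa : 0 < s - a := by linarith
  have hηa : ∀ᵐ y ∂(volume.restrict Ω), |η a y| ≤ M + M * (s - a) := by
    refine hae fun y hy => ?_
    have h3 := abs_sub_abs_le_abs_sub (η a y) (η s y)
    rw [abs_sub_comm] at h3
    linarith [h2 y hy, hηM y hy]
  have i1 : Integrable (fun y => F (u s y) * η s y) (volume.restrict Ω) :=
    (hFi (u s)).mul_bdd (c := M) (hηc s).aestronglyMeasurable (hae hηM)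
  have i2 : Integrable (fun y => F (u a y) * η s y) (volume.restrict Ω) :=
    (hFi (u a)).mul_bdd (c := M) (hηc s).aestronglyMeasurable (hae hηM)
  have i3 : Integrable (fun y => F (u a y) * η a y) (volume.restrict Ω) :=
    (hFi (u a)).mul_bdd (hηc a).aestronglyMeasurable hηa
  have hkas : ∫ t in a..s, k t = ∫ t in a..s, inner ℝ P.2 (hH.fluxL2 (G t)) := by
    refine intervalIntegral.integral_congr fun t ht => ?_
    have : a ≤ t := by rw [uIcc_of_le has.le] at ht; exact ht.1
    simp only [k, max_eq_left (ha0.le.trans this)]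
  have hconv : ∫ y in Ω, (F (u s y) * η s y - F (u a y) * η s y) ≤ -∫ t in a..s, k t := by
    rw [hkas, ← hweak P hP a s ha0 hs, L2.inner_def]
    refine integral_mono_ae (i1.sub i2) (L2.integrable_inner (𝕜 := ℝ) P.1 (u s - u a)) ?_
    filter_upwards [hP1, Lp.coeFn_sub (u s) (u a)] with y h3 h4
    rw [h3, h4, Pi.sub_apply, ← sub_mul]
    have h5 := mul_le_mul_of_nonneg_right (regPow_sub_le hδ hq1 hq2 (u a y) (u s y)) (hη0 y)
    refine h5.trans (le_of_eq ?_)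
    simp only [RCLike.inner_apply, conj_trivial]
    ring
  have hDa : ∫ y in Ω, F (u a y) * ((η s y - η a y) / (s - a)) =
      (∫ y in Ω, (F (u a y) * η s y - F (u a y) * η a y)) / (s - a) := by
    rw [← integral_div]
    congr 1; funext y; ring
  rw [hDa, ← neg_div, ← add_div]
  refine div_le_div_of_nonneg_right ?_ hsa.le
  rw [integral_sub i1 i2] at hconv
  rw [integral_sub i2 i3]
  change (∫ y in Ω, F (u s y) * η s y) - (∫ y in Ω, F (u a y) * η a y) ≤ _
  linarith

end Solution

/-! ### The weights -/

section Weight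

variable {N : ℕ} {H : Space N → ℝ} {Ω : Set (Space N)}

/-- The weight `c t^β (1 + κ t^ℓ K²) e^{-q K² (1 + t^ℓ) - ψ}`, where `K` and `ψ` are smooth
substitutes for `H₀` and for the distance to a point. -/
noncomputable def expWeight (ℓ c β κ q : ℝ) (K ψ : Space N → ℝ) (t : ℝ) (y : Space N) : ℝ :=
  c * t ^ β * (1 + κ * (t ^ ℓ * K y ^ 2)) * Real.exp (-(q * (K y ^ 2 * (1 + t ^ ℓ)) + ψ y))

/-- The time derivative of `expWeight`. -/
noncomputable def expWeightDeriv (ℓ c β κ q : ℝ) (K ψ : Space N → ℝ) (t : ℝ) (y : Space N) : ℝ :=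
  c * (β * t ^ (β - 1) * (1 + κ * (t ^ ℓ * K y ^ 2)) + t ^ β * (κ * (ℓ * t ^ (ℓ - 1) * K y ^ 2)) -
    t ^ β * (1 + κ * (t ^ ℓ * K y ^ 2)) * (q * (ℓ * t ^ (ℓ - 1) * K y ^ 2))) *
    Real.exp (-(q * (K y ^ 2 * (1 + t ^ ℓ)) + ψ y))

variable {ℓ c β κ q : ℝ} {K ψ : Space N → ℝ}

theorem expWeight_nonneg (hc : 0 ≤ c) (hκ : 0 ≤ κ) {t : ℝ} (ht : 0 ≤ t) (y : Space N) :
    0 ≤ expWeight ℓ c β κ q K ψ t y := by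
  have := Real.rpow_nonneg ht β
  have := Real.rpow_nonneg ht ℓ
  unfold expWeight
  positivity

theorem contDiff_expWeight (hK : ContDiff ℝ ∞ K) (hψ : ContDiff ℝ ∞ ψ) (t : ℝ) :
    ContDiff ℝ ∞ (expWeight ℓ c β κ q K ψ t) := by
  unfold expWeight
  fun_prop

theorem continuous_expWeight (hℓ : 0 ≤ ℓ) (hβ : 0 ≤ β) (hK : Continuous K) (hψ : Continuous ψ) :
    Continuous fun x : ℝ × Space N => expWeight ℓ c β κ q K ψ x.1 x.2 := by
  have h1 : Continuous fun x : ℝ × Space N => x.1 ^ β :=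
    (Real.continuous_rpow_const hβ).comp continuous_fst
  have h2 : Continuous fun x : ℝ × Space N => x.1 ^ ℓ :=
    (Real.continuous_rpow_const hℓ).comp continuous_fst
  unfold expWeight
  fun_prop

theorem hasDerivAt_expWeight {t : ℝ} (ht : 0 < t) (y : Space N) :
    HasDerivAt (fun t => expWeight ℓ c β κ q K ψ t y) (expWeightDeriv ℓ c β κ q K ψ t y) t := by
  have h1 : HasDerivAt (fun t : ℝ => t ^ β) (β * t ^ (β - 1)) t :=
    Real.hasDerivAt_rpow_const (Or.inl ht.ne')
  have h2 : HasDerivAt (fun t : ℝ => t ^ ℓ) (ℓ * t ^ (ℓ - 1)) t :=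
    Real.hasDerivAt_rpow_const (Or.inl ht.ne')
  have h3 := ((h1.const_mul c).mul (((h2.mul_const (K y ^ 2)).const_mul κ).const_add 1)).mul
    ((((h2.const_add 1).const_mul (K y ^ 2)).const_mul q).add_const (ψ y)).neg.exp
  refine h3.congr_deriv ?_
  simp only [expWeightDeriv, Pi.mul_apply, Pi.neg_apply]
  ring

theorem continuousOn_expWeightDeriv (hK : Continuous K) (hψ : Continuous ψ) :
    ContinuousOn (fun x : ℝ × Space N => expWeightDeriv ℓ c β κ q K ψ x.1 x.2)
      (Ioi 0 ×ˢ univ) := by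
  have h : ∀ p : ℝ, ContinuousOn (fun x : ℝ × Space N => x.1 ^ p) (Ioi 0 ×ˢ univ) := fun p =>
    continuousOn_fst.rpow_const fun x hx => Or.inl (ne_of_gt hx.1)
  have h1 := h β
  have h2 := h ℓ
  have h3 := h (β - 1)
  have h4 := h (ℓ - 1)
  unfold expWeightDeriv
  fun_prop

theorem exists_bound_of_continuous (hΩ : Bornology.IsBounded Ω) {E : Type*} [NormedAddCommGroup E]
    {f : Space N → E} (hf : Continuous f) : ∃ M, ∀ y ∈ Ω, ‖f y‖ ≤ M := by
  obtain ⟨M, hM⟩ := hΩ.isCompact_closure.exists_bound_of_continuousOn hf.continuousOn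
  exact ⟨M, fun y hy => hM y (subset_closure hy)⟩

theorem exists_bound_expWeight (hΩ : Bornology.IsBounded Ω) (hℓ : 0 ≤ ℓ) (hβ : 0 ≤ β)
    (hK : Continuous K) (hψ : Continuous ψ) (s : ℝ) :
    ∃ M, ∀ t ∈ Icc (s - 1) (s + 1), ∀ y ∈ Ω, |expWeight ℓ c β κ q K ψ t y| ≤ M := by
  obtain ⟨M, hM⟩ := (isCompact_Icc (a := s - 1) (b := s + 1)).prod hΩ.isCompact_closure
    |>.exists_bound_of_continuousOn
      (continuous_expWeight (c := c) (κ := κ) (q := q) hℓ hβ hK hψ).continuousOn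
  exact ⟨M, fun t ht y hy => hM (t, y) ⟨ht, subset_closure hy⟩⟩

theorem exists_lipschitz_expWeight (hΩ : Bornology.IsBounded Ω) (hK : Continuous K)
    (hψ : Continuous ψ) {s : ℝ} (hs : 0 < s) :
    ∃ M, ∀ᶠ a in 𝓝[<] s, ∀ y ∈ Ω,
      |expWeight ℓ c β κ q K ψ s y - expWeight ℓ c β κ q K ψ a y| ≤ M * (s - a) := by
  obtain ⟨M, hM⟩ := (isCompact_Icc (a := s / 2) (b := s)).prod hΩ.isCompact_closure
    |>.exists_bound_of_continuousOn
      ((continuousOn_expWeightDeriv (ℓ := ℓ) (c := c) (β := β) (κ := κ) (q := q) hK hψ).mono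
        (fun x hx => ⟨lt_of_lt_of_le (by positivity) hx.1.1, mem_univ _⟩))
  refine ⟨M, ?_⟩
  filter_upwards [mem_nhdsWithin_of_mem_nhds (Ioi_mem_nhds (half_lt_self hs)),
    self_mem_nhdsWithin] with a (ha : s / 2 < a) (has : a < s) y hy
  have h1 := Convex.norm_image_sub_le_of_norm_hasDerivWithin_le
    (f := fun t => expWeight ℓ c β κ q K ψ t y) (f' := fun t => expWeightDeriv ℓ c β κ q K ψ t y)
    (C := M) (s := Icc (s / 2) s)
    (fun t ht => (hasDerivAt_expWeight (lt_of_lt_of_le (by positivity) ht.1) y).hasDerivWithinAt)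
    (fun t ht => hM (t, y) ⟨ht, subset_closure hy⟩) (convex_Icc _ _) (x := a) (y := s)
    ⟨ha.le, has.le⟩ ⟨by linarith, le_rfl⟩
  rwa [Real.norm_of_nonneg (by linarith : 0 ≤ s - a)] at h1

theorem gradient_expWeight (hK : ContDiff ℝ ∞ K) (hψ : ContDiff ℝ ∞ ψ) (t : ℝ) (y : Space N) :
    gradient (expWeight ℓ c β κ q K ψ t) y =
      (c * t ^ β * Real.exp (-(q * (K y ^ 2 * (1 + t ^ ℓ)) + ψ y)) *
        (2 * κ * t ^ ℓ * K y - (1 + κ * (t ^ ℓ * K y ^ 2)) * (2 * q * (1 + t ^ ℓ) * K y))) •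
          gradient K y - expWeight ℓ c β κ q K ψ t y • gradient ψ y := by
  have h1 := (hK.differentiable (by simp) y).hasFDerivAt
  have h2 := (hψ.differentiable (by simp) y).hasFDerivAt
  have h3 : HasFDerivAt (expWeight ℓ c β κ q K ψ t) _ y :=
    ((((h1.pow 2).const_mul (t ^ ℓ)).const_mul κ).const_add 1 |>.const_mul (c * t ^ β)).mul
      (((((h1.pow 2).mul_const (1 + t ^ ℓ)).const_mul q).add h2).neg.exp)
  rw [gradient, h3.fderiv]
  simp only [gradient, expWeight, map_add, map_smul, map_neg, smul_add, smul_smul, smul_neg,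
    Pi.add_apply, Pi.neg_apply]
  module

theorem IsFinslerNorm.sub_le (hH : IsFinslerNorm H) (ξ ζ : Space N) : H (ξ - ζ) ≤ H ξ + H ζ := by
  rw [sub_eq_add_neg, ← hH.map_neg ζ]
  exact hH.add_le ξ (-ζ)

theorem IsFinslerNorm.gradient_expWeight_le (hH : IsFinslerNorm H) (hK : ContDiff ℝ ∞ K)
    (hψ : ContDiff ℝ ∞ ψ) (hc : 0 ≤ c) (hκ : 0 ≤ κ) (hκ' : κ ≤ 1 / 2) (hq0 : 0 ≤ q) (hq : q ≤ 2)
    (hK0 : ∀ y, 0 ≤ K y) (hK1 : ∀ y, H (gradient K y) ≤ 1) (hψ1 : ∀ y, H (gradient ψ y) ≤ 1)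
    (hℓ : 0 ≤ ℓ) {t : ℝ} (ht : 0 ≤ t) (ht1 : t ≤ 1) (y : Space N) :
    H (gradient (expWeight ℓ c β κ q K ψ t) y) ≤
      expWeight ℓ c β κ q K ψ t y * (1 + 9 * K y) := by
  have hη := expWeight_nonneg (ℓ := ℓ) (β := β) (q := q) (K := K) (ψ := ψ) hc hκ ht y
  rw [gradient_expWeight hK hψ]
  refine (hH.sub_le _ _).trans ?_
  rw [hH.homogeneous, hH.homogeneous, abs_of_nonneg hη]
  have hσ : 0 ≤ t ^ ℓ := Real.rpow_nonneg ht ℓ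
  have hσ1 : t ^ ℓ ≤ 1 := Real.rpow_le_one ht ht1 hℓ
  have hβ := Real.rpow_nonneg ht β
  have hk := hK0 y
  set σ := t ^ ℓ
  set k := K y
  set E := Real.exp (-(q * (k ^ 2 * (1 + σ)) + ψ y))
  have hE : 0 ≤ c * t ^ β * E := by positivity
  have hz : 0 ≤ κ * (σ * k ^ 2) := by positivity
  have h1 : |2 * κ * σ * k - (1 + κ * (σ * k ^ 2)) * (2 * q * (1 + σ) * k)| ≤
      (1 + κ * (σ * k ^ 2)) * (9 * k) := by
    have h2 : 0 ≤ 2 * κ * σ * k := by positivity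
    have h3 : 2 * κ * σ * k ≤ k := by
      have : 2 * κ * σ ≤ 1 := by nlinarith
      nlinarith
    have h4 : 2 * q * (1 + σ) * k ≤ 8 * k := by
      have : 2 * q * (1 + σ) ≤ 8 := by nlinarith
      nlinarith
    have h5 : 0 ≤ 2 * q * (1 + σ) * k := by positivity
    rw [abs_le]
    constructor
    · nlinarith [mul_le_mul_of_nonneg_left h4 (show 0 ≤ 1 + κ * (σ * k ^ 2) by linarith),
        mul_nonneg hz hk]
    · nlinarith [mul_nonneg (show 0 ≤ 1 + κ * (σ * k ^ 2) by linarith) h5, mul_nonneg hz hk]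
  rw [abs_mul, abs_of_nonneg hE]
  have hηE : expWeight ℓ c β κ q K ψ t y = c * t ^ β * E * (1 + κ * (σ * k ^ 2)) := by
    unfold expWeight; ring
  rw [hηE] at hη ⊢
  calc _ ≤ c * t ^ β * E * ((1 + κ * (σ * k ^ 2)) * (9 * k)) * 1 +
        c * t ^ β * E * (1 + κ * (σ * k ^ 2)) * 1 := by
        gcongr
        · exact hH.nonneg _
        · exact hK1 y
        · exact hψ1 y
    _ = _ := by ring

theorem expWeightDeriv_le (hc : 0 ≤ c) (hκ : 0 ≤ κ) (hκ' : κ ≤ 1 / 2) (hq1 : 1 ≤ q) (hℓ : 0 ≤ ℓ)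
    {t : ℝ} (ht : 0 < t) (y : Space N) :
    expWeightDeriv ℓ c β κ q K ψ t y ≤
      expWeight ℓ c β κ q K ψ t y * (β / t - q * (ℓ / (2 * t)) * (t ^ ℓ * K y ^ 2)) := by
  have h1 : t ^ (β - 1) = t ^ β / t := by rw [Real.rpow_sub_one ht.ne']
  have h2 : t ^ (ℓ - 1) = t ^ ℓ / t := by rw [Real.rpow_sub_one ht.ne']
  have hσ : 0 ≤ t ^ ℓ := Real.rpow_nonneg ht.le ℓ
  have hβ := Real.rpow_nonneg ht.le β
  rw [expWeightDeriv, expWeight, h1, h2]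
  set z := t ^ ℓ * K y ^ 2 with hz
  have hz0 : 0 ≤ z := by positivity
  set E := Real.exp (-(q * (K y ^ 2 * (1 + t ^ ℓ)) + ψ y))
  have h3 : 0 ≤ c * t ^ β * E := by positivity
  have h4 : ℓ * (t ^ ℓ / t) * K y ^ 2 = ℓ / t * z := by rw [hz]; ring
  rw [h4]
  have hd : 0 ≤ ℓ / t := by positivity
  have h5 : κ * (ℓ / t * z) ≤ (1 + κ * z) * (q / 2 * (ℓ / t * z)) := by
    have h6 : κ ≤ q / 2 := by linarith
    have h7 : 0 ≤ ℓ / t * z := by positivity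
    have h8 : 0 ≤ κ * z := by positivity
    calc κ * (ℓ / t * z) ≤ q / 2 * (ℓ / t * z) := by gcongr
      _ ≤ (1 + κ * z) * (q / 2 * (ℓ / t * z)) :=
        le_mul_of_one_le_left (by positivity) (by linarith)
  have h9 := mul_le_mul_of_nonneg_left h5 h3
  have h10 : ℓ / (2 * t) = ℓ / t / 2 := by field_simp
  rw [h10]
  calc _ = c * t ^ β * E * (κ * (ℓ / t * z)) + c * t ^ β * E * (1 + κ * z) * (β / t) -
        c * t ^ β * E * (1 + κ * z) * (q * (ℓ / t * z)) := by ring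
    _ ≤ c * t ^ β * E * ((1 + κ * z) * (q / 2 * (ℓ / t * z))) +
        c * t ^ β * E * (1 + κ * z) * (β / t) -
        c * t ^ β * E * (1 + κ * z) * (q * (ℓ / t * z)) := by linarith
    _ = _ := by ring

/-- Pointwise bound of the integrand in the derivative of a weighted integral. The growth of the
weight in time produces the good term `-(ℓ / 2t) t^ℓ K²`. -/
theorem IsFinslerNorm.integrand_le (hH : IsFinslerNorm H) (hK : ContDiff ℝ ∞ K)
    (hψ : ContDiff ℝ ∞ ψ) (hc : 0 ≤ c) (hκ : 0 ≤ κ) (hκ' : κ ≤ 1 / 2) (hq1 : 1 ≤ q) (hq : q ≤ 2)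
    (hK0 : ∀ y, 0 ≤ K y) (hK1 : ∀ y, H (gradient K y) ≤ 1) (hψ1 : ∀ y, H (gradient ψ y) ≤ 1)
    (hℓ : 0 ≤ ℓ) {t : ℝ} (ht : 0 < t) (ht1 : t ≤ 1) (y : Space N) {δ : ℝ} (hδ : 0 < δ) (a : ℝ)
    (ξ : Space N) :
    regPow δ q a / q * expWeightDeriv ℓ c β κ q K ψ t y -
      inner ℝ (flux H ξ) ((derivMulRegPow δ (q - 2) a * expWeight ℓ c β κ q K ψ t y) • ξ +
        (a * regPow δ (q - 2) a) • gradient (expWeight ℓ c β κ q K ψ t) y) ≤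
    expWeight ℓ c β κ q K ψ t y * (β / (q * t) * regPow δ q a -
      ℓ / (2 * t) * (t ^ ℓ * K y ^ 2) * regPow δ q a -
      (q - 1) * regPow δ (q - 2) a * H ξ ^ 2 + regPow δ (q - 1) a * H ξ * (1 + 9 * K y)) := by
  have hη := expWeight_nonneg (ℓ := ℓ) (β := β) (q := q) (K := K) (ψ := ψ) hc hκ ht.le y
  have h1 := expWeightDeriv_le (β := β) (K := K) (ψ := ψ) hc hκ hκ' hq1 hℓ ht y
  have h2 := hH.gradient_expWeight_le (β := β) hK hψ hc hκ hκ' (by linarith) hq hK0 hK1 hψ1 hℓ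
    ht.le ht1 y
  have h3 := hH.abs_inner_flux_le ξ (gradient (expWeight ℓ c β κ q K ψ t) y)
  have h4 := le_derivMulRegPow hδ (p := q - 2) (by linarith) a
  have hq0 : 0 < q := by linarith
  set η := expWeight ℓ c β κ q K ψ t y
  rw [inner_add_right, inner_smul_right, inner_smul_right, hH.inner_flux_self]
  have hU := regPow_pos hδ q a
  have h5 : |a * regPow δ (q - 2) a| ≤ regPow δ (q - 1) a := by
    rw [abs_mul, abs_of_pos (regPow_pos hδ _ _)]
    have h6 := mul_le_mul_of_nonneg_right (le_regPow_one (δ := δ) a) (regPow_pos hδ (q - 2) a).le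
    rw [regPow_mul hδ] at h6
    rwa [show (1 : ℝ) + (q - 2) = q - 1 by ring] at h6
  have e1 : regPow δ q a / q * expWeightDeriv ℓ c β κ q K ψ t y ≤
      regPow δ q a / q * (η * (β / t - q * (ℓ / (2 * t)) * (t ^ ℓ * K y ^ 2))) := by gcongr
  have e2 : (1 + (q - 2)) * regPow δ (q - 2) a * η * H ξ ^ 2 ≤
      derivMulRegPow δ (q - 2) a * η * H ξ ^ 2 := by gcongr
  have e3 : -(a * regPow δ (q - 2) a * inner ℝ (flux H ξ)
      (gradient (expWeight ℓ c β κ q K ψ t) y)) ≤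
      regPow δ (q - 1) a * (H ξ * (η * (1 + 9 * K y))) := by
    refine (neg_le_abs _).trans ?_
    rw [abs_mul]
    have hX := hH.nonneg ξ
    have h0 := (regPow_pos hδ (q - 1) a).le
    gcongr
    exact h3.trans (mul_le_mul_of_nonneg_left h2 hX)
  have e4 : regPow δ q a / q * (η * (β / t - q * (ℓ / (2 * t)) * (t ^ ℓ * K y ^ 2))) =
      η * (β / (q * t) * regPow δ q a - ℓ / (2 * t) * (t ^ ℓ * K y ^ 2) * regPow δ q a) := by
    field_simp
  rw [e4] at e1
  linarith

end Weight

/-! ### The pointwise differential inequality -/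

section Pointwise

/-- The weighted `L^q` energy: the first order term is absorbed by the dissipation and by the good
term coming from the growth of the weight in time. -/
theorem energy_absorb {ℓ m s σ K X A B D L q : ℝ} (hℓ : 0 < ℓ) (hm : 0 < m) (hs : 0 < s)
    (hσ : 0 ≤ σ) (hsm : s ≤ m / 2) (hsσ : 324 * s ≤ ℓ * m * σ) (hA : 0 < A) (hB : 0 ≤ B)
    (hD : D ^ 2 = A * B) (hL : 0 ≤ L) (hq : 1 ≤ q) :
    s * L * (1 + ℓ / 8 * (σ * K ^ 2)) * ((1 / 2) / (q * s) * B - ℓ / (2 * s) * (σ * K ^ 2) * B -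
      m * A * X ^ 2 + D * X * (1 + 9 * K)) ≤
    L * B - s * L * (1 + ℓ / 8 * (σ * K ^ 2)) *
      (ℓ / (8 * s) * (σ * K ^ 2) * B + m / 2 * A * X ^ 2) := by
  set k := 1 + 9 * K with hk
  set z := σ * K ^ 2 with hz
  have hz0 : 0 ≤ z := by positivity
  have h1 : D * X * k ≤ m / 2 * A * X ^ 2 + 1 / (2 * m) * (B * k ^ 2) := by
    have h2 : 0 ≤ A * (m ^ 2 * A * X ^ 2 + B * k ^ 2 - 2 * m * (D * X * k)) := by
      have : A * (m ^ 2 * A * X ^ 2 + B * k ^ 2 - 2 * m * (D * X * k)) =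
          (m * A * X - D * k) ^ 2 + (A * B - D ^ 2) * k ^ 2 := by ring
      rw [this, hD]; nlinarith [sq_nonneg (m * A * X - D * k)]
    have h3 := nonneg_of_mul_nonneg_right h2 hA
    have h4 : m / 2 * A * X ^ 2 + 1 / (2 * m) * (B * k ^ 2) =
        (m ^ 2 * A * X ^ 2 + B * k ^ 2) / (2 * m) := by field_simp
    rw [h4, le_div_iff₀ (by positivity)]
    linarith
  have h5 : k ^ 2 ≤ 2 + 162 * K ^ 2 := by rw [hk]; nlinarith [sq_nonneg (1 - 9 * K)]
  have h6 : 1 / (2 * m) * (B * k ^ 2) ≤ 1 / (2 * s) * B + ℓ / (4 * s) * z * B := by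
    have h7 : 1 / (2 * m) * (B * k ^ 2) ≤ 1 / (2 * m) * (B * (2 + 162 * K ^ 2)) := by gcongr
    have h8 : 1 / m ≤ 1 / (2 * s) := one_div_le_one_div_of_le (by positivity) (by linarith)
    have h9 : 81 / m ≤ ℓ / (4 * s) * σ := by
      rw [div_mul_eq_mul_div, div_le_div_iff₀ hm (by positivity)]; linarith
    calc _ ≤ 1 / (2 * m) * (B * (2 + 162 * K ^ 2)) := h7
      _ = 1 / m * B + 81 / m * (K ^ 2 * B) := by field_simp; ring
      _ ≤ 1 / (2 * s) * B + ℓ / (4 * s) * σ * (K ^ 2 * B) := by gcongr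
      _ = _ := by rw [hz]; ring
  have h10 : (1 / 2) / (q * s) * B ≤ 1 / (2 * s) * B := by
    gcongr ?_ * B
    rw [div_le_div_iff₀ (by positivity) (by positivity)]
    nlinarith
  have hw : 0 ≤ s * L * (1 + ℓ / 8 * z) := by positivity
  have h11 : (1 / 2) / (q * s) * B - ℓ / (2 * s) * z * B - m * A * X ^ 2 + D * X * k ≤
      1 / s * B - ℓ / (4 * s) * z * B - m / 2 * A * X ^ 2 := by
    have : 1 / s * B = 1 / (2 * s) * B + 1 / (2 * s) * B := by field_simp; ring
    have : ℓ / (2 * s) * z * B = ℓ / (4 * s) * z * B + ℓ / (4 * s) * z * B := by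
      field_simp; ring
    linarith
  refine (mul_le_mul_of_nonneg_left h11 hw).trans ?_
  have h12 : s * L * (1 + ℓ / 8 * z) * (1 / s * B - ℓ / (4 * s) * z * B - m / 2 * A * X ^ 2) =
      L * B - s * L * (1 + ℓ / 8 * z) * (ℓ / (8 * s) * z * B + m / 2 * A * X ^ 2) -
        L * (ℓ / 8 * z) * (ℓ / 8 * z) * B := by
    field_simp; ring
  rw [h12]
  have : 0 ≤ L * (ℓ / 8 * z) * (ℓ / 8 * z) * B := by positivity
  linarith

/-- The scale `r² = m s / 32` in the Nash inequality is small enough for its gradient term to be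
absorbed by what is left of the dissipation and of the good term. -/
theorem nash_absorb {ℓ m s σ K X A B L E f Y d : ℝ} (hℓ : 0 < ℓ) (hm : 0 < m) (hm2 : m ≤ 1 / 2)
    (hs : 0 < s) (hs1 : s ≤ 1) (hσ : 0 ≤ σ) (hsσ : 324 * s ≤ ℓ * m * σ) (hA : 0 < A) (hB : 0 ≤ B)
    (hL : 0 ≤ L) (hE : 0 ≤ E) (hY : Y ≤ 2 * (E * (A * X ^ 2)) + 2 * (E * (B * (1 + 9 * K) ^ 2)))
    (hf : E * B ≤ f + d) :
    L * E * B - s * (L * E) * (1 + ℓ / 8 * (σ * K ^ 2)) *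
      (ℓ / (8 * s) * (σ * K ^ 2) * B + m / 4 * A * X ^ 2) ≤
    2 * L * (f - 2 * (m / 32 * s) * Y) + 2 * L * d := by
  set z := σ * K ^ 2 with hz
  have hz0 : 0 ≤ z := by positivity
  have h1 : s * (L * E) * (ℓ / (8 * s) * z * B + m / 4 * A * X ^ 2) ≤
      s * (L * E) * (1 + ℓ / 8 * z) * (ℓ / (8 * s) * z * B + m / 4 * A * X ^ 2) := by
    have h0 : 0 ≤ ℓ / 8 * z := by positivity
    have h0' : 0 ≤ s * (L * E) := by positivity
    have hQ : 0 ≤ ℓ / (8 * s) * z * B + m / 4 * A * X ^ 2 := by positivity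
    exact mul_le_mul_of_nonneg_right (le_mul_of_one_le_right h0' (by linarith)) hQ
  have h2 : s * (L * E) * (ℓ / (8 * s) * z * B + m / 4 * A * X ^ 2) =
      L * (ℓ / 8 * (E * B) * z + s * m / 4 * (E * (A * X ^ 2))) := by field_simp
  have h5 : (1 + 9 * K) ^ 2 ≤ 2 + 162 * K ^ 2 := by nlinarith [sq_nonneg (1 - 9 * K)]
  have hEB : 0 ≤ E * B := by positivity
  have h6 : Y ≤ 2 * (E * (A * X ^ 2)) + 4 * (E * B) + 324 * (E * B) * K ^ 2 := by
    have := mul_le_mul_of_nonneg_left h5 hEB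
    linarith
  have h7 : 4 * (m / 32 * s) * Y ≤
      E * B + ℓ / 8 * (E * B) * z + s * m / 4 * (E * (A * X ^ 2)) := by
    have h8 : 4 * (m / 32 * s) * Y ≤ 4 * (m / 32 * s) *
        (2 * (E * (A * X ^ 2)) + 4 * (E * B) + 324 * (E * B) * K ^ 2) := by gcongr
    have h9 : 4 * (m / 32 * s) * (4 * (E * B)) ≤ E * B := by
      have : m * s ≤ 1 := by nlinarith
      nlinarith
    have h10 : 4 * (m / 32 * s) * (324 * (E * B) * K ^ 2) ≤ ℓ / 8 * (E * B) * z := by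
      have h11 : m * (324 * s) ≤ ℓ * σ := by
        have h12 : m * (324 * s) ≤ m * (ℓ * m * σ) := by gcongr
        have h13 : m * m ≤ 1 := by nlinarith
        have : 0 ≤ ℓ * σ := by positivity
        nlinarith
      have h14 : 0 ≤ E * B * K ^ 2 := by positivity
      rw [hz]
      nlinarith
    linarith
  have h8 := mul_le_mul_of_nonneg_left h7 hL
  have h9 := mul_le_mul_of_nonneg_left hf hL
  rw [h2] at h1
  linarith

theorem rpow_mul_rpow_le_add {x y m : ℝ} (hx : 0 ≤ x) (hy : 0 ≤ y) (hm0 : 0 ≤ m) (hm1 : m ≤ 1) :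
    x ^ (1 - m) * y ^ m ≤ x + y := by
  have h := Real.geom_mean_le_arith_mean2_weighted (w₁ := 1 - m) (w₂ := m) (by linarith) hm0 hx hy
    (by ring)
  nlinarith

/-- The constant in front of the last term of `remainder_le`. -/
noncomputable def youngConst (ℓ m : ℝ) : ℝ :=
  (162 / m * ((ℓ / 8) ^ (-m) * (2 / ℓ) ^ (1 - m))) ^ (1 / m)

theorem youngConst_pos {ℓ m : ℝ} (hℓ : 0 < ℓ) (hm : 0 < m) : 0 < youngConst ℓ m := by
  unfold youngConst; positivity

/-- The remainder of the first order term in the `L¹` estimate, after the dissipation of the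
`L^q` energy has been used, is absorbed by the good term up to an integrable power of time. -/
theorem remainder_le {ℓ m s K w y : ℝ} (hℓ : 0 < ℓ) (hm : 0 < m) (hm2 : m ≤ 1 / 2) (hs : 0 < s)
    (hw : 0 ≤ w) (hy : 0 ≤ y) :
    1 / m * s ^ (-(1 / 2 : ℝ)) * (1 + 9 * K) ^ 2 / (1 + ℓ / 8 * (s ^ ℓ * K ^ 2)) *
      (w ^ (1 - m) * y ^ m) ≤
    2 / m * s ^ (-(1 / 2 : ℝ)) * (w + y) + ℓ / (2 * s) * (s ^ ℓ * K ^ 2) * w +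
      youngConst ℓ m * s ^ ((1 / 2 - ℓ) / m - 1) * y := by
  set z := s ^ ℓ * K ^ 2 with hz
  have hσ : 0 < s ^ ℓ := Real.rpow_pos_of_pos hs ℓ
  have hz0 : 0 ≤ z := by positivity
  have hκz : 0 < 1 + ℓ / 8 * z := by positivity
  have hh : 0 < s ^ (-(1 / 2 : ℝ)) := Real.rpow_pos_of_pos hs _
  have hg : 0 ≤ w ^ (1 - m) * y ^ m := by positivity
  have h5 : (1 + 9 * K) ^ 2 ≤ 2 + 162 * K ^ 2 := by nlinarith [sq_nonneg (1 - 9 * K)]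
  have hy2 := rpow_mul_rpow_le_add hw hy hm.le (by linarith)
  have hKz : K ^ 2 = s ^ (-ℓ) * z := by
    rw [hz, Real.rpow_neg hs.le]; field_simp
  have hzk : z / (1 + ℓ / 8 * z) ≤ (ℓ / 8) ^ (-m) * z ^ (1 - m) := by
    rcases hz0.eq_or_lt with h | h
    · rw [← h, zero_div]; positivity
    · have h6 : (ℓ / 8 * z) ^ m ≤ 1 + ℓ / 8 * z := by
        have := rpow_mul_rpow_le_add zero_le_one (y := ℓ / 8 * z) (by positivity) hm.le
          (by linarith)
        rwa [Real.one_rpow, one_mul] at this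
      rw [div_le_iff₀ hκz]
      calc z = (ℓ / 8) ^ (-m) * z ^ (1 - m) * (ℓ / 8 * z) ^ m := by
            rw [Real.mul_rpow (by positivity) hz0, Real.rpow_neg (by positivity),
              Real.rpow_sub h, Real.rpow_one]
            have : 0 < z ^ m := Real.rpow_pos_of_pos h m
            have : 0 < (ℓ / 8) ^ m := by positivity
            field_simp
        _ ≤ _ := by gcongr
  -- split `(1 + 9 K)²`
  have hsplit : 1 / m * s ^ (-(1 / 2 : ℝ)) * (1 + 9 * K) ^ 2 / (1 + ℓ / 8 * z) *
      (w ^ (1 - m) * y ^ m) ≤ 2 / m * s ^ (-(1 / 2 : ℝ)) * (w ^ (1 - m) * y ^ m) +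
      162 / m * s ^ (-(1 / 2 : ℝ)) * s ^ (-ℓ) * ((ℓ / 8) ^ (-m) * z ^ (1 - m)) *
        (w ^ (1 - m) * y ^ m) := by
    rw [← add_mul]
    refine mul_le_mul_of_nonneg_right ?_ hg
    have h7 : 1 / m * s ^ (-(1 / 2 : ℝ)) * (1 + 9 * K) ^ 2 / (1 + ℓ / 8 * z) ≤
        1 / m * s ^ (-(1 / 2 : ℝ)) * (2 + 162 * K ^ 2) / (1 + ℓ / 8 * z) := by gcongr
    have h8 : 1 / m * s ^ (-(1 / 2 : ℝ)) * (2 + 162 * K ^ 2) / (1 + ℓ / 8 * z) =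
        2 / m * s ^ (-(1 / 2 : ℝ)) * (1 / (1 + ℓ / 8 * z)) +
          162 / m * s ^ (-(1 / 2 : ℝ)) * s ^ (-ℓ) * (z / (1 + ℓ / 8 * z)) := by
      rw [hKz]; field_simp
    have h9 : 1 / (1 + ℓ / 8 * z) ≤ 1 := by
      rw [div_le_one hκz]
      have : 0 ≤ ℓ / 8 * z := by positivity
      linarith
    rw [h8] at h7
    refine h7.trans (add_le_add ?_ ?_)
    · exact mul_le_of_le_one_right (by positivity) h9
    · gcongr
  -- the second part, by the weighted inequality between the means
  have hpart : 162 / m * s ^ (-(1 / 2 : ℝ)) * s ^ (-ℓ) * ((ℓ / 8) ^ (-m) * z ^ (1 - m)) *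
      (w ^ (1 - m) * y ^ m) ≤
      ℓ / (2 * s) * z * w + youngConst ℓ m * s ^ ((1 / 2 - ℓ) / m - 1) * y := by
    have hc := (youngConst_pos hℓ hm).le
    have hsp : 0 ≤ s ^ ((1 / 2 - ℓ) / m - 1) := Real.rpow_nonneg hs.le _
    refine le_trans (le_of_eq ?_) (rpow_mul_rpow_le_add (x := ℓ / (2 * s) * z * w)
      (y := youngConst ℓ m * s ^ ((1 / 2 - ℓ) / m - 1) * y) (by positivity) (by positivity) hm.le
      (by linarith))
    rw [Real.mul_rpow (x := ℓ / (2 * s) * z) (by positivity) hw,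
      Real.mul_rpow (x := ℓ / (2 * s)) (by positivity) hz0,
      Real.mul_rpow (x := youngConst ℓ m * s ^ ((1 / 2 - ℓ) / m - 1)) (by positivity) hy,
      Real.mul_rpow (x := youngConst ℓ m) hc hsp, youngConst, ← Real.rpow_mul (by positivity),
      one_div_mul_cancel hm.ne', Real.rpow_one, ← Real.rpow_mul hs.le]
    have e1 : (ℓ / (2 * s)) ^ (1 - m) * (2 / ℓ) ^ (1 - m) = s ^ (-(1 - m)) := by
      rw [← Real.mul_rpow (by positivity) (by positivity), Real.rpow_neg hs.le,
        ← Real.inv_rpow hs.le]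
      congr 1; field_simp
    have e2 : s ^ (-(1 / 2 : ℝ)) * s ^ (-ℓ) =
        s ^ (-(1 - m)) * s ^ (((1 / 2 - ℓ) / m - 1) * m) := by
      rw [← Real.rpow_add hs, ← Real.rpow_add hs]
      congr 1; field_simp; ring
    calc _ = 162 / m * (s ^ (-(1 / 2 : ℝ)) * s ^ (-ℓ)) * ((ℓ / 8) ^ (-m) * z ^ (1 - m)) *
        (w ^ (1 - m) * y ^ m) := by ring
      _ = 162 / m * ((ℓ / (2 * s)) ^ (1 - m) * (2 / ℓ) ^ (1 - m) *
          s ^ (((1 / 2 - ℓ) / m - 1) * m)) * ((ℓ / 8) ^ (-m) * z ^ (1 - m)) *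
        (w ^ (1 - m) * y ^ m) := by rw [e2, e1]
      _ = _ := by ring
  have hfirst : 2 / m * s ^ (-(1 / 2 : ℝ)) * (w ^ (1 - m) * y ^ m) ≤
      2 / m * s ^ (-(1 / 2 : ℝ)) * (w + y) := by gcongr
  linarith

/-- The first order term in the `L¹` estimate is absorbed by the dissipation of the weighted `L^q`
energy, up to a remainder. -/
theorem mass_absorb {m s X A Λ c k e g : ℝ} (hm : 0 < m) (hs : 0 < s) (hA : 0 < A) (hΛ : 0 < Λ)
    (hc : 0 < c) (he : e ^ 2 = Λ * A * g) :
    e * X * k ≤ s ^ (1 / 2 : ℝ) * Λ * c * (m / 4 * A * X ^ 2) +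
      1 / m * s ^ (-(1 / 2 : ℝ)) * k ^ 2 / c * g := by
  have hσ : 0 < s ^ (1 / 2 : ℝ) := Real.rpow_pos_of_pos hs _
  rw [Real.rpow_neg hs.le]
  set σ := s ^ (1 / 2 : ℝ)
  have hP : 0 < σ * Λ * c * A * m := by positivity
  have h1 : 1 / m * σ⁻¹ * k ^ 2 / c * g = (e * k) ^ 2 / (σ * Λ * c * A * m) := by
    rw [mul_pow, he]; field_simp
  rw [h1]
  have h2 : e * X * k ≤ σ * Λ * c * A * m / 4 * X ^ 2 + (e * k) ^ 2 / (σ * Λ * c * A * m) := by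
    set P := σ * Λ * c * A * m
    have h3 : P / 4 * X ^ 2 + (e * k) ^ 2 / P - e * X * k = (P / 2 * X - e * k) ^ 2 / P := by
      field_simp; ring
    have : 0 ≤ (P / 2 * X - e * k) ^ 2 / P := by positivity
    linarith
  linarith

variable {N : ℕ} {H : Space N → ℝ} {K ψ : Space N → ℝ}

/-- Pointwise form of the estimate for the sum of the weighted `L¹` mass and the weighted `L^q`
energy, `q = 1 + m`. The first term on the right is the integrand of a Nash inequality. -/
theorem IsFinslerNorm.integrand_add_le (hH : IsFinslerNorm H) (hK : ContDiff ℝ ∞ K)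
    (hψ : ContDiff ℝ ∞ ψ) (hK0 : ∀ y, 0 ≤ K y) (hψ0 : ∀ y, 0 ≤ ψ y)
    (hK1 : ∀ y, H (gradient K y) ≤ 1) (hψ1 : ∀ y, H (gradient ψ y) ≤ 1) {ℓ m μ s δ : ℝ}
    (hℓ : 0 < ℓ) (hℓ1 : ℓ ≤ 1) (hm : 0 < m) (hm2 : m ≤ 1 / 2) (hμ : 0 < μ) (hs : 0 < s)
    (hs1 : s ≤ 1) (hsm : s ≤ m / 2) (hsσ : 324 * s ≤ ℓ * m * s ^ ℓ) (hδ : 0 < δ) (y : Space N)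
    (a : ℝ) (ξ : Space N) :
    (regPow δ 1 a / 1 * expWeightDeriv ℓ 1 0 0 1 K ψ s y -
      inner ℝ (flux H ξ) ((derivMulRegPow δ (1 - 2) a * expWeight ℓ 1 0 0 1 K ψ s y) • ξ +
        (a * regPow δ (1 - 2) a) • gradient (expWeight ℓ 1 0 0 1 K ψ s) y)) +
    (regPow δ (1 + m) a / (1 + m) *
        expWeightDeriv ℓ (μ ^ (-m)) (1 / 2) (ℓ / 8) (1 + m) K ψ s y -
      inner ℝ (flux H ξ) ((derivMulRegPow δ (1 + m - 2) a *
          expWeight ℓ (μ ^ (-m)) (1 / 2) (ℓ / 8) (1 + m) K ψ s y) • ξ +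
        (a * regPow δ (1 + m - 2) a) •
          gradient (expWeight ℓ (μ ^ (-m)) (1 / 2) (ℓ / 8) (1 + m) K ψ s) y)) ≤
    2 * (μ ^ (-m) * s ^ (-(1 / 2 : ℝ))) *
      ((a * regPow δ ((1 + m) / 2 - 1) a *
          expWeight ℓ 1 0 0 ((1 + m) / 2) K (fun y => ψ y / 2) s y) ^ 2 -
        2 * (m / 32 * s) *
          H ((derivMulRegPow δ ((1 + m) / 2 - 1) a *
              expWeight ℓ 1 0 0 ((1 + m) / 2) K (fun y => ψ y / 2) s y) • ξ +
            (a * regPow δ ((1 + m) / 2 - 1) a) •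
              gradient (expWeight ℓ 1 0 0 ((1 + m) / 2) K (fun y => ψ y / 2) s) y) ^ 2) +
      2 * (μ ^ (-m) * s ^ (-(1 / 2 : ℝ))) * δ ^ (1 + m) +
      2 / m * s ^ (-(1 / 2 : ℝ)) *
        (regPow δ 1 a * expWeight ℓ 1 0 0 1 K ψ s y + μ * Real.exp (-ψ y)) +
      youngConst ℓ m * s ^ ((1 / 2 - ℓ) / m - 1) * (μ * Real.exp (-ψ y)) := by
  have hσ : 0 < s ^ ℓ := Real.rpow_pos_of_pos hs ℓ
  have hΛ : 0 < μ ^ (-m) := Real.rpow_pos_of_pos hμ _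
  have hh : 0 < s ^ (-(1 / 2 : ℝ)) := Real.rpow_pos_of_pos hs _
  have hA := regPow_pos hδ (1 + m - 2) a
  have hB := regPow_pos hδ (1 + m) a
  have hD := regPow_pos hδ (1 + m - 1) a
  have hU := regPow_pos hδ 1 a
  have hX := hH.nonneg ξ
  have hD2 : regPow δ (1 + m - 1) a ^ 2 = regPow δ (1 + m - 2) a * regPow δ (1 + m) a := by
    rw [sq, regPow_mul hδ, regPow_mul hδ]; congr 1; ring
  -- the weights in terms of the two exponentials
  set h := K y ^ 2 * (1 + s ^ ℓ) with hh_def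
  set E := Real.exp (-((1 + m) * h + ψ y)) with hE_def
  set e := Real.exp (-(h + ψ y)) with he_def
  have hE : 0 < E := Real.exp_pos _
  have hz0 : 0 ≤ s ^ ℓ * K y ^ 2 := by positivity
  have hh0 : 0 ≤ h := by positivity
  have hη1 : expWeight ℓ 1 0 0 1 K ψ s y = e := by simp [expWeight, he_def, hh_def]
  have hsL : s ^ (1 / 2 : ℝ) = s * s ^ (-(1 / 2 : ℝ)) := by
    rw [← Real.rpow_one_add' hs.le (by norm_num)]; norm_num
  have hη2 : expWeight ℓ (μ ^ (-m)) (1 / 2) (ℓ / 8) (1 + m) K ψ s y =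
      s * (μ ^ (-m) * s ^ (-(1 / 2 : ℝ)) * E) * (1 + ℓ / 8 * (s ^ ℓ * K y ^ 2)) := by
    rw [expWeight, hsL]; ring
  have hη3 : expWeight ℓ 1 0 0 ((1 + m) / 2) K (fun y => ψ y / 2) s y ^ 2 = E := by
    simp only [expWeight, Real.rpow_zero, zero_mul, add_zero, one_mul]
    rw [← Real.exp_nat_mul]; congr 1; push_cast; ring
  have i1 := hH.integrand_le hK hψ zero_le_one (le_refl (0 : ℝ)) (by norm_num) (le_refl (1 : ℝ))
    one_le_two hK0 hK1 hψ1 hℓ.le hs hs1 (β := 0) y hδ a ξ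
  have i2 := hH.integrand_le hK hψ hΛ.le (κ := ℓ / 8) (by positivity) (by linarith)
    (q := 1 + m) (by linarith) (by linarith) hK0 hK1 hψ1 hℓ.le hs hs1 (β := 1 / 2) y hδ a ξ
  rw [hη1] at i1 ⊢
  rw [hη2] at i2 ⊢
  rw [show (1 : ℝ) - 1 = 0 by norm_num, regPow_zero] at i1
  -- absorption
  set L := μ ^ (-m) * s ^ (-(1 / 2 : ℝ)) with hL_def
  have hL : 0 < L := by positivity
  have a1 := energy_absorb (K := K y) (X := H ξ) (L := L * E) hℓ hm hs hσ.le hsm hsσ hA hB.le hD2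
    (by positivity) (by linarith : (1 : ℝ) ≤ 1 + m)
  have hw : 0 ≤ regPow δ 1 a * e := by positivity
  have hYw : 0 ≤ μ * Real.exp (-ψ y) := by positivity
  have a2 := remainder_le (K := K y) hℓ hm hm2 hs hw hYw
  have a3 := mass_absorb (X := H ξ) (A := regPow δ (1 + m - 2) a) (Λ := μ ^ (-m) * E)
    (c := 1 + ℓ / 8 * (s ^ ℓ * K y ^ 2)) (k := 1 + 9 * K y) (e := e)
    (g := (regPow δ 1 a * e) ^ (1 - m) * (μ * Real.exp (-ψ y)) ^ m) hm hs hA (by positivity)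
    (by positivity) (by
      rw [Real.mul_rpow hU.le (by positivity), Real.mul_rpow hμ.le (by positivity),
        ← regPow_eq_rpow hδ, Real.rpow_neg hμ.le, ← Real.exp_mul, ← Real.exp_mul]
      have e1 : regPow δ (1 + m - 2) a * regPow δ (1 - m) a = 1 := by
        rw [regPow_mul hδ, show 1 + m - 2 + (1 - m) = 0 by ring, regPow_zero]
      have e2 : E * (Real.exp (-(h + ψ y) * (1 - m)) * Real.exp (-ψ y * m)) = e ^ 2 := by
        rw [← Real.exp_add, ← Real.exp_add, ← Real.exp_nat_mul]; congr 1; push_cast; ring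
      have e3 : 0 < μ ^ m := Real.rpow_pos_of_pos hμ m
      calc e ^ 2 = (regPow δ (1 + m - 2) a * regPow δ (1 - m) a) *
          (E * (Real.exp (-(h + ψ y) * (1 - m)) * Real.exp (-ψ y * m))) * ((μ ^ m)⁻¹ * μ ^ m) := by
            rw [e1, e2, inv_mul_cancel₀ e3.ne']; ring
        _ = _ := by ring)
  -- the gradient in the Nash inequality
  set η3 := expWeight ℓ 1 0 0 ((1 + m) / 2) K (fun y => ψ y / 2) s with hη3_def
  have hη3' : 0 ≤ η3 y := expWeight_nonneg zero_le_one le_rfl hs.le y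
  have hψ2 : ContDiff ℝ ∞ fun y => ψ y / 2 := by fun_prop
  have hψ2' : ∀ y, H (gradient (fun y => ψ y / 2) y) ≤ 1 := fun y => by
    have : gradient (fun y => ψ y / 2) y = (1 / 2 : ℝ) • gradient ψ y := by
      have h1 := ((hψ.differentiable (by simp) y).hasFDerivAt.const_mul (1 / 2 : ℝ))
      have h2 : (fun y => ψ y / 2) = fun y => 1 / 2 * ψ y := by funext y; ring
      rw [gradient, h2, h1.fderiv, gradient, map_smul]
    rw [this, hH.homogeneous, abs_of_pos (by norm_num)]
    linarith [hψ1 y]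
  have g1 := hH.gradient_expWeight_le (β := 0) (c := 1) (κ := 0) (q := (1 + m) / 2) hK hψ2
    zero_le_one le_rfl (by norm_num) (by linarith) (by linarith) hK0 hK1 hψ2' hℓ.le hs.le hs1 y
  rw [← hη3_def] at g1
  have g2 := derivMulRegPow_le hδ (p := (1 + m) / 2 - 1) (by linarith) a
  have g3 := derivMulRegPow_nonneg hδ (p := (1 + m) / 2 - 1) (by linarith) (by linarith) a
  have hR := regPow_pos hδ ((1 + m) / 2 - 1) a
  have hR2 : regPow δ ((1 + m) / 2 - 1) a ^ 2 = regPow δ (1 + m - 2) a := by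
    rw [sq, regPow_mul hδ]; congr 1; ring
  have hS := regPow_pos hδ ((1 + m) / 2) a
  have hS2 : regPow δ ((1 + m) / 2) a ^ 2 = regPow δ (1 + m) a := by
    rw [sq, regPow_mul hδ]; congr 1; ring
  have g4 : |a * regPow δ ((1 + m) / 2 - 1) a| ≤ regPow δ ((1 + m) / 2) a := by
    rw [abs_mul, abs_of_pos hR]
    have h6 := mul_le_mul_of_nonneg_right (le_regPow_one (δ := δ) a) hR.le
    rw [regPow_mul hδ] at h6
    rwa [show (1 : ℝ) + ((1 + m) / 2 - 1) = (1 + m) / 2 by ring] at h6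
  set Z := (derivMulRegPow δ ((1 + m) / 2 - 1) a * η3 y) • ξ +
    (a * regPow δ ((1 + m) / 2 - 1) a) • gradient η3 y with hZ
  have g5 : H Z ≤ η3 y * (regPow δ ((1 + m) / 2 - 1) a * H ξ) +
      η3 y * (regPow δ ((1 + m) / 2) a * (1 + 9 * K y)) := by
    refine (hH.add_le _ _).trans ?_
    rw [hH.homogeneous, hH.homogeneous, abs_of_nonneg (mul_nonneg g3 hη3')]
    have hg := hH.nonneg (gradient η3 y)
    calc _ ≤ regPow δ ((1 + m) / 2 - 1) a * η3 y * H ξ +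
          regPow δ ((1 + m) / 2) a * (η3 y * (1 + 9 * K y)) := by gcongr
      _ = _ := by ring
  have g6 : H Z ^ 2 ≤ 2 * (E * (regPow δ (1 + m - 2) a * H ξ ^ 2)) +
      2 * (E * (regPow δ (1 + m) a * (1 + 9 * K y) ^ 2)) := by
    have h1 := pow_le_pow_left₀ (hH.nonneg Z) g5 2
    refine h1.trans ((add_sq_le).trans (le_of_eq ?_))
    rw [← hη3, ← hR2, ← hS2]; ring
  have hδq : 0 < δ ^ (1 + m) := Real.rpow_pos_of_pos hδ _
  have hE1 : E ≤ 1 := Real.exp_le_one_iff.2 (by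
    have := hψ0 y
    have : 0 ≤ (1 + m) * h := by positivity
    linarith)
  have hf : E * regPow δ (1 + m) a ≤
      (a * regPow δ ((1 + m) / 2 - 1) a * η3 y) ^ 2 + δ ^ (1 + m) := by
    rw [mul_pow, mul_pow, hR2, hη3, regPow_eq_add hδ (1 + m) a]
    have h1 := sq_mul_regPow_sub_two_le hδ (p := 1 + m) (by linarith) a
    have h2 : E * (δ ^ 2 * regPow δ (1 + m - 2) a) ≤ 1 * δ ^ (1 + m) := by gcongr
    linarith
  have a4 := nash_absorb hℓ hm hm2 hs hs1 hσ.le hsσ hA hB.le hL.le hE.le g6 hf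
  have hsL2 : s ^ (1 / 2 : ℝ) * (μ ^ (-m) * E) = s * (L * E) := by rw [hsL, hL_def]; ring
  rw [hsL2] at a3
  rw [show 1 + m - 1 = m by ring] at i2 a1
  refine (add_le_add i1 (i2.trans a1)).trans ?_
  rw [zero_div, zero_mul, zero_mul, zero_mul, one_mul]
  generalize s * (L * E) * (1 + ℓ / 8 * (s ^ ℓ * K y ^ 2)) = η2 at *
  generalize 1 / m * s ^ (-(1 / 2 : ℝ)) * (1 + 9 * K y) ^ 2 / (1 + ℓ / 8 * (s ^ ℓ * K y ^ 2)) *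
        ((regPow δ 1 a * e) ^ (1 - m) * (μ * Real.exp (-ψ y)) ^ m) = T at *
  clear_value L E e Z η3
  linarith

end Pointwise

/-! ### The differential inequality for the energy -/

section Energy

variable {N : ℕ} {H : Space N → ℝ} {Ω : Set (Space N)} {u : ℝ → L2 Ω} {G : ℝ → L2Vec Ω}
  {K ψ : Space N → ℝ}

/-- The integrand in the left derivative of `weightedMass`. -/
noncomputable def slopeIntegrand (H : Space N → ℝ) (δ q : ℝ) (η η' : Space N → ℝ)
    (w : Space N → ℝ) (g : Space N → Space N) (y : Space N) : ℝ :=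
  regPow δ q (w y) / q * η' y -
    inner ℝ (flux H (g y)) ((derivMulRegPow δ (q - 2) (w y) * η y) • g y +
      (w y * regPow δ (q - 2) (w y)) • gradient η y)

theorem abs_derivMulRegPow_le {δ p : ℝ} (hδ : 0 < δ) (hp1 : -1 ≤ p) (hp : p ≤ 0) (a : ℝ) :
    |derivMulRegPow δ p a| ≤ δ ^ p := by
  rw [← (hasDerivAt_mul_regPow hδ p a).deriv]
  exact abs_deriv_mul_regPow_le hδ hp1 hp a

theorem exists_bounds_weight (hΩ : Bornology.IsBounded Ω) (hΩm : MeasurableSet Ω)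
    {η : Space N → ℝ} (hη : ContDiff ℝ ∞ η) :
    ∃ M, (∀ᵐ y ∂(volume.restrict Ω), |η y| ≤ M) ∧
      ∀ᵐ y ∂(volume.restrict Ω), ‖gradient η y‖ ≤ M := by
  obtain ⟨M₁, h1⟩ := exists_bound_of_continuous hΩ hη.continuous
  obtain ⟨M₂, h2⟩ := exists_bound_of_continuous hΩ (continuous_gradient hη)
  exact ⟨max M₁ M₂,
    (ae_restrict_iff' hΩm).2 (ae_of_all _ fun y hy => (h1 y hy).trans (le_max_left _ _)),
    (ae_restrict_iff' hΩm).2 (ae_of_all _ fun y hy => (h2 y hy).trans (le_max_right _ _))⟩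

theorem IsFinslerNorm.integrable_slopeIntegrand (hH : IsFinslerNorm H)
    (hΩ : Bornology.IsBounded Ω) (hΩm : MeasurableSet Ω) {δ q : ℝ} (hδ : 0 < δ) (hq1 : 1 ≤ q)
    (hq2 : q ≤ 2) {η η' : Space N → ℝ} (hη : ContDiff ℝ ∞ η) (hη' : Continuous η')
    {p : L2 Ω × L2Vec Ω} (hp : p ∈ sobolevH10 Ω) :
    Integrable (slopeIntegrand H δ q η η' p.1 p.2) (volume.restrict Ω) := by
  have : IsFiniteMeasure (volume.restrict Ω) := ⟨by simpa using hΩ.measure_lt_top⟩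
  obtain ⟨M, h1, h2⟩ := exists_bounds_weight hΩ hΩm hη
  obtain ⟨M', h3⟩ := exists_bound_of_continuous hΩ hη'
  obtain ⟨P, -, -, hP2⟩ := exists_mem_sobolevH10_comp
    (F := fun a => a * regPow δ (q - 2) a) (F' := derivMulRegPow δ (q - 2)) (L := δ ^ (q - 2))
    (contDiff_mul_regPow hδ _) (by simp) (hasDerivAt_mul_regPow hδ _)
    (abs_derivMulRegPow_le hδ (by linarith) (by linarith)) hη h1 h2 hp
  refine Integrable.sub ?_ ?_
  · exact (integrable_comp_L2 ((continuous_regPow hδ q).div_const q)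
      (abs_regPow_div_le hδ hq1 hq2) p.1).mul_bdd (c := M') hη'.aestronglyMeasurable
      ((ae_restrict_iff' hΩm).2 (ae_of_all _ h3))
  · refine (L2.integrable_inner (𝕜 := ℝ) P.2 (hH.fluxL2 p.2)).congr ?_
    filter_upwards [hP2, hH.coeFn_fluxL2 p.2] with y h1 h2
    rw [h1, h2, real_inner_comm]

theorem continuous_expWeightDeriv {ℓ c β κ q s : ℝ} (hK : Continuous K) (hψ : Continuous ψ) :
    Continuous (expWeightDeriv ℓ c β κ q K ψ s) := by
  unfold expWeightDeriv
  fun_prop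

/-- The left difference quotients of the weighted mass with the weight `expWeight`. -/
theorem eventually_slope_expWeight_lt (hH : IsFinslerNorm H) (hΩ : Bornology.IsBounded Ω)
    (hΩm : MeasurableSet Ω) {δ q : ℝ} (hδ : 0 < δ) (hq1 : 1 ≤ q) (hq2 : q ≤ 2)
    (hu : ContinuousOn u (Ici 0)) (hG : ContinuousOn G (Ici 0))
    (hmem : ∀ t, 0 ≤ t → (u t, G t) ∈ sobolevH10 Ω)
    (hweak : ∀ p ∈ sobolevH10 Ω, ∀ a b : ℝ, 0 < a → 0 < b →
        inner ℝ p.1 (u b - u a) = -∫ t in a..b, inner ℝ p.2 (hH.fluxL2 (G t)))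
    (hK : ContDiff ℝ ∞ K) (hψ : ContDiff ℝ ∞ ψ) {ℓ c β κ : ℝ} (hc : 0 ≤ c)
    (hκ : 0 ≤ κ) {s : ℝ} (hs : 0 < s) {r : ℝ}
    (hr : ∫ y in Ω, slopeIntegrand H δ q (expWeight ℓ c β κ q K ψ s)
      (expWeightDeriv ℓ c β κ q K ψ s) (u s) (G s) y < r) :
    ∀ᶠ a in 𝓝[<] s, (weightedMass Ω δ q (expWeight ℓ c β κ q K ψ) u s -
      weightedMass Ω δ q (expWeight ℓ c β κ q K ψ) u a) / (s - a) < r := by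
  have hηs := contDiff_expWeight (ℓ := ℓ) (c := c) (β := β) (κ := κ) (q := q) hK hψ
  obtain ⟨M₁, h1⟩ := exists_bound_of_continuous hΩ (hηs s).continuous
  obtain ⟨M₂, h2⟩ := exists_bound_of_continuous hΩ (continuous_gradient (hηs s))
  obtain ⟨M₃, h3⟩ := exists_lipschitz_expWeight (ℓ := ℓ) (c := c) (β := β) (κ := κ) (q := q) hΩ
    hK.continuous hψ.continuous hs
  refine eventually_slope_weightedMass_lt hH hΩ.measure_lt_top.ne hΩm hδ hq1 hq2 hu hG hmem hweak
    hs (fun t => (hηs t).continuous) (hηs s) (fun y => expWeight_nonneg hc hκ hs.le y)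
    (M := max M₁ (max M₂ M₃)) (fun y hy => (h1 y hy).trans (le_max_left _ _))
    (fun y hy => (h2 y hy).trans ((le_max_left _ _).trans (le_max_right _ _)))
    (fun y => hasDerivAt_expWeight hs y) ?_ hr
  filter_upwards [h3, self_mem_nhdsWithin] with a ha (has : a < s) y hy
  refine (ha y hy).trans (mul_le_mul_of_nonneg_right ?_ (by linarith))
  exact (le_max_right _ _).trans (le_max_right _ _)

theorem continuousOn_weightedMass_expWeight (hΩ : Bornology.IsBounded Ω) (hΩm : MeasurableSet Ω)
    {δ q : ℝ} (hδ : 0 < δ) (hq1 : 1 ≤ q) (hq2 : q ≤ 2) (hu : ContinuousOn u (Ici 0))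
    (hK : ContDiff ℝ ∞ K) (hψ : ContDiff ℝ ∞ ψ) {ℓ c β κ : ℝ} (hℓ : 0 ≤ ℓ) (hβ : 0 ≤ β) :
    ContinuousOn (weightedMass Ω δ q (expWeight ℓ c β κ q K ψ) u) (Ici 0) := by
  intro s hs
  have hc := continuous_expWeight (c := c) (κ := κ) (q := q) hℓ hβ hK.continuous hψ.continuous
  obtain ⟨M, hM⟩ := exists_bound_expWeight (c := c) (κ := κ) (q := q) hΩ hℓ hβ hK.continuous
    hψ.continuous s
  refine continuousWithinAt_weightedMass (M := M) hΩ.measure_lt_top.ne hδ hq1 hq2 hu hs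
    (fun t => (contDiff_expWeight hK hψ t).continuous) ?_ fun y => ?_
  · filter_upwards [mem_nhdsWithin_of_mem_nhds (Icc_mem_nhds (sub_one_lt s) (lt_add_one s))]
      with t ht
    exact (ae_restrict_iff' hΩm).2 (ae_of_all _ (hM t ht))
  · have h1 : Continuous fun t => expWeight ℓ c β κ q K ψ t y :=
      hc.comp (continuous_id.prodMk continuous_const)
    exact h1.continuousAt.continuousWithinAt

/-- Comparison on `[0, t]` by means of left difference quotients. -/
theorem sub_le_sub_of_left_slope {f B B' : ℝ → ℝ} {t : ℝ} (ht : 0 ≤ t)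
    (hf : ContinuousOn f (Icc 0 t)) (hB : ContinuousOn B (Icc 0 t))
    (hB' : ∀ s ∈ Ioc 0 t, HasDerivAt B (B' s) s)
    (h : ∀ s ∈ Ioc 0 t, ∀ r, B' s < r → ∀ᶠ a in 𝓝[<] s, (f s - f a) / (s - a) < r) :
    f t - f 0 ≤ B t - B 0 := by
  have hmap : MapsTo (fun x => t - x) (Icc 0 t) (Icc 0 t) := fun x hx =>
    ⟨by linarith [hx.2], by linarith [hx.1]⟩
  have hcs : ContinuousOn (fun x : ℝ => t - x) (Icc 0 t) := by fun_prop
  have key := image_le_of_liminf_slope_right_le_deriv_boundary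
    (f := fun x => -f (t - x)) (a := 0) (b := t) (B := fun x => -B (t - x) + (B t - f t))
    (B' := fun x => B' (t - x)) (hf.comp hcs hmap).neg (by simp)
    ((hB.comp hcs hmap).neg.add continuousOn_const) (fun x hx => ?_)
    (fun x hx r hr => ?_) ⟨ht, le_rfl⟩
  · simp only [sub_self] at key
    linarith
  · have hs : t - x ∈ Ioc 0 t := ⟨by linarith [hx.2], by linarith [hx.1]⟩
    have h1 := ((hB' _ hs).comp_const_sub t x).neg.add_const (B t - f t)
    rw [neg_neg] at h1
    exact h1.hasDerivWithinAt
  · have hs : t - x ∈ Ioc 0 t := ⟨by linarith [hx.2], by linarith [hx.1]⟩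
    have h1 : Tendsto (fun z => t - z) (𝓝[>] x) (𝓝[<] (t - x)) := by
      refine tendsto_nhdsWithin_iff.2 ⟨?_, ?_⟩
      · exact ((continuous_const.sub continuous_id).tendsto x).mono_left nhdsWithin_le_nhds
      · filter_upwards [self_mem_nhdsWithin] with z (hz : x < z)
        exact sub_lt_sub_left hz t
    refine ((h1.eventually (h _ hs r hr)).mono fun z hz => ?_).frequently
    rw [slope_def_field]
    convert hz using 1
    congr 1 <;> ring

end Energy

section Energy

variable {N : ℕ} {H : Space N → ℝ} {Ω : Set (Space N)} {K ψ : Space N → ℝ}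

theorem integrable_abs_mul (hΩ : Bornology.IsBounded Ω) (hΩm : MeasurableSet Ω) (w : L2 Ω)
    {g : Space N → ℝ} (hg : Continuous g) :
    Integrable (fun y => |w y| * g y) (volume.restrict Ω) := by
  have : IsFiniteMeasure (volume.restrict Ω) := ⟨by simpa using hΩ.measure_lt_top⟩
  obtain ⟨M, hM⟩ := exists_bound_of_continuous hΩ hg
  exact ((Lp.memLp w).integrable one_le_two).abs.mul_bdd (c := M) hg.aestronglyMeasurable
    ((ae_restrict_iff' hΩm).2 (ae_of_all _ hM))

theorem IsFinslerNorm.volume_real_dualBall (hH : IsFinslerNorm H) {r : ℝ} (hr : 0 < r) :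
    volume.real (dualBall H 0 r) = r ^ N * volume.real (dualBall H 0 1) := by
  rw [Measure.real, hH.volume_dualBall 0 hr, ENNReal.toReal_mul,
    ENNReal.toReal_ofReal (by positivity), Measure.real]

theorem IsFinslerNorm.volume_real_dualBall_pos (hH : IsFinslerNorm H) :
    0 < volume.real (dualBall H 0 1) :=
  ENNReal.toReal_pos (hH.volume_dualBall_pos 0 one_pos).ne' (hH.volume_dualBall_lt_top 0 1).ne

theorem abs_mul_regPow_rpow_le {δ q a b : ℝ} (hδ : 0 < δ) (hq : 0 < q) (hq2 : q ≤ 2) :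
    |a * regPow δ (q / 2 - 1) a * Real.exp b| ^ (2 / q) ≤ |a| * Real.exp (2 / q * b) := by
  rcases eq_or_ne a 0 with rfl | ha
  · rw [zero_mul, zero_mul, abs_zero, zero_mul, Real.zero_rpow (by positivity)]
  have ha' : 0 < |a| := abs_pos.2 ha
  have h1 : regPow δ (q / 2 - 1) a ≤ |a| ^ (q / 2 - 1) := by
    rw [regPow_eq_rpow hδ]
    exact Real.rpow_le_rpow_of_nonpos ha' (le_regPow_one a) (by linarith)
  have h2 : |a * regPow δ (q / 2 - 1) a * Real.exp b| ≤ |a| ^ (q / 2) * Real.exp b := by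
    rw [abs_mul, abs_mul, abs_of_pos (regPow_pos hδ _ _), Real.abs_exp]
    refine mul_le_mul_of_nonneg_right ?_ (Real.exp_pos b).le
    calc |a| * regPow δ (q / 2 - 1) a ≤ |a| * |a| ^ (q / 2 - 1) := by gcongr
      _ = |a| ^ (q / 2) := by
        rw [Real.rpow_sub_one ha'.ne']; field_simp
  refine (Real.rpow_le_rpow (abs_nonneg _) h2 (by positivity)).trans (le_of_eq ?_)
  rw [Real.mul_rpow (by positivity) (Real.exp_pos b).le, ← Real.rpow_mul ha'.le, ← Real.exp_mul]
  rw [show q / 2 * (2 / q) = 1 by field_simp, Real.rpow_one, mul_comm b]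

/-- The Nash inequality for `f = w (w² + δ²)^{(q/2 - 1)/2} e^{-(q h + ψ)/2}`, `q = 1 + m`, at the
scale `r² = m s / 32`. Since `N m = 1/2`, the volume factor is of the order `s^{-1/4}`; the power of
the total mass `M` is compensated by the coefficient `(M / |B|)^{-m}`, so that the bound is linear
in `M`. -/
theorem IsFinslerNorm.nash_weighted (hH : IsFinslerNorm H) (hΩ : Bornology.IsBounded Ω)
    (hΩm : MeasurableSet Ω) (hK : ContDiff ℝ ∞ K) (hψ : ContDiff ℝ ∞ ψ) {ℓ m s δ M C₀ : ℝ}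
    (hm : 0 < m) (hm2 : m ≤ 1 / 2) (hmN : N * m = 1 / 2) (hs : 0 < s) (hδ : 0 < δ) (hM : 0 < M)
    (hC₀ : 0 ≤ C₀) {p : L2 Ω × L2Vec Ω} (hp : p ∈ sobolevH10 Ω)
    (hmass : ∫ y in Ω, |p.1 y| * Real.exp (-(K y ^ 2 * (1 + s ^ ℓ) + ψ y / (1 + m))) ≤ C₀ * M) :
    Integrable (fun y => (p.1 y * regPow δ ((1 + m) / 2 - 1) (p.1 y) *
          expWeight ℓ 1 0 0 ((1 + m) / 2) K (fun y => ψ y / 2) s y) ^ 2 -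
        2 * (m / 32 * s) *
          H ((derivMulRegPow δ ((1 + m) / 2 - 1) (p.1 y) *
              expWeight ℓ 1 0 0 ((1 + m) / 2) K (fun y => ψ y / 2) s y) • p.2 y +
            (p.1 y * regPow δ ((1 + m) / 2 - 1) (p.1 y)) •
              gradient (expWeight ℓ 1 0 0 ((1 + m) / 2) K (fun y => ψ y / 2) s) y) ^ 2)
      (volume.restrict Ω) ∧
    2 * ((M / volume.real (dualBall H 0 1)) ^ (-m) * s ^ (-(1 / 2 : ℝ))) *
      ∫ y in Ω, ((p.1 y * regPow δ ((1 + m) / 2 - 1) (p.1 y) *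
          expWeight ℓ 1 0 0 ((1 + m) / 2) K (fun y => ψ y / 2) s y) ^ 2 -
        2 * (m / 32 * s) *
          H ((derivMulRegPow δ ((1 + m) / 2 - 1) (p.1 y) *
              expWeight ℓ 1 0 0 ((1 + m) / 2) K (fun y => ψ y / 2) s y) • p.2 y +
            (p.1 y * regPow δ ((1 + m) / 2 - 1) (p.1 y)) •
              gradient (expWeight ℓ 1 0 0 ((1 + m) / 2) K (fun y => ψ y / 2) s) y) ^ 2) ≤
      4 * C₀ ^ (1 + m) * (m / 32) ^ (-(1 / 4 : ℝ)) * M * s ^ (-(3 / 4 : ℝ)) := by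
  have hfin : IsFiniteMeasure (volume.restrict Ω) := ⟨by simpa using hΩ.measure_lt_top⟩
  set η := expWeight ℓ 1 0 0 ((1 + m) / 2) K (fun y => ψ y / 2) s with hη_def
  have hψ2 : ContDiff ℝ ∞ fun y => ψ y / 2 := by fun_prop
  have hη : ContDiff ℝ ∞ η := contDiff_expWeight hK hψ2 s
  obtain ⟨M', h1, h2⟩ := exists_bounds_weight hΩ hΩm hη
  obtain ⟨P, hP, hP1, hP2⟩ := exists_mem_sobolevH10_comp
    (F := fun a => a * regPow δ ((1 + m) / 2 - 1) a)
    (F' := derivMulRegPow δ ((1 + m) / 2 - 1)) (L := δ ^ ((1 + m) / 2 - 1))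
    (contDiff_mul_regPow hδ _) (by simp) (hasDerivAt_mul_regPow hδ _)
    (abs_derivMulRegPow_le hδ (by linarith) (by linarith)) hη h1 h2 hp
  have i1 : Integrable (fun y => P.1 y ^ 2) (volume.restrict Ω) := (Lp.memLp P.1).integrable_sq
  have i2 : Integrable (fun y => H (P.2 y) ^ 2) (volume.restrict Ω) := by
    obtain ⟨C, hC⟩ := hH.exists_lipschitzWith
    exact (hC.comp_memLp hH.map_zero (Lp.memLp P.2)).integrable_sq
  have hcongr : (fun y => P.1 y ^ 2 - 2 * (m / 32 * s) * H (P.2 y) ^ 2)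
      =ᵐ[volume.restrict Ω] fun y => (p.1 y * regPow δ ((1 + m) / 2 - 1) (p.1 y) * η y) ^ 2 -
        2 * (m / 32 * s) * H ((derivMulRegPow δ ((1 + m) / 2 - 1) (p.1 y) * η y) • p.2 y +
            (p.1 y * regPow δ ((1 + m) / 2 - 1) (p.1 y)) • gradient η y) ^ 2 := by
    filter_upwards [hP1, hP2] with y e1 e2
    rw [e1, e2]
  refine ⟨(i1.sub (i2.const_mul _)).congr hcongr, ?_⟩
  rw [← integral_congr_ae hcongr, integral_sub i1 (i2.const_mul _), integral_const_mul]
  set b := volume.real (dualBall H 0 1)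
  have hb : 0 < b := hH.volume_real_dualBall_pos
  have hr2 : 0 < m / 32 * s := by positivity
  have hr : 0 < (m / 32 * s) ^ (1 / 2 : ℝ) := Real.rpow_pos_of_pos hr2 _
  have hrsq : ((m / 32 * s) ^ (1 / 2 : ℝ)) ^ 2 = m / 32 * s := by
    rw [← Real.rpow_natCast, ← Real.rpow_mul hr2.le]; norm_num
  have hn := hH.nash hΩ.measure_lt_top.ne hP hr (q := 1 + m) (by linarith) (by linarith)
  rw [hrsq, hH.volume_real_dualBall hr] at hn
  -- the `L^1` mass
  have hmass' : ∫ y in Ω, |P.1 y| ^ (2 / (1 + m)) ≤ C₀ * M := by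
    refine le_trans (integral_mono_of_nonneg (ae_of_all _ fun y => by positivity)
      (integrable_abs_mul hΩ hΩm p.1 (g := fun y =>
        Real.exp (-(K y ^ 2 * (1 + s ^ ℓ) + ψ y / (1 + m)))) ?_) ?_) hmass
    · have := hK.continuous
      have := hψ.continuous
      fun_prop
    · filter_upwards [hP1] with y e1
      simp only [e1, hη_def, expWeight, Real.rpow_zero, zero_mul, add_zero, one_mul]
      refine (abs_mul_regPow_rpow_le hδ (by linarith) (by linarith)).trans (le_of_eq ?_)
      congr 2
      field_simp
  have hI0 : 0 ≤ ∫ y in Ω, |P.1 y| ^ (2 / (1 + m)) := integral_nonneg fun y => by positivity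
  have hpow : (∫ y in Ω, |P.1 y| ^ (2 / (1 + m))) ^ (1 + m) ≤ C₀ ^ (1 + m) * M ^ (1 + m) := by
    rw [← Real.mul_rpow hC₀ hM.le]
    exact Real.rpow_le_rpow hI0 hmass' (by linarith)
  have hvol : (((m / 32 * s) ^ (1 / 2 : ℝ)) ^ N * b) ^ (-(1 + m - 1)) =
      (m / 32) ^ (-(1 / 4 : ℝ)) * s ^ (-(1 / 4 : ℝ)) * b ^ (-m) := by
    rw [Real.mul_rpow (by positivity) hb.le, ← Real.rpow_natCast, ← Real.rpow_mul hr2.le,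
      ← Real.rpow_mul hr2.le, ← Real.mul_rpow (by positivity) hs.le]
    congr 2
    · linear_combination (-(1 / 2) : ℝ) * hmN
    · ring
  rw [hvol] at hn
  have hs1 : 0 < s ^ (-(1 / 2 : ℝ)) := Real.rpow_pos_of_pos hs _
  have hs2 : 0 < s ^ (-(1 / 4 : ℝ)) := Real.rpow_pos_of_pos hs _
  have hs3 : s ^ (-(3 / 4 : ℝ)) = s ^ (-(1 / 2 : ℝ)) * s ^ (-(1 / 4 : ℝ)) := by
    rw [← Real.rpow_add hs]; norm_num
  have hb' : 0 < b ^ (-m) := Real.rpow_pos_of_pos hb _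
  have hmM : (M / b) ^ (-m) * b ^ (-m) * M ^ (1 + m) = M := by
    rw [← Real.mul_rpow (by positivity) hb.le, div_mul_cancel₀ _ hb.ne', ← Real.rpow_add hM]
    simp
  have hΛ : 0 < (M / b) ^ (-m) := Real.rpow_pos_of_pos (by positivity) _
  calc 2 * ((M / b) ^ (-m) * s ^ (-(1 / 2 : ℝ))) * ((∫ y in Ω, P.1 y ^ 2) -
        2 * (m / 32 * s) * ∫ y in Ω, H (P.2 y) ^ 2)
      ≤ 2 * ((M / b) ^ (-m) * s ^ (-(1 / 2 : ℝ))) *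
        (2 * ((m / 32) ^ (-(1 / 4 : ℝ)) * s ^ (-(1 / 4 : ℝ)) * b ^ (-m)) *
          (C₀ ^ (1 + m) * M ^ (1 + m))) := by
        refine mul_le_mul_of_nonneg_left ?_ (by positivity)
        have := mul_le_mul_of_nonneg_left hpow (show 0 ≤ 2 * ((m / 32) ^ (-(1 / 4 : ℝ)) *
          s ^ (-(1 / 4 : ℝ)) * b ^ (-m)) by positivity)
        linarith
    _ = 4 * C₀ ^ (1 + m) * (m / 32) ^ (-(1 / 4 : ℝ)) *
        ((M / b) ^ (-m) * b ^ (-m) * M ^ (1 + m)) *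
          (s ^ (-(1 / 2 : ℝ)) * s ^ (-(1 / 4 : ℝ))) := by ring
    _ = _ := by rw [hmM, hs3]

end Energy

section Energy

variable {N : ℕ} {H : Space N → ℝ} {Ω : Set (Space N)} {u : ℝ → L2 Ω} {G : ℝ → L2Vec Ω}
  {K ψ : Space N → ℝ}

/-- The rate at which the energy may grow, relative to the total mass. It is integrable at `0`. -/
noncomputable def growthRate (ℓ m C₀ C₁ s : ℝ) : ℝ :=
  4 * C₀ ^ (1 + m) * (m / 32) ^ (-(1 / 4 : ℝ)) * s ^ (-(3 / 4 : ℝ)) +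
    2 / m * (1 + C₁) * s ^ (-(1 / 2 : ℝ)) +
    youngConst ℓ m * C₁ * s ^ ((1 / 2 - ℓ) / m - 1)

/-- The primitive of `growthRate` that vanishes at `0`. -/
noncomputable def growth (ℓ m C₀ C₁ s : ℝ) : ℝ :=
  4 * C₀ ^ (1 + m) * (m / 32) ^ (-(1 / 4 : ℝ)) * (4 * s ^ (1 / 4 : ℝ)) +
    2 / m * (1 + C₁) * (2 * s ^ (1 / 2 : ℝ)) +
    youngConst ℓ m * C₁ * (s ^ ((1 / 2 - ℓ) / m) / ((1 / 2 - ℓ) / m))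

theorem growth_zero {ℓ m : ℝ} (hℓ : ℓ < 1 / 2) (hm : 0 < m) (C₀ C₁ : ℝ) :
    growth ℓ m C₀ C₁ 0 = 0 := by
  have : (1 / 2 - ℓ) / m ≠ 0 := (div_pos (by linarith) hm).ne'
  rw [growth, Real.zero_rpow this, Real.zero_rpow (by norm_num), Real.zero_rpow (by norm_num)]
  ring

theorem continuous_growth {ℓ m : ℝ} (hℓ : ℓ < 1 / 2) (hm : 0 < m) (C₀ C₁ : ℝ) :
    Continuous (growth ℓ m C₀ C₁) := by
  have h1 : Continuous fun s : ℝ => s ^ ((1 / 2 - ℓ) / m) :=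
    Real.continuous_rpow_const (div_pos (by linarith) hm).le
  have h2 : Continuous fun s : ℝ => s ^ (1 / 4 : ℝ) := Real.continuous_rpow_const (by norm_num)
  have h3 : Continuous fun s : ℝ => s ^ (1 / 2 : ℝ) := Real.continuous_rpow_const (by norm_num)
  unfold growth
  fun_prop

theorem hasDerivAt_growth {ℓ m s : ℝ} (hℓ : ℓ < 1 / 2) (hm : 0 < m) (C₀ C₁ : ℝ) (hs : 0 < s) :
    HasDerivAt (growth ℓ m C₀ C₁) (growthRate ℓ m C₀ C₁ s) s := by
  have hγ : 0 < (1 / 2 - ℓ) / m := div_pos (by linarith) hm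
  have h : ∀ p : ℝ, HasDerivAt (fun t : ℝ => t ^ p) (p * s ^ (p - 1)) s := fun p =>
    Real.hasDerivAt_rpow_const (Or.inl hs.ne')
  refine (((((h _).const_mul 4).const_mul _).add (((h _).const_mul 2).const_mul _)).add
    (((h _).div_const _).const_mul _)).congr_deriv ?_
  rw [growthRate, mul_div_cancel_left₀ _ hγ.ne', show (1 / 4 : ℝ) - 1 = -(3 / 4) by norm_num,
    show (1 / 2 : ℝ) - 1 = -(1 / 2) by norm_num]
  ring

/-- The errors made in regularizing `|u|` by `(u² + δ²)^{1/2}`. -/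
noncomputable def regError (m μ V δ : ℝ) : ℝ :=
  2 * μ ^ (-m) * δ ^ (1 + m) * V + 2 / m * (δ * V)

theorem tendsto_regError {m : ℝ} (hm : 0 < m) (μ V : ℝ) :
    Tendsto (regError m μ V) (𝓝[>] 0) (𝓝 0) := by
  have h1 : Continuous fun s : ℝ => s ^ (1 + m) := Real.continuous_rpow_const (by linarith)
  have h2 : Continuous (regError m μ V) := by unfold regError; fun_prop
  have h3 : regError m μ V 0 = 0 := by
    simp [regError, Real.zero_rpow (by linarith : (1 : ℝ) + m ≠ 0)]
  exact (h3 ▸ h2.tendsto 0).mono_left nhdsWithin_le_nhds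

theorem integral_regPow_mul_le (hΩ : Bornology.IsBounded Ω) (hΩm : MeasurableSet Ω) (w : L2 Ω)
    {g : Space N → ℝ} (hg : Continuous g) (hg0 : ∀ y, 0 ≤ g y) (hg1 : ∀ y, g y ≤ 1) {δ : ℝ}
    (hδ : 0 < δ) :
    Integrable (fun y => regPow δ 1 (w y) * g y) (volume.restrict Ω) ∧
      ∫ y in Ω, regPow δ 1 (w y) * g y ≤ (∫ y in Ω, |w y| * g y) + δ * volume.real Ω := by
  have hfin : IsFiniteMeasure (volume.restrict Ω) := ⟨by simpa using hΩ.measure_lt_top⟩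
  have h1 := integrable_abs_mul hΩ hΩm w hg
  have hle : ∀ y, regPow δ 1 (w y) * g y ≤ |w y| * g y + δ := fun y => by
    have h2 := mul_le_mul_of_nonneg_right (regPow_one_le hδ (w y)) (hg0 y)
    have h3 := mul_le_mul_of_nonneg_left (hg1 y) hδ.le
    linarith
  have hi : Integrable (fun y => regPow δ 1 (w y) * g y) (volume.restrict Ω) := by
    refine (h1.add (integrable_const δ)).mono' (((continuous_regPow hδ 1).comp_aestronglyMeasurable
      (Lp.aestronglyMeasurable w)).mul hg.aestronglyMeasurable) (ae_of_all _ fun y => ?_)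
    rw [Real.norm_of_nonneg (mul_nonneg (regPow_pos hδ _ _).le (hg0 y))]
    exact hle y
  refine ⟨hi, (integral_mono hi (h1.add (integrable_const δ)) hle).trans (le_of_eq ?_)⟩
  simp only [Pi.add_apply]
  rw [integral_add h1 (integrable_const δ), integral_const, smul_eq_mul, mul_comm,
    measureReal_restrict_apply_univ]

theorem integral_linear_combination [IsFiniteMeasure (volume.restrict Ω)] {f g k : Space N → ℝ}
    (hf : Integrable f (volume.restrict Ω)) (hg : Integrable g (volume.restrict Ω))
    (hk : Integrable k (volume.restrict Ω)) (a b c d : ℝ) :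
    Integrable (fun y => a * f y + b + c * (g y + k y) + d * k y) (volume.restrict Ω) ∧
      ∫ y in Ω, (a * f y + b + c * (g y + k y) + d * k y) =
        a * (∫ y in Ω, f y) + b * volume.real Ω + c * ((∫ y in Ω, g y) + ∫ y in Ω, k y) +
          d * ∫ y in Ω, k y := by
  have i1 : Integrable (fun y => a * f y) (volume.restrict Ω) := hf.const_mul a
  have i2 : Integrable (fun y => a * f y + b) (volume.restrict Ω) := i1.add (integrable_const b)
  have i3 : Integrable (fun y => c * (g y + k y)) (volume.restrict Ω) := (hg.add hk).const_mul c
  have i4 : Integrable (fun y => a * f y + b + c * (g y + k y)) (volume.restrict Ω) := i2.add i3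
  have i5 : Integrable (fun y => d * k y) (volume.restrict Ω) := hk.const_mul d
  refine ⟨i4.add i5, ?_⟩
  rw [integral_add i4 i5, integral_add i2 i3, integral_add i1 (integrable_const b),
    integral_const_mul, integral_const_mul, integral_add hg hk, integral_const_mul, integral_const,
    smul_eq_mul, measureReal_restrict_apply_univ]
  ring

/-- The differential inequality for the sum of the weighted `L¹` mass and the weighted
`L^q` energy. -/
theorem IsFinslerNorm.integral_slopeIntegrand_add_le (hH : IsFinslerNorm H)
    (hΩ : Bornology.IsBounded Ω) (hΩm : MeasurableSet Ω) (hK : ContDiff ℝ ∞ K)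
    (hψ : ContDiff ℝ ∞ ψ) (hK0 : ∀ y, 0 ≤ K y) (hψ0 : ∀ y, 0 ≤ ψ y)
    (hK1 : ∀ y, H (gradient K y) ≤ 1) (hψ1 : ∀ y, H (gradient ψ y) ≤ 1) {ℓ m s δ M C₀ C₁ : ℝ}
    (hℓ : 0 < ℓ) (hℓ1 : ℓ < 1 / 2) (hm : 0 < m) (hm2 : m ≤ 1 / 2) (hmN : N * m = 1 / 2)
    (hs : 0 < s) (hs1 : s ≤ 1) (hsm : s ≤ m / 2) (hsσ : 324 * s ≤ ℓ * m * s ^ ℓ) (hδ : 0 < δ)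
    (hM : 0 < M) (hC₀ : 0 ≤ C₀) {p : L2 Ω × L2Vec Ω} (hp : p ∈ sobolevH10 Ω)
    (hM1 : ∫ y in Ω, |p.1 y| * Real.exp (-(K y ^ 2 * (1 + s ^ ℓ) + ψ y)) ≤ M)
    (hmass : ∫ y in Ω, |p.1 y| * Real.exp (-(K y ^ 2 * (1 + s ^ ℓ) + ψ y / (1 + m))) ≤ C₀ * M)
    (hexp : ∫ y in Ω, Real.exp (-ψ y) ≤ C₁ * volume.real (dualBall H 0 1)) :
    (∫ y in Ω, slopeIntegrand H δ 1 (expWeight ℓ 1 0 0 1 K ψ s)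
        (expWeightDeriv ℓ 1 0 0 1 K ψ s) p.1 p.2 y) +
      ∫ y in Ω, slopeIntegrand H δ (1 + m)
        (expWeight ℓ ((M / volume.real (dualBall H 0 1)) ^ (-m)) (1 / 2) (ℓ / 8) (1 + m) K ψ s)
        (expWeightDeriv ℓ ((M / volume.real (dualBall H 0 1)) ^ (-m)) (1 / 2) (ℓ / 8) (1 + m) K ψ s)
        p.1 p.2 y ≤
    M * growthRate ℓ m C₀ C₁ s +
      regError m (M / volume.real (dualBall H 0 1)) (volume.real Ω) δ * s ^ (-(1 / 2 : ℝ)) := by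
  have hfin : IsFiniteMeasure (volume.restrict Ω) := ⟨by simpa using hΩ.measure_lt_top⟩
  set b := volume.real (dualBall H 0 1)
  have hb : 0 < b := hH.volume_real_dualBall_pos
  have hμ : 0 < M / b := by positivity
  obtain ⟨n1, n2⟩ := hH.nash_weighted hΩ hΩm hK hψ hm hm2 hmN hs hδ hM hC₀ hp hmass
  have hη : ∀ c β κ q, ContDiff ℝ ∞ (expWeight ℓ c β κ q K ψ s) := fun c β κ q =>
    contDiff_expWeight hK hψ s
  have hη' : ∀ c β κ q, Continuous (expWeightDeriv ℓ c β κ q K ψ s) := fun c β κ q =>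
    continuous_expWeightDeriv hK.continuous hψ.continuous
  have j1 := hH.integrable_slopeIntegrand hΩ hΩm hδ le_rfl one_le_two (hη 1 0 0 1) (hη' 1 0 0 1) hp
  have j2 := hH.integrable_slopeIntegrand hΩ hΩm hδ (q := 1 + m) (by linarith) (by linarith)
    (hη ((M / b) ^ (-m)) (1 / 2) (ℓ / 8) (1 + m)) (hη' ((M / b) ^ (-m)) (1 / 2) (ℓ / 8) (1 + m)) hp
  have hη1 : ∀ y, expWeight ℓ 1 0 0 1 K ψ s y = Real.exp (-(K y ^ 2 * (1 + s ^ ℓ) + ψ y)) :=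
    fun y => by simp [expWeight]
  have hσ : 0 ≤ s ^ ℓ := Real.rpow_nonneg hs.le ℓ
  obtain ⟨k1, k2⟩ := integral_regPow_mul_le hΩ hΩm p.1 (hη 1 0 0 1).continuous
    (fun y => expWeight_nonneg zero_le_one le_rfl hs.le y) (fun y => by
      rw [hη1, Real.exp_le_one_iff]
      have := hψ0 y
      have : 0 ≤ K y ^ 2 * (1 + s ^ ℓ) := by positivity
      linarith) hδ
  have k3 : Integrable (fun y => M / b * Real.exp (-ψ y)) (volume.restrict Ω) := by
    have hcont : Continuous fun y => Real.exp (-ψ y) := by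
      have := hψ.continuous
      fun_prop
    obtain ⟨C, hC⟩ := exists_bound_of_continuous hΩ hcont
    exact (Integrable.of_bound hcont.aestronglyMeasurable C
      ((ae_restrict_iff' hΩm).2 (ae_of_all _ hC))).const_mul _
  simp only [hη1] at k1 k2
  rw [← integral_add j1 j2]
  have hle := fun y => hH.integrand_add_le hK hψ hK0 hψ0 hK1 hψ1 hℓ (by linarith) hm hm2 hμ hs hs1
    hsm hsσ hδ y (p.1 y) (p.2 y)
  simp only [hη1] at hle
  obtain ⟨r1, r2⟩ := integral_linear_combination n1 k1 k3
    (2 * ((M / b) ^ (-m) * s ^ (-(1 / 2 : ℝ))))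
    (2 * ((M / b) ^ (-m) * s ^ (-(1 / 2 : ℝ))) * δ ^ (1 + m)) (2 / m * s ^ (-(1 / 2 : ℝ)))
    (youngConst ℓ m * s ^ ((1 / 2 - ℓ) / m - 1))
  refine (integral_mono (j1.add j2) r1 fun y => ?_).trans ?_
  · simp only [slopeIntegrand, hη1, Pi.add_apply]
    exact hle y
  rw [r2, integral_const_mul]
  have hh : 0 < s ^ (-(1 / 2 : ℝ)) := Real.rpow_pos_of_pos hs _
  have hg : 0 < s ^ ((1 / 2 - ℓ) / m - 1) := Real.rpow_pos_of_pos hs _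
  have hY := youngConst_pos hℓ hm
  have e1 : M / b * ∫ y in Ω, Real.exp (-ψ y) ≤ C₁ * M := by
    refine (mul_le_mul_of_nonneg_left hexp hμ.le).trans (le_of_eq ?_)
    field_simp
  have e2 := mul_le_mul_of_nonneg_left (add_le_add (k2.trans (add_le_add_left hM1 _)) e1)
    (show 0 ≤ 2 / m * s ^ (-(1 / 2 : ℝ)) by positivity)
  have e3 := mul_le_mul_of_nonneg_left e1
    (show 0 ≤ youngConst ℓ m * s ^ ((1 / 2 - ℓ) / m - 1) by positivity)
  unfold growthRate regError
  linarith

end Energy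

section Energy

variable {N : ℕ} {H : Space N → ℝ} {Ω : Set (Space N)} {u : ℝ → L2 Ω} {G : ℝ → L2Vec Ω}
  {K ψ : Space N → ℝ}

/-- If all weighted masses on `(0, t]` are bounded by `M`, then a single one grows by at most
`M * growth t`. -/
theorem IsFinslerNorm.mass_le_add_growth (hH : IsFinslerNorm H) (hΩ : Bornology.IsBounded Ω)
    (hΩm : MeasurableSet Ω) (hu : ContinuousOn u (Ici 0)) (hG : ContinuousOn G (Ici 0))
    (hmem : ∀ t, 0 ≤ t → (u t, G t) ∈ sobolevH10 Ω)
    (hweak : ∀ p ∈ sobolevH10 Ω, ∀ a b : ℝ, 0 < a → 0 < b →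
        inner ℝ p.1 (u b - u a) = -∫ t in a..b, inner ℝ p.2 (hH.fluxL2 (G t)))
    (hK : ContDiff ℝ ∞ K) (hψ : ContDiff ℝ ∞ ψ) (hK0 : ∀ y, 0 ≤ K y) (hψ0 : ∀ y, 0 ≤ ψ y)
    (hK1 : ∀ y, H (gradient K y) ≤ 1) (hψ1 : ∀ y, H (gradient ψ y) ≤ 1) {ℓ m t M C₀ C₁ : ℝ}
    (hℓ : 0 < ℓ) (hℓ1 : ℓ < 1 / 2) (hm : 0 < m) (hm2 : m ≤ 1 / 2) (hmN : N * m = 1 / 2)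
    (ht : 0 ≤ t) (ht1 : t ≤ 1) (htm : t ≤ m / 2)
    (htσ : ∀ s ∈ Ioc 0 t, 324 * s ≤ ℓ * m * s ^ ℓ) (hM : 0 < M) (hC₀ : 0 ≤ C₀)
    (hM1 : ∀ s ∈ Ioc 0 t, ∫ y in Ω, |u s y| * Real.exp (-(K y ^ 2 * (1 + s ^ ℓ) + ψ y)) ≤ M)
    (hmass : ∀ s ∈ Ioc 0 t,
      ∫ y in Ω, |u s y| * Real.exp (-(K y ^ 2 * (1 + s ^ ℓ) + ψ y / (1 + m))) ≤ C₀ * M)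
    (hexp : ∫ y in Ω, Real.exp (-ψ y) ≤ C₁ * volume.real (dualBall H 0 1)) :
    ∫ y in Ω, |u t y| * Real.exp (-(K y ^ 2 * (1 + t ^ ℓ) + ψ y)) ≤
      (∫ y in Ω, |u 0 y| * Real.exp (-(K y ^ 2 + ψ y))) + M * growth ℓ m C₀ C₁ t := by
  have hη1 : ∀ s y, expWeight ℓ 1 0 0 1 K ψ s y = Real.exp (-(K y ^ 2 * (1 + s ^ ℓ) + ψ y)) :=
    fun s y => by simp [expWeight]
  set c := (M / volume.real (dualBall H 0 1)) ^ (-m) with hc_def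
  have hc : 0 < c := Real.rpow_pos_of_pos (div_pos hM hH.volume_real_dualBall_pos) _
  set V := volume.real Ω
  set err := regError m (M / volume.real (dualBall H 0 1)) V
  have hgrowth := continuous_growth hℓ1 hm C₀ C₁
  have hsqrt : Continuous fun s : ℝ => s ^ (1 / 2 : ℝ) :=
    Real.continuous_rpow_const (by norm_num)
  -- the estimate with a regularized modulus
  have key : ∀ δ : ℝ, 0 < δ →
      ∫ y in Ω, |u t y| * Real.exp (-(K y ^ 2 * (1 + t ^ ℓ) + ψ y)) ≤
        (∫ y in Ω, |u 0 y| * Real.exp (-(K y ^ 2 + ψ y))) + δ * V + M * growth ℓ m C₀ C₁ t +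
          err δ * (2 * t ^ (1 / 2 : ℝ)) := by
    intro δ hδ
    set J₁ := weightedMass Ω δ 1 (expWeight ℓ 1 0 0 1 K ψ) u with hJ₁
    set J₂ := weightedMass Ω δ (1 + m) (expWeight ℓ c (1 / 2) (ℓ / 8) (1 + m) K ψ) u with hJ₂
    have hJ : ContinuousOn (fun s => J₁ s + J₂ s) (Icc 0 t) :=
      ((continuousOn_weightedMass_expWeight hΩ hΩm hδ le_rfl one_le_two hu hK hψ hℓ.le le_rfl).add
        (continuousOn_weightedMass_expWeight hΩ hΩm hδ (by linarith) (by linarith) hu hK hψ hℓ.le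
          (by norm_num))).mono fun s hs => hs.1
    have hcomp := sub_le_sub_of_left_slope (f := fun s => J₁ s + J₂ s)
      (B := fun s => M * growth ℓ m C₀ C₁ s + err δ * (2 * s ^ (1 / 2 : ℝ)))
      (B' := fun s => M * growthRate ℓ m C₀ C₁ s + err δ * s ^ (-(1 / 2 : ℝ))) ht hJ
      (by fun_prop) (fun s hs => ?_) (fun s hs r hr => ?_)
    · rw [growth_zero hℓ1 hm, Real.zero_rpow (by norm_num)] at hcomp
      have hJ₂0 : J₂ 0 = 0 := by
        simp [hJ₂, weightedMass, expWeight]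
      have hJ₂t : 0 ≤ J₂ t := integral_nonneg fun y => mul_nonneg
        (div_nonneg (regPow_pos hδ _ _).le (by linarith))
        (expWeight_nonneg hc.le (by positivity) ht y)
      have hcont : ∀ s, Continuous fun y => Real.exp (-(K y ^ 2 * (1 + s ^ ℓ) + ψ y)) := fun s => by
        have := hK.continuous
        have := hψ.continuous
        fun_prop
      have hexp1 : ∀ s : ℝ, 0 ≤ s → ∀ y, Real.exp (-(K y ^ 2 * (1 + s ^ ℓ) + ψ y)) ≤ 1 :=
        fun s hs y => by
          rw [Real.exp_le_one_iff]
          have := hψ0 y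
          have := Real.rpow_nonneg hs ℓ
          have : 0 ≤ K y ^ 2 * (1 + s ^ ℓ) := by positivity
          linarith
      have hJ₁' : ∀ s, J₁ s =
          ∫ y in Ω, regPow δ 1 (u s y) * Real.exp (-(K y ^ 2 * (1 + s ^ ℓ) + ψ y)) := fun s => by
        simp only [hJ₁, weightedMass, hη1, div_one]
      have hJ₁t : ∫ y in Ω, |u t y| * Real.exp (-(K y ^ 2 * (1 + t ^ ℓ) + ψ y)) ≤ J₁ t := by
        rw [hJ₁']
        refine integral_mono (integrable_abs_mul hΩ hΩm _ (hcont t))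
          (integral_regPow_mul_le hΩ hΩm _ (hcont t) (fun y => (Real.exp_pos _).le)
            (hexp1 t ht) hδ).1 fun y => ?_
        exact mul_le_mul_of_nonneg_right (le_regPow_one _) (Real.exp_pos _).le
      have hJ₁0 := (integral_regPow_mul_le hΩ hΩm (u 0) (hcont 0) (fun y => (Real.exp_pos _).le)
        (hexp1 0 le_rfl) hδ).2
      rw [← hJ₁' 0] at hJ₁0
      simp only [Real.zero_rpow hℓ.ne', add_zero, mul_one] at hJ₁0
      linarith
    · refine (((hasDerivAt_growth hℓ1 hm C₀ C₁ hs.1).const_mul M).add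
        (((Real.hasDerivAt_rpow_const (p := 1 / 2) (Or.inl hs.1.ne')).const_mul 2).const_mul
          (err δ))).congr_deriv ?_
      rw [show (1 / 2 : ℝ) - 1 = -(1 / 2) by norm_num]
      ring
    · have hd := hH.integral_slopeIntegrand_add_le hΩ hΩm hK hψ hK0 hψ0 hK1 hψ1 hℓ hℓ1 hm hm2 hmN
        hs.1 (hs.2.trans ht1) (hs.2.trans htm) (htσ s hs) hδ hM hC₀ (hmem s hs.1.le) (hM1 s hs)
        (hmass s hs) hexp
      have hd' := hd.trans_lt hr
      rw [← lt_sub_iff_add_lt] at hd'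
      obtain ⟨r₁, h1, h2⟩ := exists_between hd'
      have e1 := eventually_slope_expWeight_lt hH hΩ hΩm hδ le_rfl one_le_two hu hG hmem hweak
        hK hψ zero_le_one le_rfl hs.1 h1
      have e2 := eventually_slope_expWeight_lt hH hΩ hΩm hδ (q := 1 + m) (by linarith)
        (by linarith) hu hG hmem hweak hK hψ hc.le (by positivity) hs.1 (lt_sub_comm.1 h2)
      filter_upwards [e1, e2] with a h3 h4
      have h5 := add_lt_add h3 h4
      rw [add_sub_cancel, ← add_div] at h5
      have h6 : J₁ s + J₂ s - (J₁ a + J₂ a) = J₁ s - J₁ a + (J₂ s - J₂ a) := by ring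
      change (J₁ s + J₂ s - (J₁ a + J₂ a)) / (s - a) < r
      rwa [h6]
  have hlim : Tendsto (fun δ => (∫ y in Ω, |u 0 y| * Real.exp (-(K y ^ 2 + ψ y))) + δ * V +
      M * growth ℓ m C₀ C₁ t + err δ * (2 * t ^ (1 / 2 : ℝ))) (𝓝[>] 0)
      (𝓝 ((∫ y in Ω, |u 0 y| * Real.exp (-(K y ^ 2 + ψ y))) + 0 * V +
        M * growth ℓ m C₀ C₁ t + 0 * (2 * t ^ (1 / 2 : ℝ)))) := by
    have h1 : Tendsto (fun δ : ℝ => δ) (𝓝[>] 0) (𝓝 0) := nhdsWithin_le_nhds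
    exact ((tendsto_const_nhds.add (h1.mul_const V)).add_const _).add
      ((tendsto_regError hm _ V).mul_const _)
  rw [zero_mul, zero_mul, add_zero, add_zero] at hlim
  exact ge_of_tendsto hlim (by filter_upwards [self_mem_nhdsWithin] with δ hδ using key δ hδ)

end Energy

/-! ### Uniform bounds of the weighted masses -/

section Mass

variable {N : ℕ} {H : Space N → ℝ} {Ω : Set (Space N)} {K : Space N → ℝ}

/-- A fixed-point bound: if every bound `M` can be improved to `S + M / 2`, then `2 S` is
a bound. -/
theorem le_two_mul_of_forall_le_add {ι : Type*} {E : ι → ℝ} {S B : ℝ} (hS : 0 ≤ S)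
    (hB : ∀ i, E i ≤ B) (h : ∀ M, 0 < M → (∀ i, E i ≤ M) → ∀ i, E i ≤ S + M / 2) (i : ι) :
    E i ≤ 2 * S := by
  have : Nonempty ι := ⟨i⟩
  have hbdd : BddAbove (range E) := ⟨B, by rintro _ ⟨j, rfl⟩; exact hB j⟩
  have hle : ∀ j, E j ≤ sSup (range E) := fun j => le_csSup hbdd (mem_range_self j)
  rcases le_or_gt (sSup (range E)) 0 with h0 | h0
  · linarith [hle i]
  · have h1 : sSup (range E) ≤ S + sSup (range E) / 2 :=
      csSup_le (range_nonempty E) (by rintro _ ⟨j, rfl⟩; exact h _ h0 hle j)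
    linarith [hle i]

theorem lintegral_ofReal_eq (hΩ : Bornology.IsBounded Ω) (hΩm : MeasurableSet Ω) (w : L2 Ω)
    {g : Space N → ℝ} (hg : Continuous g) (hg0 : ∀ y, 0 ≤ g y) :
    ENNReal.ofReal (∫ y in Ω, |w y| * g y) = ∫⁻ y in Ω, ENNReal.ofReal (|w y| * g y) :=
  ofReal_integral_eq_lintegral_ofReal (integrable_abs_mul hΩ hΩm w hg)
    (ae_of_all _ fun y => mul_nonneg (abs_nonneg _) (hg0 y))

theorem integral_abs_mul_le (hΩ : Bornology.IsBounded Ω) (hΩm : MeasurableSet Ω) (w : L2 Ω)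
    {g : Space N → ℝ} (hg : Continuous g) (hg1 : ∀ y, g y ≤ 1) :
    ∫ y in Ω, |w y| * g y ≤ volume.real Ω + ‖w‖ ^ 2 := by
  have hfin : IsFiniteMeasure (volume.restrict Ω) := ⟨by simpa using hΩ.measure_lt_top⟩
  have i1 : Integrable (fun y => w y ^ 2) (volume.restrict Ω) := (Lp.memLp w).integrable_sq
  rw [norm_sq_eq_integral_sq]
  calc ∫ y in Ω, |w y| * g y ≤ ∫ y in Ω, (1 + w y ^ 2) := by
        refine integral_mono (integrable_abs_mul hΩ hΩm w hg) ((integrable_const 1).add i1)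
          fun y => ?_
        have h1 : |w y| * g y ≤ |w y| := mul_le_of_le_one_right (abs_nonneg _) (hg1 y)
        have h2 := sq_abs (w y)
        simp only
        nlinarith [sq_nonneg (|w y| - 1), abs_nonneg (w y)]
    _ = _ := by
        rw [integral_add (integrable_const 1) i1, integral_const, smul_eq_mul, mul_one,
          measureReal_restrict_apply_univ]

/-- The constant comparing masses with different cutoffs. -/
noncomputable def massConst (N : ℕ) : ℝ :=
  Real.exp (5 / 2) * (Real.exp (1 / 4) * (4 ^ N * N.factorial))

/-- Masses with the slowly decaying cutoff `e^{-ψ / (1 + m)}` are controlled by those with the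
cutoff `e^{-ψ}`, uniformly in the center, by covering with unit balls. -/
theorem IsFinslerNorm.mass_cutoff_le (hH : IsFinslerNorm H) (hΩ : Bornology.IsBounded Ω)
    (hΩm : MeasurableSet Ω) (hK : ContDiff ℝ ∞ K) (hK0 : ∀ y, 0 ≤ K y)
    (hKH : ∀ y, |K y - dualNorm H y| ≤ 1) {m M : ℝ} (hm : 0 ≤ m) (hm1 : m ≤ 1) (hM : 0 ≤ M)
    (w : L2 Ω) {h : Space N → ℝ} (hh : Continuous h)
    (hle : ∀ x ∈ Ω, ∫ y in Ω, |w y| * Real.exp (-(h y + K (y - x))) ≤ M) (x : Space N) :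
    ∫ y in Ω, |w y| * Real.exp (-(h y + K (y - x) / (1 + m))) ≤ massConst N * M := by
  have hKc := hK.continuous
  have hwm : Measurable fun y => w y := (Lp.stronglyMeasurable w).measurable
  have hf : Measurable fun y => ENNReal.ofReal (|w y| * Real.exp (-h y)) := by
    have := hh.measurable
    fun_prop
  have hball : ∀ x' ∈ Ω, ∫⁻ y in Ω ∩ dualBall H x' 1, ENNReal.ofReal (|w y| * Real.exp (-h y)) ≤
      ENNReal.ofReal (Real.exp 2 * M) := by
    intro x' hx'
    have hc : Continuous fun y => Real.exp (-(h y + K (y - x'))) := by fun_prop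
    calc ∫⁻ y in Ω ∩ dualBall H x' 1, ENNReal.ofReal (|w y| * Real.exp (-h y))
        ≤ ∫⁻ y in Ω ∩ dualBall H x' 1, ENNReal.ofReal (Real.exp 2) *
            ENNReal.ofReal (|w y| * Real.exp (-(h y + K (y - x')))) := by
          refine setLIntegral_mono' (hΩm.inter (hH.measurableSet_dualBall _ _)) fun y hy => ?_
          rw [← ENNReal.ofReal_mul (Real.exp_pos _).le]
          refine ENNReal.ofReal_le_ofReal ?_
          have h1 : K (y - x') ≤ 2 := by
            have h2 : dualNorm H (y - x') < 1 := hy.2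
            linarith [(abs_le.1 (hKH (y - x'))).2]
          have h3 : Real.exp (-h y) ≤ Real.exp 2 * Real.exp (-(h y + K (y - x'))) := by
            rw [← Real.exp_add]
            exact Real.exp_le_exp.2 (by linarith)
          calc |w y| * Real.exp (-h y) ≤
              |w y| * (Real.exp 2 * Real.exp (-(h y + K (y - x')))) := by gcongr
            _ = _ := by ring
      _ ≤ ∫⁻ y in Ω, ENNReal.ofReal (Real.exp 2) *
            ENNReal.ofReal (|w y| * Real.exp (-(h y + K (y - x')))) :=
          lintegral_mono_set inter_subset_left
      _ = ENNReal.ofReal (Real.exp 2 * ∫ y in Ω, |w y| * Real.exp (-(h y + K (y - x')))) := by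
          rw [lintegral_const_mul' _ _ ENNReal.ofReal_ne_top,
            ← lintegral_ofReal_eq hΩ hΩm w hc fun y => (Real.exp_pos _).le,
            ENNReal.ofReal_mul (Real.exp_pos _).le]
      _ ≤ _ := ENNReal.ofReal_le_ofReal
          (mul_le_mul_of_nonneg_left (hle x' hx') (Real.exp_pos _).le)
  have hcov := hH.lintegral_mul_exp_le_of_ball hf hball x
  have hc : Continuous fun y => Real.exp (-(h y + K (y - x) / (1 + m))) := by fun_prop
  have hC : 0 ≤ massConst N := by unfold massConst; positivity
  rw [← ENNReal.ofReal_le_ofReal_iff (mul_nonneg hC hM),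
    lintegral_ofReal_eq hΩ hΩm w hc fun y => (Real.exp_pos _).le]
  calc ∫⁻ y in Ω, ENNReal.ofReal (|w y| * Real.exp (-(h y + K (y - x) / (1 + m))))
      ≤ ∫⁻ y in Ω, ENNReal.ofReal (Real.exp (1 / 2)) *
          (ENNReal.ofReal (|w y| * Real.exp (-h y)) *
            ENNReal.ofReal (Real.exp (-(dualNorm H (y - x) / 2)))) := by
        refine lintegral_mono fun y => ?_
        rw [← ENNReal.ofReal_mul (by positivity), ← ENNReal.ofReal_mul (Real.exp_pos _).le]
        refine ENNReal.ofReal_le_ofReal ?_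
        have h1 : K (y - x) / 2 ≤ K (y - x) / (1 + m) :=
          div_le_div_of_nonneg_left (hK0 _) (by linarith) (by linarith)
        have h2 := (abs_le.1 (hKH (y - x))).1
        have h3 : Real.exp (-(h y + K (y - x) / (1 + m))) ≤
            Real.exp (1 / 2) * (Real.exp (-h y) * Real.exp (-(dualNorm H (y - x) / 2))) := by
          rw [← Real.exp_add, ← Real.exp_add]
          exact Real.exp_le_exp.2 (by linarith)
        calc _ ≤ |w y| *
              (Real.exp (1 / 2) * (Real.exp (-h y) * Real.exp (-(dualNorm H (y - x) / 2)))) := by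
              gcongr
          _ = _ := by ring
    _ ≤ ENNReal.ofReal (Real.exp (1 / 2)) *
          (ENNReal.ofReal (Real.exp (1 / 4) * (4 ^ N * N.factorial)) *
            ENNReal.ofReal (Real.exp 2 * M)) := by
        rw [lintegral_const_mul' _ _ ENNReal.ofReal_ne_top]
        gcongr
    _ = _ := by
        rw [← ENNReal.ofReal_mul (by positivity), ← ENNReal.ofReal_mul (by positivity), massConst,
          show (5 / 2 : ℝ) = 1 / 2 + 2 by norm_num, Real.exp_add]
        congr 1
        ring

theorem IsFinslerNorm.integral_exp_cutoff_le (hH : IsFinslerNorm H) (hΩ : Bornology.IsBounded Ω)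
    (hΩm : MeasurableSet Ω) (hK : ContDiff ℝ ∞ K) (hKH : ∀ y, |K y - dualNorm H y| ≤ 1)
    (x : Space N) :
    ∫ y in Ω, Real.exp (-K (y - x)) ≤
      Real.exp 1 * (2 ^ N * N.factorial) * volume.real (dualBall H 0 1) := by
  have hKc := hK.continuous
  have hc : Continuous fun y => Real.exp (-K (y - x)) := by fun_prop
  have hfin : IsFiniteMeasure (volume.restrict Ω) := ⟨by simpa using hΩ.measure_lt_top⟩
  obtain ⟨C, hC⟩ := exists_bound_of_continuous hΩ hc
  have hi : Integrable (fun y => Real.exp (-K (y - x))) (volume.restrict Ω) :=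
    Integrable.of_bound hc.aestronglyMeasurable C ((ae_restrict_iff' hΩm).2 (ae_of_all _ hC))
  rw [← ENNReal.ofReal_le_ofReal_iff (by positivity),
    ofReal_integral_eq_lintegral_ofReal hi (ae_of_all _ fun y => (Real.exp_pos _).le)]
  calc ∫⁻ y in Ω, ENNReal.ofReal (Real.exp (-K (y - x)))
      ≤ ∫⁻ y, ENNReal.ofReal (Real.exp (-K (y - x))) := setLIntegral_le_lintegral _ _
    _ ≤ ∫⁻ y, ENNReal.ofReal (Real.exp 1) *
          ENNReal.ofReal (Real.exp (-(dualNorm H (y - x) / 2))) := by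
        refine lintegral_mono fun y => ?_
        rw [← ENNReal.ofReal_mul (Real.exp_pos _).le, ← Real.exp_add]
        refine ENNReal.ofReal_le_ofReal (Real.exp_le_exp.2 ?_)
        linarith [(abs_le.1 (hKH (y - x))).1, hH.dualNorm_nonneg (y - x)]
    _ = _ := by
        rw [lintegral_const_mul' _ _ ENNReal.ofReal_ne_top, hH.lintegral_exp_neg_half_dualNorm,
          ← mul_assoc, ← ENNReal.ofReal_mul (Real.exp_pos _).le, Measure.real,
          ENNReal.ofReal_mul (p := Real.exp 1 * (2 ^ N * N.factorial)) (by positivity),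
          ENNReal.ofReal_toReal (hH.volume_dualBall_lt_top 0 1).ne]

theorem gradient_comp_sub {f : Space N → ℝ} (x y : Space N) :
    gradient (fun y => f (y - x)) y = gradient f (y - x) := by
  rw [gradient, gradient, fderiv_comp_sub]

end Mass

/-! ### Doubling of the masses and comparison with unit balls -/

section Final

variable {N : ℕ} {H : Space N → ℝ} {Ω : Set (Space N)} {u : ℝ → L2 Ω} {G : ℝ → L2Vec Ω}
  {K : Space N → ℝ}

/-- The length of the time interval depends only on `ℓ`, `m` and the constants in `growth`. -/
theorem exists_time {ℓ m : ℝ} (hℓ : 0 < ℓ) (hℓ1 : ℓ < 1 / 2) (hm : 0 < m) (C₀ C₁ : ℝ) :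
    ∃ T, 0 < T ∧ T < 1 ∧ T ≤ m / 2 ∧ (∀ s ∈ Ioc 0 T, 324 * s ≤ ℓ * m * s ^ ℓ) ∧
      ∀ s ∈ Icc 0 T, growth ℓ m C₀ C₁ s ≤ 1 / 2 := by
  have h1 : Tendsto (growth ℓ m C₀ C₁) (𝓝 0) (𝓝 0) := by
    have := (continuous_growth hℓ1 hm C₀ C₁).tendsto 0
    rwa [growth_zero hℓ1 hm] at this
  have h2 : Tendsto (fun s : ℝ => 324 * s ^ (1 - ℓ)) (𝓝 0) (𝓝 0) := by
    have := ((Real.continuous_rpow_const (q := 1 - ℓ) (by linarith)).tendsto 0).const_mul 324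
    rwa [Real.zero_rpow (by linarith), mul_zero] at this
  obtain ⟨ε, hε, hε'⟩ := Metric.eventually_nhds_iff.1
    ((h1.eventually (gt_mem_nhds (by norm_num : (0 : ℝ) < 1 / 2))).and
      (h2.eventually (gt_mem_nhds (by positivity : (0 : ℝ) < ℓ * m))))
  refine ⟨min (ε / 2) (min (1 / 2) (m / 2)), by positivity,
    ((min_le_right _ _).trans (min_le_left _ _)).trans_lt (by norm_num),
    (min_le_right _ _).trans (min_le_right _ _), fun s hs => ?_, fun s hs => ?_⟩
  · have h3 := (hε' (y := s) (by
      rw [Real.dist_eq, sub_zero, abs_of_pos hs.1]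
      linarith [hs.2.trans (min_le_left _ _)])).2
    have h4 : 0 < s ^ ℓ := Real.rpow_pos_of_pos hs.1 ℓ
    have h5 : s = s ^ (1 - ℓ) * s ^ ℓ := by
      rw [← Real.rpow_add hs.1, sub_add_cancel, Real.rpow_one]
    have h6 := mul_le_mul_of_nonneg_right h3.le h4.le
    rw [mul_assoc, ← h5] at h6
    exact h6
  · exact (hε' (y := s) (by
      rw [Real.dist_eq, sub_zero, abs_of_nonneg hs.1]
      linarith [hs.2.trans (min_le_left _ _)])).1.le

/-- On the time interval where `growth` is at most `1 / 2`, the weighted masses at most double. -/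
theorem IsFinslerNorm.mass_le_two_mul (hH : IsFinslerNorm H) (hΩ : Bornology.IsBounded Ω)
    (hΩm : MeasurableSet Ω) (hu : ContinuousOn u (Ici 0)) (hG : ContinuousOn G (Ici 0))
    (hmem : ∀ t, 0 ≤ t → (u t, G t) ∈ sobolevH10 Ω)
    (hweak : ∀ p ∈ sobolevH10 Ω, ∀ a b : ℝ, 0 < a → 0 < b →
        inner ℝ p.1 (u b - u a) = -∫ t in a..b, inner ℝ p.2 (hH.fluxL2 (G t)))
    (hK : ContDiff ℝ ∞ K) (hK0 : ∀ y, 0 ≤ K y) (hK1 : ∀ y, H (gradient K y) ≤ 1)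
    (hKH : ∀ y, |K y - dualNorm H y| ≤ 1) {ℓ m T S : ℝ}
    (hℓ : 0 < ℓ) (hℓ1 : ℓ < 1 / 2) (hm : 0 < m) (hm2 : m ≤ 1 / 2) (hmN : N * m = 1 / 2)
    (hT1 : T ≤ 1) (hTm : T ≤ m / 2)
    (hTσ : ∀ s ∈ Ioc 0 T, 324 * s ≤ ℓ * m * s ^ ℓ)
    (hTg : ∀ s ∈ Icc 0 T,
      growth ℓ m (massConst N) (Real.exp 1 * (2 ^ N * N.factorial)) s ≤ 1 / 2)
    (hS : 0 ≤ S) (hS0 : ∀ x ∈ Ω, ∫ y in Ω, |u 0 y| * Real.exp (-(K y ^ 2 + K (y - x))) ≤ S)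
    {x : Space N} (hx : x ∈ Ω) {t : ℝ} (ht : t ∈ Icc 0 T) :
    ∫ y in Ω, |u t y| * Real.exp (-(K y ^ 2 * (1 + t ^ ℓ) + K (y - x))) ≤ 2 * S := by
  have hKc := hK.continuous
  have hC₀ : 0 ≤ massConst N := by unfold massConst; positivity
  obtain ⟨B, hB⟩ := isCompact_Icc.exists_bound_of_continuousOn
    (hu.mono (fun s (hs : s ∈ Icc 0 T) => hs.1))
  refine le_two_mul_of_forall_le_add (ι := Ω × Icc (0 : ℝ) T) (B := volume.real Ω + B ^ 2)
    (E := fun i => ∫ y in Ω, |u i.2 y| *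
      Real.exp (-(K y ^ 2 * (1 + (i.2 : ℝ) ^ ℓ) + K (y - i.1)))) hS ?_ ?_ ⟨⟨x, hx⟩, ⟨t, ht⟩⟩
  · rintro ⟨⟨x, hx⟩, s, hs⟩
    refine (integral_abs_mul_le hΩ hΩm (u s) (by fun_prop) fun y => ?_).trans ?_
    · rw [Real.exp_le_one_iff]
      have := Real.rpow_nonneg hs.1 ℓ
      have := hK0 (y - x)
      have : 0 ≤ K y ^ 2 * (1 + s ^ ℓ) := by positivity
      linarith
    · have := pow_le_pow_left₀ (norm_nonneg _) (hB s hs) 2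
      linarith
  · rintro M hM hE ⟨⟨x, hx⟩, s, hs⟩
    have hE' : ∀ x ∈ Ω, ∀ s ∈ Icc 0 T,
        ∫ y in Ω, |u s y| * Real.exp (-(K y ^ 2 * (1 + s ^ ℓ) + K (y - x))) ≤ M :=
      fun x hx s hs => hE ⟨⟨x, hx⟩, s, hs⟩
    have hψ : ContDiff ℝ ∞ fun y => K (y - x) := by fun_prop
    have hsub : ∀ a ∈ Ioc 0 s, a ∈ Icc 0 T := fun a ha => ⟨ha.1.le, ha.2.trans hs.2⟩
    have h1 := hH.mass_le_add_growth hΩ hΩm hu hG hmem hweak hK hψ hK0 (fun y => hK0 _) hK1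
      (fun y => by rw [gradient_comp_sub]; exact hK1 _) hℓ hℓ1 hm hm2 hmN hs.1 (hs.2.trans hT1)
      (hs.2.trans hTm) (fun a ha => hTσ a ⟨ha.1, ha.2.trans hs.2⟩) hM hC₀
      (fun a ha => hE' x hx a (hsub a ha))
      (fun a ha => hH.mass_cutoff_le hΩ hΩm hK hK0 hKH hm.le (by linarith) hM.le (u a)
        (h := fun y => K y ^ 2 * (1 + a ^ ℓ)) (by fun_prop)
        (fun x' hx' => hE' x' hx' a (hsub a ha)) x)
      (hH.integral_exp_cutoff_le hΩ hΩm hK hKH x)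
    have h2 := mul_le_mul_of_nonneg_left (hTg s hs) hM.le
    have h3 := hS0 x hx
    change ∫ y in Ω, |u s y| * Real.exp (-(K y ^ 2 * (1 + s ^ ℓ) + K (y - x))) ≤ S + M / 2
    linarith

/-- Masses at time `0` with a smooth weight and an exponential cutoff are controlled by the weighted
masses in unit balls. -/
theorem IsFinslerNorm.initial_mass_le (hH : IsFinslerNorm H) (hΩ : Bornology.IsBounded Ω)
    (hΩm : MeasurableSet Ω) (hK : ContDiff ℝ ∞ K) (hKH : ∀ y, |K y - dualNorm H y| ≤ 1)
    (hKsq : ∀ y ∈ Ω, |K y ^ 2 - dualNorm H y ^ 2| ≤ 1) {w : L2 Ω} {φ : Space N → ℝ}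
    (hφ : Continuous φ) (hwφ : ∀ᵐ y ∂(volume.restrict Ω), w y = φ y) {S : ℝ} (hS : 0 ≤ S)
    (hle : ∀ x ∈ Ω, ∫⁻ y in Ω ∩ dualBall H x 1,
      ENNReal.ofReal (Real.exp (-(dualNorm H y ^ 2)) * |φ y|) ≤ ENNReal.ofReal S)
    (x : Space N) :
    ∫ y in Ω, |w y| * Real.exp (-(K y ^ 2 + K (y - x))) ≤
      Real.exp 2 * (Real.exp (1 / 4) * (4 ^ N * N.factorial)) * S := by
  have hKc := hK.continuous
  have hHc := hH.continuous_dualNorm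
  have hc : Continuous fun y => Real.exp (-(K y ^ 2 + K (y - x))) := by fun_prop
  have hf : Measurable fun y => ENNReal.ofReal (Real.exp (-(dualNorm H y ^ 2)) * |φ y|) := by
    have h1 : Continuous fun y => Real.exp (-(dualNorm H y ^ 2)) * |φ y| := by fun_prop
    exact h1.measurable.ennreal_ofReal
  have hcov := hH.lintegral_mul_exp_le_of_ball hf hle x
  rw [← ENNReal.ofReal_le_ofReal_iff (by positivity),
    lintegral_ofReal_eq hΩ hΩm w hc fun y => (Real.exp_pos _).le]
  calc ∫⁻ y in Ω, ENNReal.ofReal (|w y| * Real.exp (-(K y ^ 2 + K (y - x))))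
      ≤ ∫⁻ y in Ω, ENNReal.ofReal (Real.exp 2) *
          (ENNReal.ofReal (Real.exp (-(dualNorm H y ^ 2)) * |φ y|) *
            ENNReal.ofReal (Real.exp (-(dualNorm H (y - x) / 2)))) := by
        refine lintegral_mono_ae ?_
        filter_upwards [hwφ, (ae_restrict_iff' hΩm).2 (ae_of_all _ hKsq)] with y h1 h2
        rw [h1, ← ENNReal.ofReal_mul (by positivity), ← ENNReal.ofReal_mul (Real.exp_pos _).le]
        refine ENNReal.ofReal_le_ofReal ?_
        have h3 := (abs_le.1 (hKH (y - x))).1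
        have h4 := (abs_le.1 h2).1
        have h5 := hH.dualNorm_nonneg (y - x)
        have h6 : Real.exp (-(K y ^ 2 + K (y - x))) ≤ Real.exp 2 *
            (Real.exp (-(dualNorm H y ^ 2)) * Real.exp (-(dualNorm H (y - x) / 2))) := by
          rw [← Real.exp_add, ← Real.exp_add]
          exact Real.exp_le_exp.2 (by linarith)
        calc _ ≤ |φ y| * (Real.exp 2 *
            (Real.exp (-(dualNorm H y ^ 2)) * Real.exp (-(dualNorm H (y - x) / 2)))) := by gcongr
          _ = _ := by ring
    _ ≤ ENNReal.ofReal (Real.exp 2) *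
          (ENNReal.ofReal (Real.exp (1 / 4) * (4 ^ N * N.factorial)) * ENNReal.ofReal S) := by
        rw [lintegral_const_mul' _ _ ENNReal.ofReal_ne_top]
        gcongr
    _ = _ := by
        rw [← ENNReal.ofReal_mul (by positivity), ← ENNReal.ofReal_mul (by positivity)]
        congr 1
        ring

/-- Weighted masses in unit balls are controlled by masses with an exponential cutoff. -/
theorem IsFinslerNorm.ball_mass_le (hH : IsFinslerNorm H) (hΩ : Bornology.IsBounded Ω)
    (hΩm : MeasurableSet Ω) (hK : ContDiff ℝ ∞ K) (hKH : ∀ y, |K y - dualNorm H y| ≤ 1)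
    (hKsq : ∀ y ∈ Ω, |K y ^ 2 - dualNorm H y ^ 2| ≤ 1) (w : L2 Ω) {ℓ t : ℝ} (hℓ : 0 ≤ ℓ)
    (ht : 0 ≤ t) (ht1 : t ≤ 1) (x : Space N) :
    ∫⁻ y in Ω ∩ dualBall H x 1, ENNReal.ofReal (Real.exp (-weight H ℓ y t) * |w y|) ≤
      ENNReal.ofReal (Real.exp 4 *
        ∫ y in Ω, |w y| * Real.exp (-(K y ^ 2 * (1 + t ^ ℓ) + K (y - x)))) := by
  have hKc := hK.continuous
  have hc : Continuous fun y => Real.exp (-(K y ^ 2 * (1 + t ^ ℓ) + K (y - x))) := by fun_prop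
  have hσ := Real.rpow_nonneg ht ℓ
  have hσ1 := Real.rpow_le_one ht ht1 hℓ
  calc ∫⁻ y in Ω ∩ dualBall H x 1, ENNReal.ofReal (Real.exp (-weight H ℓ y t) * |w y|)
      ≤ ∫⁻ y in Ω ∩ dualBall H x 1, ENNReal.ofReal (Real.exp 4) *
          ENNReal.ofReal (|w y| * Real.exp (-(K y ^ 2 * (1 + t ^ ℓ) + K (y - x)))) := by
        refine setLIntegral_mono' (hΩm.inter (hH.measurableSet_dualBall _ _)) fun y hy => ?_
        rw [← ENNReal.ofReal_mul (Real.exp_pos _).le]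
        refine ENNReal.ofReal_le_ofReal ?_
        have h1 : dualNorm H (y - x) < 1 := hy.2
        have h2 := (abs_le.1 (hKH (y - x))).2
        have h3 := (abs_le.1 (hKsq y hy.1)).2
        have h4 : (K y ^ 2 - dualNorm H y ^ 2) * (1 + t ^ ℓ) ≤ 1 * 2 := by
          refine (mul_le_mul_of_nonneg_right h3 (by linarith)).trans ?_
          linarith
        have h6 : Real.exp (-weight H ℓ y t) ≤
            Real.exp 4 * Real.exp (-(K y ^ 2 * (1 + t ^ ℓ) + K (y - x))) := by
          rw [← Real.exp_add, weight]
          exact Real.exp_le_exp.2 (by linarith)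
        calc _ ≤ Real.exp 4 * Real.exp (-(K y ^ 2 * (1 + t ^ ℓ) + K (y - x))) * |w y| := by
              gcongr
          _ = _ := by ring
    _ ≤ ∫⁻ y in Ω, ENNReal.ofReal (Real.exp 4) *
          ENNReal.ofReal (|w y| * Real.exp (-(K y ^ 2 * (1 + t ^ ℓ) + K (y - x)))) :=
        lintegral_mono_set inter_subset_left
    _ = _ := by
        rw [lintegral_const_mul' _ _ ENNReal.ofReal_ne_top,
          ← lintegral_ofReal_eq hΩ hΩm w hc fun y => (Real.exp_pos _).le,
          ENNReal.ofReal_mul (Real.exp_pos _).le]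

/-- A smooth substitute for the dual norm whose square is uniformly close to that of the dual norm
on a ball. -/
theorem IsFinslerNorm.exists_smooth_dualNorm_sq (hH : IsFinslerNorm H) {R : ℝ} (hR : 0 ≤ R) :
    ∃ K : Space N → ℝ, ContDiff ℝ ∞ K ∧ (∀ y, 0 ≤ K y) ∧ (∀ y, H (gradient K y) ≤ 1) ∧
      (∀ y, |K y - dualNorm H y| ≤ 1) ∧
      ∀ y ∈ dualBall H 0 R, |K y ^ 2 - dualNorm H y ^ 2| ≤ 1 := by
  obtain ⟨K, h1, h2, h3, h4⟩ := hH.exists_smooth_dualNorm (ρ := 1 / (2 * R + 1)) (by positivity)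
  have hρ : 1 / (2 * R + 1) ≤ 1 := (div_le_one (by positivity)).2 (by linarith)
  refine ⟨K, h1, h2, h4, fun y => (h3 y).trans hρ, fun y hy => ?_⟩
  have h5 : dualNorm H y < R := by simpa [dualBall] using hy
  have h6 := hH.dualNorm_nonneg y
  have h7 := (abs_le.1 ((h3 y).trans hρ)).2
  have h8 := h2 y
  rw [sq_sub_sq, abs_mul, abs_of_nonneg (by linarith : 0 ≤ K y + dualNorm H y)]
  calc (K y + dualNorm H y) * |K y - dualNorm H y| ≤ (2 * R + 1) * (1 / (2 * R + 1)) :=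
        mul_le_mul (by linarith) (h3 y) (abs_nonneg _) (by linarith)
    _ = 1 := by field_simp

end Final

end FinslerHeat

theorem proposition3p1 (N : ℕ) (hN : 1 ≤ N) (ℓ : ℝ) (hℓ_pos : 0 < ℓ) (hℓ_lt : ℓ < 1 / 2) :
    ∃ C T : ℝ, 0 < C ∧ 0 < T ∧ T < 1 ∧
      ∀ H : FinslerHeat.Space N → ℝ, FinslerHeat.IsFinslerNorm H →
      ∀ R : ℝ, 1 ≤ R →
      ∀ φ : FinslerHeat.Space N → ℝ,
        FinslerHeat.IsTestFunction (FinslerHeat.dualBall H 0 R) φ →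
      ∀ u : ℝ → FinslerHeat.L2 (FinslerHeat.dualBall H 0 R),
        FinslerHeat.IsSolution H (FinslerHeat.dualBall H 0 R) φ u →
      ∀ t : ℝ, 0 < t → t ≤ T →
        (⨆ x ∈ FinslerHeat.dualBall H 0 R,
          ∫⁻ y in FinslerHeat.dualBall H 0 R ∩ FinslerHeat.dualBall H x 1,
            ENNReal.ofReal (Real.exp (-FinslerHeat.weight H ℓ y t) * |u t y|))
        ≤ ENNReal.ofReal C *
          ⨆ x ∈ FinslerHeat.dualBall H 0 R,
            ∫⁻ y in FinslerHeat.dualBall H 0 R ∩ FinslerHeat.dualBall H x 1,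
              ENNReal.ofReal (Real.exp (-(FinslerHeat.dualNorm H y ^ 2)) * |φ y|) := by
  have hN' : (1 : ℝ) ≤ N := by exact_mod_cast hN
  obtain ⟨m, hm_def⟩ : ∃ m : ℝ, m = 1 / (2 * N) := ⟨_, rfl⟩
  have hm : 0 < m := by rw [hm_def]; positivity
  have hmN : N * m = 1 / 2 := by rw [hm_def]; field_simp
  have hm2 : m ≤ 1 / 2 := by nlinarith
  obtain ⟨T, hT, hT1, hTm, hTσ, hTg⟩ := FinslerHeat.exists_time hℓ_pos hℓ_lt hm
    (FinslerHeat.massConst N) (Real.exp 1 * (2 ^ N * N.factorial))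
  refine ⟨Real.exp 4 * (2 * (Real.exp 2 * (Real.exp (1 / 4) * (4 ^ N * N.factorial)))), T,
    by positivity, hT, hT1, ?_⟩
  intro H hH R hR
  have hΩ : Bornology.IsBounded (FinslerHeat.dualBall H 0 R) := hH.isBounded_dualBall 0 R
  have hΩm : MeasurableSet (FinslerHeat.dualBall H 0 R) := hH.measurableSet_dualBall 0 R
  obtain ⟨K, hK, hK0, hK1, hKH, hKsq⟩ := hH.exists_smooth_dualNorm_sq (R := R) (by linarith)
  generalize FinslerHeat.dualBall H 0 R = Ω at *
  intro φ hφ u hsol t ht htT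
  set S := ⨆ x ∈ Ω, ∫⁻ y in Ω ∩ FinslerHeat.dualBall H x 1,
    ENNReal.ofReal (Real.exp (-(FinslerHeat.dualNorm H y ^ 2)) * |φ y|) with hS_def
  rcases eq_or_ne S ⊤ with hS | hS
  · rw [hS, ENNReal.mul_top (ENNReal.ofReal_pos.2 (by positivity)).ne']
    exact le_top
  obtain ⟨G, hu, hG, hmem, hu0, hweak⟩ := hsol.exists_gradient hH
  have hle : ∀ x ∈ Ω, ∫⁻ y in Ω ∩ FinslerHeat.dualBall H x 1,
      ENNReal.ofReal (Real.exp (-(FinslerHeat.dualNorm H y ^ 2)) * |φ y|) ≤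
        ENNReal.ofReal S.toReal := fun x hx => by
    rw [ENNReal.ofReal_toReal hS]
    exact le_iSup₂_of_le x hx le_rfl
  have hinit := hH.initial_mass_le hΩ hΩm hK hKH hKsq hφ.contDiff.continuous hu0
    ENNReal.toReal_nonneg hle
  refine iSup₂_le fun x hx => ?_
  refine (hH.ball_mass_le hΩ hΩm hK hKH hKsq (u t) hℓ_pos.le ht.le (htT.trans hT1.le) x).trans ?_
  rw [← ENNReal.ofReal_toReal hS, ← ENNReal.ofReal_mul (by positivity), mul_assoc]
  refine ENNReal.ofReal_le_ofReal (mul_le_mul_of_nonneg_left ?_ (Real.exp_pos 4).le)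
  rw [mul_assoc]
  exact hH.mass_le_two_mul hΩ hΩm hu hG hmem hweak hK hK0 hK1 hKH hℓ_pos hℓ_lt hm hm2 hmN
    hT1.le hTm hTσ hTg (mul_nonneg (by positivity) ENNReal.toReal_nonneg)
    (fun x _ => hinit x) hx ⟨ht.le, htT⟩
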